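/- **Games.** A concurrent game has a finite set of players, a finite set $S$ of states, a finite set $\Gamma$ of actions, for each player $i$ and state $s$ a nonempty set $\Gamma_i(s)\subseteq\Gamma$ of legal actions, a transition function $\delta$ from states and action profiles to states, and reward functions $r_i\colon S\to\mathbb R$. It is *turn-based* if at each state all players but at most one have exactly one legal action, and a *terminal-reward game* if nonzero rewards occur only at terminal states, i.e. states $s$ with $\delta(s,\vec a)=s$ for all legal $\vec a$. A strategy maps each history to a probability distribution over the legal actions at its last state; it is *stationary* if the distribution depends only on the last state. The payoff of a play $s_0\vec a_0s_1\vec a_1\dots$ for player $i$ is $\liminf_{n\to\infty}\frac1n\sum_{j<n}r_i(s_j)$, and the payoff of a strategy profile is the expected value of this quantity. A profile is a Nash equilibrium if no player can increase her expected payoff by unilaterally switching to any other (not necessarily stationary) strategy. **Problems.** StatNE: given a game with rational rewards, an initial state and thresholds $\vec x,\vec y\in(\mathbb Q\cup\{\pm\infty\})^k$, where $k$ is the number of players, is there a stationary Nash equilibrium with payoff $\geq\vec x$ and $\leq\vec y$? SqrtSum: given $d_1,\dots,d_n,k\in\mathbb N$, is $\sum_{i=1}^n\sqrt{d_i}\geq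 k$? In both problems numbers are encoded in binary (rationals as numerator and denominator). **Theorem.** 1. SqrtSum is polynomial-time (many-one) reducible to StatNE for turn-based 8-player terminal-reward games. 2. For $0\le p\le 1$ let $G(p)$ be the following turn-based terminal-reward game with players $0,\dots,5$. It has nonterminal states $s_1,r_1,t_1,u_1,v_1,s_2,r_2,t_2,u_2,v_2$, controlled by players $2,4,5,0,0,3,4,5,0,0$, respectively. At each of them the controlling player either moves on to the next state of this list (from $v_2$ back to $s_1$) or leaves the game by moving to a terminal state belonging to that state. The nonzero rewards $i\colon x$ (player $i$ receives $x$) at these terminal states are: - at $s_1$: $0\colon -1,\ 2\colon 1$; - at $r_1$: $0\colon -1,\ 4\colon 1$; - at $t_1$: $0\colon -1,\ 5\colon 1-p$; - at $u_1$: $1\colon 1,\ 2\colon 1,\ 4\colon 2-p$; - at $v_1$: $2\colon 2,\ 4\colon 1-p,\ 5\colon 1$; - at $s_2$: $0\colon -1,\ 3\colon 1$; - at $r_2$: $0\colon -1,\ 4\colon 1-p$; - at $t_2$: $0\colon -1,\ 5\colon 1$; - at $u_2$: $1\colon 1,\ 3\colon 1,\ 5\colon 2-p$; - at $v_2$: $3\colon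 2,\ 4\colon 1,\ 5\colon 1-p$. Then the maximal payoff that player 1 receives in a stationary Nash equilibrium of $(G(p),s_1)$ in which player 0 receives payoff $\geq 0$ exists and equals $\sqrt p$. -/

import Mathlib

open MeasureTheory ProbabilityTheory

/-! ### Concurrent games -/

/-- A concurrent game with players `ι`, states `S` and actions `A` (all finite sets). -/
structure ConcurrentGame (ι S A : Type*) where
  /-- `legal i s` is the set of actions that are available to player `i` at state `s`. -/
  legal : ι → S → Finset A
  legal_nonempty : ∀ i s, (legal i s).Nonempty
  /-- The transition function. -/
  trans : S → (ι → A) → S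
  /-- The reward that a state gives to a player. -/
  reward : ι → S → ℝ

/-- One stage of a play: the current state and the action profile chosen there. -/
def Stage (ι S A : Type*) := S × (ι → A)

instance (ι S A : Type*) : MeasurableSpace (Stage ι S A) := ⊤

instance (ι S A : Type*) : DiscreteMeasurableSpace (Stage ι S A) :=
  ⟨fun _ => MeasurableSpace.measurableSet_top⟩

instance (ι S A : Type*) [Finite ι] [Finite S] [Finite A] : Finite (Stage ι S A) :=
  inferInstanceAs (Finite (S × (ι → A)))

namespace ConcurrentGame

section Basic

variable {ι S A : Type*} (G : ConcurrentGame ι S A)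

/-- All players but one have exactly one available action at `s`. -/
def IsControlledBy (s : S) (i : ι) : Prop :=
  ∀ j, j ≠ i → (G.legal j s).card = 1

def IsTurnBased : Prop :=
  ∀ s, ∃ i, G.IsControlledBy s i

def IsTerminal (s : S) : Prop :=
  ∀ a : ι → A, (∀ i, a i ∈ G.legal i s) → G.trans s a = s

/-- Nonzero rewards occur only at terminal states. -/
def IsTerminalReward : Prop :=
  ∀ i s, G.reward i s ≠ 0 → G.IsTerminal s

/-- A randomised strategy for player `i`. The history `s₀ a₀ s₁ a₁ … sₙ` is given as the list
`[(s₀, a₀), …, (sₙ₋₁, aₙ₋₁)]` of the completed stages, oldest first, and the last state `sₙ`. -/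
def Strategy (i : ι) :=
  {σ : List (Stage ι S A) → S → PMF A // ∀ x s a, σ x s a ≠ 0 → a ∈ G.legal i s}

abbrev Profile := ∀ i, G.Strategy i

variable {G}

/-- The choice of the strategy depends on the last state only. -/
def Strategy.IsStationary {i : ι} (σ : G.Strategy i) : Prop :=
  ∀ x y s, σ.1 x s = σ.1 y s

def Profile.IsStationary (σ : G.Profile) : Prop :=
  ∀ i, (σ i).IsStationary

variable (G)

/-- The limit-average payoff of a play for player `i`. -/
noncomputable def playPayoff (i : ι) (π : ℕ → Stage ι S A) : ℝ :=
  Filter.liminf (fun n : ℕ => (1 / (n : ℝ)) * ∑ j ∈ Finset.range n, G.reward i (π j).1)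
    Filter.atTop

end Basic

section Probability

variable {ι S A : Type*} [Fintype ι] [DecidableEq ι] [Finite S] [Fintype A]
  {G : ConcurrentGame ι S A}

/-- The players choose their actions independently. -/
noncomputable def Profile.actionLaw (σ : G.Profile) (x : List (Stage ι S A)) (s : S) :
    PMF (ι → A) :=
  PMF.ofFintype (fun a => ∏ i, (σ i).1 x s (a i)) (by
    classical
    have h := Finset.prod_univ_sum (fun _ : ι => (Finset.univ : Finset A))
      (fun i a => (σ i).1 x s a)
    rw [Fintype.piFinset_univ] at h
    rw [← h]
    refine Finset.prod_eq_one fun i _ => ?_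
    rw [← tsum_fintype (L := SummationFilter.unconditional A)]
    exact ((σ i).1 x s).tsum_coe)

/-- The law of the stage that is played at the state `s` after the completed stages `x`. -/
noncomputable def Profile.stageLaw (σ : G.Profile) (x : List (Stage ι S A)) (s : S) :
    PMF (Stage ι S A) :=
  (σ.actionLaw x s).map fun a => (s, a)

/-- The law of stage `n + 1`, given the stages `0, …, n`. -/
noncomputable def Profile.stageKernel (σ : G.Profile) (n : ℕ) :
    Kernel ((_i : Finset.Iic n) → Stage ι S A) (Stage ι S A) :=
  Kernel.ofFunOfCountable fun x =>
    (σ.stageLaw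
      (List.ofFn fun j : Fin (n + 1) =>
        x ⟨j, Finset.mem_Iic.2 (Nat.lt_succ_iff.1 j.2)⟩)
      (G.trans (x ⟨n, Finset.mem_Iic.2 le_rfl⟩).1 (x ⟨n, Finset.mem_Iic.2 le_rfl⟩).2)).toMeasure

instance (σ : G.Profile) (n : ℕ) : IsMarkovKernel (σ.stageKernel n) :=
  ⟨fun x => by
    change IsProbabilityMeasure (PMF.toMeasure _)
    infer_instance⟩

/-- The probability measure on plays that the profile `σ` induces from the initial state `s₀`. -/
noncomputable def Profile.playMeasure (σ : G.Profile) (s₀ : S) : Measure (ℕ → Stage ι S A) :=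
  Kernel.trajMeasure (X := fun _ => Stage ι S A) (σ.stageLaw [] s₀).toMeasure σ.stageKernel

/-- The expected payoff of the profile `σ` for player `i` from the initial state `s₀`. -/
noncomputable def Profile.payoff (σ : G.Profile) (s₀ : S) (i : ι) : ℝ :=
  ∫ π, G.playPayoff i π ∂(σ.playMeasure s₀)

/-- No player can gain by a unilateral deviation to any strategy, stationary or not. -/
def Profile.IsNashEquilibrium (σ : G.Profile) (s₀ : S) : Prop :=
  ∀ (i : ι) (τ : G.Strategy i),
    Profile.payoff (Function.update σ i τ) s₀ i ≤ σ.payoff s₀ i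

end Probability

end ConcurrentGame

/-! ### Instances of the decision problems -/

/-- The value of a fraction that is given by its numerator and its positive denominator. -/
noncomputable def fracValue (x : ℤ × ℕ+) : ℝ := (x.1 : ℝ) / ((x.2 : ℕ) : ℝ)

/-- A threshold in `ℚ ∪ {±∞}`. -/
inductive Threshold where
  | negInf
  | frac (x : ℤ × ℕ+)
  | posInf

noncomputable def Threshold.value : Threshold → EReal
  | .negInf => ⊥
  | .frac x => (fracValue x : EReal)
  | .posInf => ⊤

/-- A finite description of an initialised concurrent `k`-player game with rational rewards,
together with a lower and an upper threshold for each player. The actions are numbered in such a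
way that the available actions of each player at each state are an initial segment. -/
structure GameInstance (k : ℕ) where
  numStates : ℕ
  numActions : ℕ
  /-- At state `s`, player `i` may play the actions `0, …, maxAction s i`. -/
  maxAction : Fin numStates → Fin k → Fin numActions
  /-- The successor of a state for each legal action profile. The profiles at `s` are listed in
  the order given by `finPiFinEquiv`. -/
  table : (s : Fin numStates) → Fin (∏ i, ((maxAction s i : ℕ) + 1)) → Fin numStates
  reward : Fin numStates → Fin k → ℤ × ℕ+
  init : Fin numStates
  lower : Fin k → Threshold
  upper : Fin k → Threshold

/-- The concurrent game that is described by an instance. -/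
noncomputable def GameInstance.game {k : ℕ} (I : GameInstance k) :
    ConcurrentGame (Fin k) (Fin I.numStates) (Fin I.numActions) where
  legal i s := Finset.univ.filter fun a => a ≤ I.maxAction s i
  legal_nonempty i s := ⟨I.maxAction s i, by simp⟩
  trans s a :=
    if h : ∀ i, a i ≤ I.maxAction s i then
      I.table s (finPiFinEquiv fun i => ⟨a i, Nat.lt_succ_of_le (h i)⟩)
    else s
  reward i s := fracValue (I.reward s i)

/-- The decision problem StatNE for `k` players: does the game have a stationary Nash equilibrium
whose payoff lies between the thresholds? -/
def StatNE (k : ℕ) : Set (GameInstance k) :=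
  {I | ∃ σ : I.game.Profile, σ.IsStationary ∧ σ.IsNashEquilibrium I.init ∧
    ∀ i, (I.lower i).value ≤ (σ.payoff I.init i : EReal) ∧
      (σ.payoff I.init i : EReal) ≤ (I.upper i).value}

/-- The decision problem SqrtSum: given `d₁, …, dₙ, k`, is `√d₁ + ⋯ + √dₙ ≥ k`? -/
def SqrtSum : Set (List ℕ × ℕ) :=
  {x | (x.2 : ℝ) ≤ (x.1.map fun d : ℕ => Real.sqrt (d : ℝ)).sum}

/-! ### Encoding of instances as words over a finite alphabet, numbers in binary -/

namespace Code

open Computability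

/-- A code that can be read off uniquely from the front of a word. -/
def UniquelyReadable {α : Type*} (e : α → List Γ') : Prop :=
  ∀ a b s t, e a ++ s = e b ++ t → a = b ∧ s = t

/-- The binary digits, least significant first, followed by an end mark. -/
def nat (n : ℕ) : List Γ' := (encodeNat n).map Γ'.bit ++ [Γ'.blank]

/-- A sign bit followed by the absolute value. -/
def int (z : ℤ) : List Γ' := Γ'.bit (decide (z < 0)) :: nat z.natAbs

def prod {α β : Type*} (e : α → List Γ') (f : β → List Γ') (x : α × β) : List Γ' :=
  e x.1 ++ f x.2

/-- The items, each one preceded by a comma, followed by a closing bracket. -/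
def list {α : Type*} (e : α → List Γ') : List α → List Γ'
  | [] => [Γ'.ket]
  | a :: l => Γ'.comma :: (e a ++ list e l)

def frac : ℤ × ℕ+ → List Γ' := prod int fun q => nat q

def threshold : Threshold → List Γ'
  | .negInf => [Γ'.bra]
  | .frac x => Γ'.comma :: frac x
  | .posInf => [Γ'.ket]

/-- A state is written as the number of the last available action of each player, the table of its
successors and its rewards. -/
def state : List ℕ × List ℕ × List (ℤ × ℕ+) → List Γ' :=
  prod (list nat) (prod (list nat) (list frac))

def sqrtSumInstance : List ℕ × ℕ → List Γ' := prod (list nat) nat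

def gameInstance {k : ℕ} (I : GameInstance k) : List Γ' :=
  prod nat (prod (list state) (prod nat (prod (list threshold) (list threshold))))
    (I.numActions,
     List.ofFn fun s : Fin I.numStates =>
      (List.ofFn fun i => ((I.maxAction s i : Fin I.numActions) : ℕ),
       List.ofFn fun a => ((I.table s a : Fin I.numStates) : ℕ),
       List.ofFn fun i => I.reward s i),
     (I.init : ℕ),
     List.ofFn I.lower,
     List.ofFn I.upper)

theorem uniquelyReadable_nat : UniquelyReadable nat := by
  have key : ∀ (l m : List Bool) (s t : List Γ'),
      l.map Γ'.bit ++ (Γ'.blank :: s) = m.map Γ'.bit ++ (Γ'.blank :: t) → l = m ∧ s = t := by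
    intro l
    induction l with
    | nil => intro m s t h; cases m <;> simp_all
    | cons b l ih =>
      intro m s t h
      cases m with
      | nil => simp at h
      | cons c m =>
        simp only [List.map_cons, List.cons_append, List.cons.injEq, Γ'.bit.injEq] at h
        obtain ⟨h1, h2⟩ := ih m s t h.2
        exact ⟨by rw [h.1, h1], h2⟩
  intro a b s t h
  simp only [nat, List.append_assoc, List.singleton_append] at h
  obtain ⟨h1, h2⟩ := key _ _ _ _ h
  exact ⟨encodingNatBool.encode_injective h1, h2⟩

theorem UniquelyReadable.prod {α β : Type*} {e : α → List Γ'} {f : β → List Γ'}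
    (he : UniquelyReadable e) (hf : UniquelyReadable f) : UniquelyReadable (prod e f) := by
  rintro ⟨a, b⟩ ⟨a', b'⟩ s t h
  simp only [Code.prod, List.append_assoc] at h
  obtain ⟨rfl, h₁⟩ := he _ _ _ _ h
  obtain ⟨rfl, h₂⟩ := hf _ _ _ _ h₁
  exact ⟨rfl, h₂⟩

theorem UniquelyReadable.list {α : Type*} {e : α → List Γ'} (he : UniquelyReadable e) :
    UniquelyReadable (list e) := by
  intro a
  induction a with
  | nil => intro b s t h; cases b <;> simp_all [Code.list]
  | cons a l ih =>
    intro b s t h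
    cases b with
    | nil => simp [Code.list] at h
    | cons b m =>
      simp only [Code.list, List.cons_append, List.append_assoc, List.cons.injEq, true_and] at h
      obtain ⟨rfl, h₁⟩ := he _ _ _ _ h
      obtain ⟨rfl, h₂⟩ := ih _ _ _ h₁
      exact ⟨rfl, h₂⟩

theorem uniquelyReadable_frac : UniquelyReadable frac := by
  refine UniquelyReadable.prod ?_ ?_
  · intro a b s t h
    simp only [int, List.cons_append, List.cons.injEq, Γ'.bit.injEq, decide_eq_decide] at h
    obtain ⟨h1, h2⟩ := uniquelyReadable_nat _ _ _ _ h.2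
    exact ⟨by omega, h2⟩
  · intro a b s t h
    obtain ⟨h1, h2⟩ := uniquelyReadable_nat _ _ _ _ h
    exact ⟨PNat.coe_injective h1, h2⟩

theorem uniquelyReadable_threshold : UniquelyReadable threshold := by
  intro a b s t h
  cases a <;> cases b <;> simp [threshold] at h ⊢
  · exact h
  · exact uniquelyReadable_frac _ _ _ _ h
  · exact h

theorem sqrtSumInstance_injective : Function.Injective sqrtSumInstance := fun a b h =>
  (uniquelyReadable_nat.list.prod uniquelyReadable_nat a b [] [] (congrArg (· ++ []) h)).1

theorem gameInstance_injective {k : ℕ} :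
    Function.Injective (gameInstance : GameInstance k → List Γ') := by
  rintro ⟨N, m, c, T, r, i, lo, up⟩ ⟨N', m', c', T', r', i', lo', up'⟩ h
  have hs : UniquelyReadable state :=
    uniquelyReadable_nat.list.prod (uniquelyReadable_nat.list.prod uniquelyReadable_frac.list)
  have h := (uniquelyReadable_nat.prod (hs.list.prod (uniquelyReadable_nat.prod
    (uniquelyReadable_threshold.list.prod uniquelyReadable_threshold.list))) _ _ [] []
    (congrArg (· ++ []) h)).1
  simp only [Prod.mk.injEq] at h
  obtain ⟨rfl, hst, hi, hlo, hup⟩ := h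
  obtain rfl : N = N' := by simpa using congrArg List.length hst
  have hst := List.ofFn_injective hst
  simp only [funext_iff, Prod.mk.injEq] at hst
  obtain rfl : c = c' := by
    funext s j
    exact Fin.ext (congrFun (List.ofFn_injective (hst s).1) j)
  obtain rfl : T = T' := by
    funext s j
    exact Fin.ext (congrFun (List.ofFn_injective (hst s).2.1) j)
  obtain rfl : r = r' := by
    funext s j
    exact congrFun (List.ofFn_injective (hst s).2.2) j
  obtain rfl := Fin.ext hi
  obtain rfl := List.ofFn_injective hlo
  obtain rfl := List.ofFn_injective hup
  rfl

end Code

/-! ### Polynomial-time reductions -/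

/-- The problem `A`, whose instances are encoded by `ea`, is polynomial-time many-one reducible to
the problem `B`, encoded by `eb`, restricted to the instances in `P`. -/
def PolyTimeReducible {α β Γ₁ Γ₂ : Type} (ea : α → List Γ₁) (eb : β → List Γ₂)
    (A : Set α) (B : Set β) (P : Set β) : Prop :=
  ∃ f : α → β, Nonempty (Turing.TM2ComputableInPolyTime ea eb f) ∧
    ∀ x, f x ∈ P ∧ (x ∈ A ↔ f x ∈ B)

/-! ### The games `G(p)` -/

namespace SqrtGame

/-- The nonterminal states, in their cyclic order. -/
inductive Node where
  | s₁ | r₁ | t₁ | u₁ | v₁ | s₂ | r₂ | t₂ | u₂ | v₂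
  deriving DecidableEq

open Node

instance : Fintype Node :=
  ⟨{s₁, r₁, t₁, u₁, v₁, s₂, r₂, t₂, u₂, v₂}, fun x => by cases x <;> decide⟩

def next : Node → Node
  | s₁ => r₁ | r₁ => t₁ | t₁ => u₁ | u₁ => v₁ | v₁ => s₂
  | s₂ => r₂ | r₂ => t₂ | t₂ => u₂ | u₂ => v₂ | v₂ => s₁

def controller : Node → Fin 6
  | s₁ => 2 | r₁ => 4 | t₁ => 5 | u₁ => 0 | v₁ => 0
  | s₂ => 3 | r₂ => 4 | t₂ => 5 | u₂ => 0 | v₂ => 0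

/-- The rewards for the players `0, …, 5` at the terminal state that can be entered from the given
node. -/
def exitReward (p : ℝ) : Node → Fin 6 → ℝ
  | s₁ => ![-1, 0, 1, 0, 0, 0]
  | r₁ => ![-1, 0, 0, 0, 1, 0]
  | t₁ => ![-1, 0, 0, 0, 0, 1 - p]
  | u₁ => ![0, 1, 1, 0, 2 - p, 0]
  | v₁ => ![0, 0, 2, 0, 1 - p, 1]
  | s₂ => ![-1, 0, 0, 1, 0, 0]
  | r₂ => ![-1, 0, 0, 0, 1 - p, 0]
  | t₂ => ![-1, 0, 0, 0, 0, 1]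
  | u₂ => ![0, 1, 0, 1, 0, 2 - p]
  | v₂ => ![0, 0, 0, 2, 1, 1 - p]

inductive State where
  | node (x : Node)
  | exit (x : Node)
  deriving DecidableEq, Fintype

/-- At each node the controlling player either leaves the game by going to the terminal state of
the node (action `true`), or moves on to the next node (action `false`). -/
def game (p : ℝ) : ConcurrentGame (Fin 6) State Bool where
  legal i
    | .node x => if i = controller x then {false, true} else {false}
    | .exit _ => {false}
  legal_nonempty i s := by
    cases s with
    | node x => exact ⟨false, by dsimp only; split <;> simp⟩
    | exit x => exact ⟨false, by simp⟩
  trans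
    | .node x, a => if a (controller x) then .exit x else .node (next x)
    | .exit x, _ => .exit x
  reward i
    | .node _ => 0
    | .exit x => exitReward p x i

end SqrtGame

/-! In a terminal-reward game the rewards along almost every play are eventually constant, and the
payoff is this limit. For a stationary profile the payoffs are therefore limits of the iterated
one-step expectation applied to the rewards (`tendsto_iterate_next`), which makes them solve a
linear recursion. Two facts link this to equilibria. In a stationary equilibrium, moving to a
terminal state cannot pay at a state that is reached (`IsDriven.reward_le_payoff`). Conversely, a
profile is an equilibrium if its payoffs dominate functions that are superharmonic under every
deviation (`IsDriven.isNashEquilibrium`).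

The games `G(p)`. Player 0 has no positive reward, so payoff at least 0 means payoff 0 at every
state that is reached, and the players 2 to 5 never use their exits. Those exits act as threats,
that is, as lower bounds on their payoffs. Let `a` and `b` be the probabilities that player 0 leaves
in the first and in the second half of the cycle, once there. At each of player 0's exits the
rewards of players 4 and 5 add up to `2 - p`, which is also the sum of their bounds; hence these
bounds are equalities in both halves. Solving them gives player 1 the payoff `p (2 - a) / (a + b - a
b)`, and the bounds of players 2 and 3 become `p ≤ a - b + a b` and `p ≤ b - a + a b`. These force
`√p ≤ min a b`, hence a payoff of at most `√p` (`sqrt_bound_of_system`). For `0 < p` the choice `a =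
b = √p` is an equilibrium that attains it (`exists_isOptimal`).

The reduction. For numbers `d₁, …, dₙ` a chain of blocks `n, …, 1, 0` is built. Block `b` contains a
copy of `G(p)` with `p = d_b / 4ᵉ`, where `e` is the input length plus `b`, so that `√p = 2⁻ᵉ √d_b`.
At its entrance player 6 may leave with reward `2⁻ᵉ`, then player 7 with `-2⁻ᵉ`, both punishing
player 0; then player 0 chooses between the copy and the entrance of block `b - 1`. As the players 6
and 7 have opposite payoffs, player 6 gets exactly `2⁻ᵉ` in an equilibrium with payoff 0 for player
0. The copy gives player 6 nothing and the next entrance gives `2 · 2⁻ᵉ`, so the choice is fair.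
Unrolling the chain, player 1 gets at most `∑ √d_j` times a fixed power of two, with equality
attainable (`value_entrance`, `mem_statNE_of_mem_sqrtSum`); the threshold is `k` times that power.

Polynomial time. A small structured language is compiled to stack machines. All blocks except block
0 have the same text up to a few binary numerals kept on stacks, so a fixed program writes one block
per input number (`runs_reduction`). -/

section

open Filter Topology
set_option linter.unusedSectionVars false

/-! ### Expectations along plays and the payoff as a limit -/

namespace ConcurrentGame

section Play

variable {ι S A : Type*} [Fintype ι] [DecidableEq ι] [Finite S] [Fintype A]
  {G : ConcurrentGame ι S A}

/-- The expected value of `f` at the next state. -/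
noncomputable def Profile.next (σ : G.Profile) (x : List (Stage ι S A)) (s : S) (f : S → ℝ) : ℝ :=
  ∑ a, (σ.actionLaw x s a).toReal * f (G.trans s a)

/-- The state that follows a stage. -/
def after (G : ConcurrentGame ι S A) (z : Stage ι S A) : S := G.trans z.1 z.2

/-- The stage at which the actions `a` are played in the state `s`. -/
def toStage (s : S) (a : ι → A) : Stage ι S A := (s, a)

theorem stageLaw_eq_map (σ : G.Profile) (x : List (Stage ι S A)) (s : S) :
    σ.stageLaw x s = (σ.actionLaw x s).map (toStage s) := rfl

theorem integral_stageLaw (σ : G.Profile) (x : List (Stage ι S A)) (s : S) (f : S → ℝ) :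
    ∫ z, f (G.after z) ∂(σ.stageLaw x s).toMeasure = σ.next x s f := by
  classical
  let _ : MeasurableSpace (ι → A) := ⊤
  have : DiscreteMeasurableSpace (ι → A) := ⟨fun _ => MeasurableSpace.measurableSet_top⟩
  have hm : Measurable (toStage s : (ι → A) → Stage ι S A) := measurable_from_top
  rw [stageLaw_eq_map, ← PMF.toMeasure_map _ _ hm, integral_map hm.aemeasurable
    (Measurable.of_discrete.aestronglyMeasurable), PMF.integral_eq_sum]
  rfl

theorem ae_stageLaw (σ : G.Profile) (x : List (Stage ι S A)) (s : S) :
    ∀ᵐ z ∂(σ.stageLaw x s).toMeasure, z.1 = s ∧ ∀ i, z.2 i ∈ G.legal i s := by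
  classical
  rw [ae_iff, PMF.toMeasure_apply_eq_zero_iff _ (MeasurableSet.of_discrete), Set.disjoint_left]
  rintro z hz hn
  apply hn
  rw [stageLaw_eq_map, PMF.mem_support_map_iff] at hz
  obtain ⟨a, ha, rfl⟩ := hz
  refine ⟨rfl, fun i => (σ i).2 x s _ ?_⟩
  rw [PMF.mem_support_iff] at ha
  simp only [Profile.actionLaw, PMF.ofFintype_apply] at ha
  exact fun h => ha (Finset.prod_eq_zero (Finset.mem_univ i) h)

/-- The completed stages of a play up to time `n`. -/
def history (n : ℕ) (π : ℕ → Stage ι S A) : List (Stage ι S A) :=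
  List.ofFn fun j : Fin (n + 1) => π j

theorem stageKernel_frestrictLe (σ : G.Profile) (n : ℕ) (π : ℕ → Stage ι S A) :
    σ.stageKernel n (Preorder.frestrictLe n π) =
      (σ.stageLaw (history n π) (G.after (π n))).toMeasure := rfl

instance (σ : G.Profile) (s₀ : S) : IsProbabilityMeasure (σ.playMeasure s₀) := by
  unfold Profile.playMeasure; infer_instance

theorem map_playMeasure_zero (σ : G.Profile) (s₀ : S) :
    (σ.playMeasure s₀).map (fun π => π 0) = (σ.stageLaw [] s₀).toMeasure := by
  have h1 : (fun π : ℕ → Stage ι S A => π 0) =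
      (MeasurableEquiv.piUnique (fun _ : Finset.Iic 0 => Stage ι S A)) ∘
        (Preorder.frestrictLe 0) := rfl
  rw [h1, ← Measure.map_map (by fun_prop) (by fun_prop), Profile.playMeasure, Kernel.trajMeasure,
    Measure.map_comp _ _ (by fun_prop), Kernel.traj_map_frestrictLe, Kernel.partialTraj_self,
    Measure.id_comp]
  exact MeasurableEquiv.map_map_symm _

theorem compProd_playMeasure (σ : G.Profile) (s₀ : S) (n : ℕ) :
    (σ.playMeasure s₀).map (Preorder.frestrictLe n) ⊗ₘ σ.stageKernel n =
      (σ.playMeasure s₀).map (fun π => (Preorder.frestrictLe n π, π (n + 1))) :=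
  Kernel.map_frestrictLe_trajMeasure_compProd_eq_map_trajMeasure

theorem integrable_play (σ : G.Profile) (s₀ : S) {B : Type*} [Finite B] (g : (ℕ → Stage ι S A) → B)
    (hg : ∀ b, MeasurableSet (g ⁻¹' {b})) (f : B → ℝ) :
    Integrable (fun π => f (g π)) (σ.playMeasure s₀) := by
  let _ : MeasurableSpace B := ⊤
  have hg : Measurable g := measurable_to_countable' hg
  obtain ⟨C, hC⟩ := (Set.finite_range fun b => ‖f b‖).bddAbove
  exact Integrable.of_bound ((measurable_from_top (f := f)).comp hg).aestronglyMeasurable C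
    (ae_of_all _ fun π => hC ⟨g π, rfl⟩)

theorem integrable_stage (σ : G.Profile) (s₀ : S) (n : ℕ) (f : Stage ι S A → ℝ) :
    Integrable (fun π => f (π n)) (σ.playMeasure s₀) :=
  integrable_play σ s₀ (fun π => π n)
    (fun _ => measurableSet_preimage (measurable_pi_apply n) MeasurableSet.of_discrete) f

theorem integral_after_zero (σ : G.Profile) (s₀ : S) (f : S → ℝ) :
    ∫ π, f (G.after (π 0)) ∂(σ.playMeasure s₀) = σ.next [] s₀ f := by
  rw [← integral_stageLaw, ← map_playMeasure_zero, integral_map (measurable_pi_apply 0).aemeasurable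
    (Measurable.of_discrete.aestronglyMeasurable)]

/-- The Markov step: disintegrate the joint law of the stages `0, …, n` and of stage `n + 1` along
the kernel; the inner integral is `next`. Integrability holds because only finitely many histories
of a given length exist. -/
theorem integral_after_succ (σ : G.Profile) (s₀ : S) (f : S → ℝ) (n : ℕ) :
    Integrable (fun π => σ.next (history n π) (G.after (π n)) f) (σ.playMeasure s₀) ∧
    ∫ π, f (G.after (π (n + 1))) ∂(σ.playMeasure s₀) =
      ∫ π, σ.next (history n π) (G.after (π n)) f ∂(σ.playMeasure s₀) := by
  have hd : Measurable fun q : (Finset.Iic n → Stage ι S A) × Stage ι S A => f (G.after q.2) :=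
    (Measurable.of_discrete (f := fun z => f (G.after z))).comp measurable_snd
  constructor
  · refine integrable_play σ s₀ (fun π => Preorder.frestrictLe n π)
      (fun b => measurableSet_preimage (by fun_prop) MeasurableSet.of_discrete)
      (fun x : Finset.Iic n → Stage ι S A => σ.next
        (List.ofFn fun j : Fin (n + 1) => x ⟨j, Finset.mem_Iic.2 (Nat.lt_succ_iff.1 j.2)⟩)
        (G.after (x ⟨n, Finset.mem_Iic.2 le_rfl⟩)) f)
  have h := integrable_stage σ s₀ (n + 1) (fun z => f (G.after z))
  have hp : Measurable fun π : ℕ → Stage ι S A => (Preorder.frestrictLe n π, π (n + 1)) := by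
    fun_prop
  have h2 : Integrable (fun q : (Finset.Iic n → Stage ι S A) × Stage ι S A => f (G.after q.2))
      ((σ.playMeasure s₀).map (fun π => (Preorder.frestrictLe n π, π (n + 1)))) :=
    (integrable_map_measure hd.aestronglyMeasurable hp.aemeasurable).2 h
  have e1 : ∫ π, f (G.after (π (n + 1))) ∂(σ.playMeasure s₀) =
      ∫ q, f (G.after q.2)
        ∂((σ.playMeasure s₀).map (fun π => (Preorder.frestrictLe n π, π (n + 1)))) :=
    (integral_map hp.aemeasurable hd.aestronglyMeasurable).symm
  rw [← compProd_playMeasure] at e1 h2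
  rw [e1, Measure.integral_compProd h2, integral_map (by fun_prop)
    (Measurable.of_discrete.aestronglyMeasurable)]
  simp_rw [stageKernel_frestrictLe, integral_stageLaw]

/-- Allows pathwise arguments: outside a null set a play follows the transition function and uses
legal actions only. -/
theorem ae_legal_play (σ : G.Profile) (s₀ : S) :
    ∀ᵐ π ∂(σ.playMeasure s₀), (π 0).1 = s₀ ∧
      ∀ n, (π (n + 1)).1 = G.after (π n) ∧ ∀ i, (π n).2 i ∈ G.legal i (π n).1 := by
  have h0 : ∀ᵐ π ∂(σ.playMeasure s₀), (π 0).1 = s₀ ∧ ∀ i, (π 0).2 i ∈ G.legal i (π 0).1 := by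
    have := ae_stageLaw σ [] s₀
    rw [← map_playMeasure_zero] at this
    filter_upwards [ae_of_ae_map (measurable_pi_apply 0).aemeasurable this] with π h
    exact ⟨h.1, fun i => by rw [h.1]; exact h.2 i⟩
  have h1 : ∀ n, ∀ᵐ π ∂(σ.playMeasure s₀),
      (π (n + 1)).1 = G.after (π n) ∧ ∀ i, (π (n + 1)).2 i ∈ G.legal i (π (n + 1)).1 := by
    intro n
    have h : ∀ᵐ q ∂((σ.playMeasure s₀).map (fun π => (Preorder.frestrictLe n π, π (n + 1)))),
        q.2.1 = G.after (q.1 ⟨n, Finset.mem_Iic.2 le_rfl⟩) ∧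
          ∀ i, q.2.2 i ∈ G.legal i q.2.1 := by
      rw [← compProd_playMeasure]
      refine (Measure.ae_compProd_iff ?_).2 (ae_of_all _ fun x => ?_)
      · exact MeasurableSet.of_discrete
      · filter_upwards [ae_stageLaw σ _ _] with z hz
        exact ⟨hz.1, fun i => by rw [hz.1]; exact hz.2 i⟩
    filter_upwards [ae_of_ae_map (by fun_prop) h] with π h
    exact h
  filter_upwards [h0, ae_all_iff.2 h1] with π h0 h1
  refine ⟨h0.1, fun n => ⟨(h1 n).1, ?_⟩⟩
  cases n with
  | zero => exact h0.2
  | succ n => exact (h1 n).2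

theorem integral_state_succ (σ : G.Profile) (s₀ : S) (f : S → ℝ) (n : ℕ) :
    ∫ π, f (π (n + 1)).1 ∂(σ.playMeasure s₀) = ∫ π, f (G.after (π n)) ∂(σ.playMeasure s₀) := by
  refine integral_congr_ae ?_
  filter_upwards [ae_legal_play σ s₀] with π h
  rw [(h.2 n).1]

theorem integral_after_le (σ : G.Profile) (s₀ : S) (h : S → ℝ) (hh : ∀ x s, σ.next x s h ≤ h s)
    (n : ℕ) : ∫ π, h (G.after (π n)) ∂(σ.playMeasure s₀) ≤ h s₀ := by
  induction n with
  | zero => rw [integral_after_zero]; exact hh _ _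
  | succ n ih =>
    refine le_trans ?_ ih
    rw [(integral_after_succ σ s₀ h n).2]
    exact integral_mono (integral_after_succ σ s₀ h n).1
      (integrable_stage σ s₀ n fun z => h (G.after z)) fun π => hh _ _

/-- Stationarity removes the history from `next`, so the Markov step iterates one fixed operator.
The exponent is `n + 1` because the state after stage `n` is the state with index `n + 1`. -/
theorem integral_after_stationary (σ : G.Profile) (hσ : σ.IsStationary) (s₀ : S) (n : ℕ)
    (f : S → ℝ) : ∫ π, f (G.after (π n)) ∂(σ.playMeasure s₀) =
      (fun f s => σ.next [] s f)^[n + 1] f s₀ := by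
  induction n generalizing f with
  | zero => rw [integral_after_zero]; rfl
  | succ n ih =>
    rw [(integral_after_succ σ s₀ f n).2, Function.iterate_succ_apply, ← ih]
    refine integral_congr_ae (ae_of_all _ fun π => ?_)
    simp only [Profile.next, Profile.actionLaw, PMF.ofFintype_apply]
    simp_rw [fun i => hσ i (history n π) []]

/-- Either all rewards on the play vanish, or a nonzero one occurs; its state is then terminal and
the play stays there. A Cesàro mean of an eventually constant sequence converges to that constant.
-/
theorem IsTerminalReward.ae_eventually_eq (hG : G.IsTerminalReward) (i : ι) (σ : G.Profile)
    (s₀ : S) : ∀ᵐ π ∂(σ.playMeasure s₀), ∀ᶠ n in atTop, G.reward i (π n).1 = G.playPayoff i π := by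
  filter_upwards [ae_legal_play σ s₀] with π h
  obtain ⟨c, hc⟩ : ∃ c, ∀ᶠ n in atTop, G.reward i (π n).1 = c := by
    by_cases h0 : ∀ n, G.reward i (π n).1 = 0
    · exact ⟨0, Eventually.of_forall h0⟩
    · push Not at h0
      obtain ⟨n, hn⟩ := h0
      have ht := hG i _ hn
      refine ⟨G.reward i (π n).1, eventually_atTop.2 ⟨n, fun m hm => ?_⟩⟩
      congr 1
      induction m, hm using Nat.le_induction with
      | base => rfl
      | succ m hm ih =>
        rw [(h.2 m).1, after, ih, ht]
        rw [← ih]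
        exact (h.2 m).2
  filter_upwards [hc] with n hn
  rw [hn, playPayoff]
  refine (Tendsto.liminf_eq ?_).symm
  simpa using (tendsto_const_nhds.congr' (hc.mono fun n hn => hn.symm)).cesaro

/-- Dominated convergence. The function `f` need not be the reward itself; agreement in the long run
is enough, which permits truncation by a superharmonic function. -/
theorem integral_tendsto_payoff (hG : G.IsTerminalReward) (i : ι) (σ : G.Profile) (s₀ : S)
    (f : S → ℝ)
    (hf : ∀ᵐ π ∂(σ.playMeasure s₀), ∀ᶠ n in atTop, f (π n).1 = G.reward i (π n).1) :
    Tendsto (fun n => ∫ π, f (π n).1 ∂(σ.playMeasure s₀)) atTop (𝓝 (σ.payoff s₀ i)) := by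
  obtain ⟨C, hC⟩ := (Set.finite_range fun s => ‖f s‖).bddAbove
  refine tendsto_integral_of_dominated_convergence (fun _ => C) ?_ (integrable_const _) ?_ ?_
  · exact fun n => (integrable_stage σ s₀ n fun z => f z.1).aestronglyMeasurable
  · exact fun n => ae_of_all _ fun π => hC ⟨_, rfl⟩
  · filter_upwards [hG.ae_eventually_eq i σ s₀, hf] with π h1 h2
    refine tendsto_const_nhds.congr' ?_
    filter_upwards [h1, h2] with n h1 h2
    rw [h2, h1]

/-- A superharmonic function bounds the payoff, if it bounds the reward outside a set of states
that every play leaves for good. -/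
theorem payoff_le_of_next_le (hG : G.IsTerminalReward) (i : ι) (σ : G.Profile) (s₀ : S)
    (h : S → ℝ) (hh : ∀ x s, σ.next x s h ≤ h s) (ρ : S → ℕ)
    (hρ : ∀ s a, (∀ i, a i ∈ G.legal i s) → ρ (G.trans s a) ≤ ρ s ∧
      (h s < G.reward i s → ρ (G.trans s a) < ρ s)) :
    σ.payoff s₀ i ≤ h s₀ := by
  have hev : ∀ᵐ π ∂(σ.playMeasure s₀), ∀ᶠ n in atTop,
      min (h (π n).1) (G.reward i (π n).1) = G.reward i (π n).1 := by
    filter_upwards [ae_legal_play σ s₀] with π hπ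
    have hstep : ∀ n, ρ (π (n + 1)).1 ≤ ρ (π n).1 ∧
        (h (π n).1 < G.reward i (π n).1 → ρ (π (n + 1)).1 < ρ (π n).1) := fun n => by
      rw [(hπ.2 n).1]; exact hρ _ _ (hπ.2 n).2
    -- A nonincreasing sequence of natural numbers becomes constant; from then on the strict
    -- decrease demanded where `h` is below the reward is impossible.
    obtain ⟨n, hn⟩ := WellFoundedGT.monotone_chain_condition
      (⟨fun n => OrderDual.toDual (ρ (π n).1),
        monotone_nat_of_le_succ fun n => (hstep n).1⟩ : ℕ →o ℕᵒᵈ)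
    refine eventually_atTop.2 ⟨n, fun m hm => min_eq_right (not_lt.1 fun hlt => ?_)⟩
    have e1 : ρ (π n).1 = ρ (π m).1 := hn m hm
    have e2 : ρ (π n).1 = ρ (π (m + 1)).1 := hn (m + 1) (by omega)
    have := (hstep m).2 hlt
    omega
  refine le_of_tendsto (integral_tendsto_payoff hG i σ s₀
    (fun s => min (h s) (G.reward i s)) hev) (eventually_atTop.2 ⟨1, fun n hn => ?_⟩)
  obtain ⟨n, rfl⟩ := Nat.exists_eq_succ_of_ne_zero (by omega : n ≠ 0)
  refine le_trans (integral_mono (integrable_stage σ s₀ _ fun z => min (h z.1) (G.reward i z.1))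
    (integrable_stage σ s₀ _ fun z => h z.1) fun π => min_le_left _ _) ?_
  have := integral_state_succ σ s₀ h n
  exact this.trans_le (integral_after_le σ s₀ h hh n)

/-- Value iteration from the rewards. Facts about payoffs of stationary profiles follow from it by
induction on the number of iterations, with no further measure theory. -/
theorem tendsto_iterate_next (hG : G.IsTerminalReward) (i : ι) (σ : G.Profile)
    (hσ : σ.IsStationary) (s₀ : S) :
    Tendsto (fun n => (fun f s => σ.next [] s f)^[n] (G.reward i) s₀) atTop
      (𝓝 (σ.payoff s₀ i)) := by
  rw [← tendsto_add_atTop_iff_nat 1]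
  refine ((tendsto_add_atTop_iff_nat 1).2 (integral_tendsto_payoff hG i σ s₀ (G.reward i)
    (ae_of_all _ fun π => Eventually.of_forall fun n => rfl))).congr fun n => ?_
  rw [integral_state_succ, integral_after_stationary σ hσ]

end Play

end ConcurrentGame

end

/-! ### Games in which one controller drives each transition -/

section

open Filter Topology
set_option linter.unusedSectionVars false

namespace ConcurrentGame

section Driven

variable {ι S A : Type*} [Fintype ι] [DecidableEq ι] [Finite S] [Fintype A]
  {G : ConcurrentGame ι S A}

/-- The successor of each state depends on the action of its controller only. -/
def IsDriven (G : ConcurrentGame ι S A) (c : S → ι) (succ : S → A → S) : Prop :=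
  ∀ s a, (∀ i, a i ∈ G.legal i s) → G.trans s a = succ s (a (c s))

/-- Illegal profiles have probability zero, so the arbitrary values of the transition function there
do not matter. -/
theorem Profile.next_eq_of_legal (σ : G.Profile) (x : List (Stage ι S A)) (s : S)
    (f : S → ℝ) (v : (ι → A) → ℝ)
    (hv : ∀ a, (∀ i, a i ∈ G.legal i s) → f (G.trans s a) = v a) :
    σ.next x s f = ∑ a : ι → A, (∏ i, ((σ i).1 x s (a i)).toReal) * v a := by
  refine Finset.sum_congr rfl fun a _ => ?_
  simp only [Profile.actionLaw, PMF.ofFintype_apply, ENNReal.toReal_prod]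
  by_cases h : ∀ i, a i ∈ G.legal i s
  · rw [hv a h]
  · push Not at h
    obtain ⟨i, hi⟩ := h
    have h0 : (σ i).1 x s (a i) = 0 := by
      by_contra hne
      exact hi ((σ i).2 x s _ hne)
    rw [Finset.prod_eq_zero (Finset.mem_univ i) (by rw [h0]; rfl)]
    simp

theorem sum_toReal_pmf {B : Type*} [Fintype B] (p : PMF B) : ∑ b, (p b).toReal = 1 := by
  rw [← ENNReal.toReal_sum fun b _ => p.apply_ne_top b,
    ← tsum_fintype (L := SummationFilter.unconditional B), p.tsum_coe, ENNReal.toReal_one]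

/-- Write the sum over profiles as a product of sums over the players. All factors but the
controller's are total probabilities, hence 1. -/
theorem IsDriven.next_eq {c : S → ι} {succ : S → A → S} (hd : G.IsDriven c succ) (σ : G.Profile)
    (x : List (Stage ι S A)) (s : S) (f : S → ℝ) :
    σ.next x s f = ∑ b, ((σ (c s)).1 x s b).toReal * f (succ s b) := by
  classical
  rw [σ.next_eq_of_legal x s f (fun a => f (succ s (a (c s)))) fun a ha => by rw [hd s a ha]]
  have h := Finset.prod_univ_sum (fun _ : ι => (Finset.univ : Finset A))
    (fun i b => ((σ i).1 x s b).toReal * if i = c s then f (succ s b) else 1)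
  rw [Fintype.piFinset_univ] at h
  have h1 : ∀ i, i ≠ c s →
      ∑ b, ((σ i).1 x s b).toReal * (if i = c s then f (succ s b) else 1) = 1 := by
    intro i hi
    simp only [hi, if_false, mul_one]
    exact sum_toReal_pmf _
  rw [Finset.prod_eq_single (c s) (fun i _ hi => h1 i hi) (by simp)] at h
  simp only [if_true] at h
  rw [h]
  refine Finset.sum_congr rfl fun a _ => ?_
  rw [Finset.prod_mul_distrib]
  congr 1
  rw [Finset.prod_eq_single (c s) (fun i _ hi => if_neg hi) (by simp)]
  simp

theorem Profile.next_of_isTerminal (σ : G.Profile) (x : List (Stage ι S A)) {s : S}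
    (hs : G.IsTerminal s) (f : S → ℝ) : σ.next x s f = f s := by
  have h1 : σ.next x s f = ∑ a, (σ.actionLaw x s a).toReal * f s := by
    rw [σ.next_eq_of_legal x s f (fun _ => f s) fun a ha => by rw [hs a ha]]
    simp [Profile.actionLaw, PMF.ofFintype_apply, ENNReal.toReal_prod]
  rw [h1, ← Finset.sum_mul, sum_toReal_pmf, one_mul]

theorem Profile.next_tendsto (σ : G.Profile) (x : List (Stage ι S A)) (s : S)
    {f : ℕ → S → ℝ} {g : S → ℝ} (h : ∀ s, Tendsto (fun n => f n s) atTop (𝓝 (g s))) :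
    Tendsto (fun n => σ.next x s (f n)) atTop (𝓝 (σ.next x s g)) :=
  tendsto_finsetSum _ fun _ _ => (h _).const_mul _

theorem payoff_eq_next (hG : G.IsTerminalReward) {σ : G.Profile} (hσ : σ.IsStationary) (i : ι)
    (s : S) : σ.payoff s i = σ.next [] s fun t => σ.payoff t i := by
  have h1 := (tendsto_add_atTop_iff_nat 1).2 (tendsto_iterate_next hG i σ hσ s)
  have h2 := σ.next_tendsto [] s fun t => tendsto_iterate_next hG i σ hσ t
  simp only [Function.iterate_succ_apply'] at h1
  exact tendsto_nhds_unique h1 h2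

theorem payoff_of_isTerminal (hG : G.IsTerminalReward) {σ : G.Profile} (hσ : σ.IsStationary)
    (i : ι) {s : S} (hs : G.IsTerminal s) : σ.payoff s i = G.reward i s := by
  refine tendsto_nhds_unique (tendsto_iterate_next hG i σ hσ s)
    (tendsto_const_nhds.congr fun n => ?_)
  induction n with
  | zero => rfl
  | succ n ih => rw [Function.iterate_succ_apply', σ.next_of_isTerminal [] hs, ← ih]

theorem payoff_mono (hG : G.IsTerminalReward) {σ : G.Profile} (hσ : σ.IsStationary) (i : ι)
    (M : ℝ) (hM : ∀ s, G.reward i s ≤ M) (s : S) : σ.payoff s i ≤ M := by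
  refine le_of_tendsto (tendsto_iterate_next hG i σ hσ s) (Eventually.of_forall fun n => ?_)
  induction n generalizing s with
  | zero => exact hM s
  | succ n ih =>
    rw [Function.iterate_succ_apply']
    calc σ.next [] s _ ≤ ∑ a, (σ.actionLaw [] s a).toReal * M :=
          Finset.sum_le_sum fun a _ => mul_le_mul_of_nonneg_left (ih _) ENNReal.toReal_nonneg
      _ = M := by rw [← Finset.sum_mul, sum_toReal_pmf, one_mul]

variable {c : S → ι} {succ : S → A → S}

/-- On a closed set of states, the payoffs depend on the behaviour on this set only. -/
theorem IsDriven.payoff_congr (hd : G.IsDriven c succ) (hG : G.IsTerminalReward)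
    {σ τ : G.Profile} (hσ : σ.IsStationary) (hτ : τ.IsStationary) (i j : ι) (k : ℝ) (C : Set S)
    (hC : ∀ s ∈ C, ∀ b, (σ (c s)).1 [] s b ≠ 0 → succ s b ∈ C)
    (hr : ∀ s ∈ C, G.reward i s = k * G.reward j s)
    (h : ∀ s ∈ C, ∀ b, (τ (c s)).1 [] s b = (σ (c s)).1 [] s b) (s : S) (hs : s ∈ C) :
    τ.payoff s i = k * σ.payoff s j := by
  refine tendsto_nhds_unique (tendsto_iterate_next hG i τ hτ s)
    (((tendsto_iterate_next hG j σ hσ s).const_mul k).congr fun n => ?_)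
  induction n generalizing s with
  | zero => exact (hr s hs).symm
  | succ n ih =>
    rw [Function.iterate_succ_apply', Function.iterate_succ_apply', hd.next_eq, hd.next_eq,
      Finset.mul_sum]
    refine Finset.sum_congr rfl fun b _ => ?_
    rw [h s hs b]
    by_cases hb : (σ (c s)).1 [] s b = 0
    · simp [hb]
    · rw [← ih _ (hC s hs b hb)]; ring

/-- The states that are reached with positive probability. -/
inductive Reach (c : S → ι) (succ : S → A → S) (σ : G.Profile) (s₀ : S) : S → Prop
  | refl : Reach c succ σ s₀ s₀
  | step {s : S} (b : A) : Reach c succ σ s₀ s → (σ (c s)).1 [] s b ≠ 0 →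
      Reach c succ σ s₀ (succ s b)

open scoped Classical in
/-- The strategy that plays the action `b` at `x` and follows `σ` elsewhere. -/
noncomputable def Strategy.force {i : ι} (σ : G.Strategy i) (x : S) (b : A)
    (hb : b ∈ G.legal i x) : G.Strategy i :=
  ⟨fun h s => if s = x then PMF.pure b else σ.1 h s, by
    intro h s a ha
    dsimp only at ha
    split at ha
    · next hs =>
      rw [PMF.pure_apply, ite_ne_right_iff] at ha
      rw [ha.1, hs]; exact hb
    · exact σ.2 h s a ha⟩

theorem Strategy.force_self {i : ι} (σ : G.Strategy i) {x : S} {b : A} (hb : b ∈ G.legal i x)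
    (h : List (Stage ι S A)) : (σ.force x b hb).1 h x = PMF.pure b := if_pos rfl

theorem Strategy.force_of_ne {i : ι} (σ : G.Strategy i) {x : S} {b : A} (hb : b ∈ G.legal i x)
    (h : List (Stage ι S A)) {s : S} (hs : s ≠ x) : (σ.force x b hb).1 h s = σ.1 h s := if_neg hs

/-- In a stationary equilibrium, entering a terminal state is not profitable at any state that is
reached with positive probability. -/
theorem IsDriven.reward_le_payoff (hd : G.IsDriven c succ) (hG : G.IsTerminalReward)
    {σ : G.Profile} (hσ : σ.IsStationary) {s₀ : S} (hN : σ.IsNashEquilibrium s₀) {x : S}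
    (hx : Reach c succ σ s₀ x) {b : A} (hb : b ∈ G.legal (c x) x)
    (ht : G.IsTerminal (succ x b)) :
    G.reward (c x) (succ x b) ≤ σ.payoff x (c x) := by
  classical
  by_contra! hlt
  set i := c x with hi
  -- The deviation changes `σ` at `x` only and is again stationary, so both profiles obey the payoff
  -- recursion.
  let τ : G.Strategy i := (σ i).force x b hb
  let σ' : G.Profile := Function.update σ i τ
  have e : σ' i = τ := Function.update_self _ _ _
  have hσ' : σ'.IsStationary := by
    intro j
    by_cases hj : j = i
    · subst hj
      intro h h' s
      rw [e]
      by_cases hs : s = x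
      · rw [hs, Strategy.force_self, Strategy.force_self]
      · rw [Strategy.force_of_ne _ _ _ hs, Strategy.force_of_ne _ _ _ hs]
        exact hσ _ _ _ _
    · simp only [σ', Function.update_of_ne hj]
      exact hσ j
  have hsame : ∀ s, s ≠ x → ∀ b, (σ' (c s)).1 [] s b = (σ (c s)).1 [] s b := by
    intro s hs b
    by_cases hj : c s = i
    · rw [hj, e, Strategy.force_of_ne _ _ _ hs]
    · simp only [σ', Function.update_of_ne hj]
  -- The gain of the deviation. It is positive at `x` and harmonic for `σ` at all other states; the
  -- aim is that it is positive at `s₀`.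
  let g : S → ℝ := fun s => σ'.payoff s i - σ.payoff s i
  have hgx : 0 < g x := by
    have h1 : σ'.payoff x i = G.reward i (succ x b) := by
      rw [payoff_eq_next hG hσ', hd.next_eq, Finset.sum_eq_single b]
      · rw [← hi, e, Strategy.force_self, payoff_of_isTerminal hG hσ' i ht]
        simp
      · intro a _ hab
        rw [← hi, e, Strategy.force_self]
        simp [hab]
      · simp
    simp only [g, h1]
    linarith
  have hg : ∀ s, s ≠ x → g s = ∑ b, ((σ (c s)).1 [] s b).toReal * g (succ s b) := by
    intro s hs
    simp only [g]
    rw [payoff_eq_next hG hσ', payoff_eq_next hG hσ, hd.next_eq, hd.next_eq,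
      ← Finset.sum_sub_distrib]
    refine Finset.sum_congr rfl fun b _ => ?_
    rw [hsame s hs]; ring
  -- Minimum principle: if the minimum were negative, the set of minimisers would avoid `x` and, by
  -- harmonicity, be closed under `σ`. On such a set both profiles behave alike, so the gain there
  -- would be 0.
  have hpos : ∀ s, 0 ≤ g s := by
    by_contra! hneg
    obtain ⟨s₁, hs₁⟩ := hneg
    have : Nonempty S := ⟨s₁⟩
    obtain ⟨m, hm⟩ := Finite.exists_min g
    have hm0 : g m < 0 := (hm s₁).trans_lt hs₁
    have hC : ∀ s, g s = g m → s ≠ x := by rintro s hs rfl; linarith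
    have := hd.payoff_congr hG hσ hσ' i i 1 {s | g s = g m} (by
      intro s hs b hb
      have h1 := hg s (hC s hs)
      have h2 : ∑ b, ((σ (c s)).1 [] s b).toReal * (g (succ s b) - g m) = 0 := by
        simp only [mul_sub, Finset.sum_sub_distrib, ← h1, ← Finset.sum_mul, sum_toReal_pmf]
        rw [hs]; ring
      rw [Finset.sum_eq_zero_iff_of_nonneg fun b _ =>
        mul_nonneg ENNReal.toReal_nonneg (sub_nonneg.2 (hm _))] at h2
      rcases mul_eq_zero.1 (h2 b (Finset.mem_univ _)) with h3 | h3
      · exact absurd h3 (ENNReal.toReal_ne_zero.2 ⟨hb, PMF.apply_ne_top _ _⟩)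
      · exact sub_eq_zero.1 h3) (by simp) (fun s hs => hsame s (hC s hs)) m rfl
    simp only [g] at hm0
    linarith
  -- A positive gain propagates backwards along the path by which `x` is reached, because the gain
  -- is an average of nonnegative gains (or the state is `x` itself).
  have key : ∀ s, Reach c succ σ s₀ s → 0 < g s → 0 < g s₀ := by
    intro s hs
    induction hs with
    | refl => exact id
    | @step s b hs hb ih =>
      intro h
      refine ih ?_
      by_cases hsx : s = x
      · rw [hsx]; exact hgx
      · rw [hg s hsx]
        refine lt_of_lt_of_le (mul_pos (ENNReal.toReal_pos hb (PMF.apply_ne_top _ _)) h)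
          (Finset.single_le_sum
            (f := fun b => ((σ (c s)).1 [] s b).toReal * g (succ s b)) (fun b _ =>
            mul_nonneg ENNReal.toReal_nonneg (hpos _)) (Finset.mem_univ b))
  have h1 := key x hx hgx
  have h2 := hN i τ
  simp only [g, σ'] at h1
  linarith

/-- A verification theorem for stationary equilibria. -/
theorem IsDriven.isNashEquilibrium (hd : G.IsDriven c succ) (hG : G.IsTerminalReward)
    {σ : G.Profile} (hσ : σ.IsStationary) (s₀ : S) (h : ι → S → ℝ) (ρ : S → ℕ)
    (h1 : ∀ s b, b ∈ G.legal (c s) s → h (c s) (succ s b) ≤ h (c s) s)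
    (h2 : ∀ i s, c s ≠ i → ∑ b, ((σ (c s)).1 [] s b).toReal * h i (succ s b) ≤ h i s)
    (hρ : ∀ s b, b ∈ G.legal (c s) s → ρ (succ s b) ≤ ρ s ∧
      ∀ i, h i s < G.reward i s → ρ (succ s b) < ρ s)
    (h0 : ∀ i, h i s₀ ≤ σ.payoff s₀ i) : σ.IsNashEquilibrium s₀ := by
  intro i τ
  refine (payoff_le_of_next_le hG i _ s₀ (h i) ?_ ρ ?_).trans (h0 i)
  · intro x s
    rw [hd.next_eq]
    by_cases hi : c s = i
    · subst hi
      rw [Function.update_self]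
      calc ∑ b, (τ.1 x s b).toReal * h (c s) (succ s b)
          ≤ ∑ b, (τ.1 x s b).toReal * h (c s) s := Finset.sum_le_sum fun b _ => by
            by_cases hb : τ.1 x s b = 0
            · simp [hb]
            · exact mul_le_mul_of_nonneg_left (h1 s b (τ.2 x s b hb)) ENNReal.toReal_nonneg
        _ = h (c s) s := by rw [← Finset.sum_mul, sum_toReal_pmf, one_mul]
    · rw [Function.update_of_ne hi, hσ (c s) x []]
      exact h2 i s hi
  · intro s a ha
    rw [hd s a ha]
    exact ⟨(hρ s _ (ha _)).1, (hρ s _ (ha _)).2 i⟩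

/-- A lottery with given weights. -/
noncomputable def lottery {B : Type*} [Fintype B] (w : B → ℝ) (h0 : ∀ b, 0 ≤ w b)
    (h1 : ∑ b, w b = 1) : PMF B :=
  PMF.ofFintype (fun b => ENNReal.ofReal (w b)) (by
    rw [← ENNReal.ofReal_sum_of_nonneg fun b _ => h0 b, h1, ENNReal.ofReal_one])

/-- Each state has a controller who chooses among the actions with the given weights. -/
theorem exists_profile (G : ConcurrentGame ι S A) (c : S → ι) (w : S → A → ℝ)
    (h0 : ∀ s b, 0 ≤ w s b) (h1 : ∀ s, ∑ b, w s b = 1)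
    (hl : ∀ s b, w s b ≠ 0 → b ∈ G.legal (c s) s) :
    ∃ σ : G.Profile, σ.IsStationary ∧ ∀ s b, ((σ (c s)).1 [] s b).toReal = w s b := by
  classical
  refine ⟨fun i => ⟨fun _ s => if i = c s then lottery (w s) (h0 s) (h1 s)
    else PMF.pure (G.legal_nonempty i s).choose, fun x s a ha => ?_⟩, fun i x y s => rfl,
    fun s b => ?_⟩
  · dsimp only at ha
    by_cases hi : i = c s
    · rw [if_pos hi] at ha
      rw [hi]
      refine hl s a fun hw => ha ?_
      simp [lottery, hw]
    · rw [if_neg hi] at ha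
      have : a = (G.legal_nonempty i s).choose := by
        by_contra hne
        exact ha (by simp [hne])
      rw [this]
      exact (G.legal_nonempty i s).choose_spec
  · simp [lottery, h0 s b]

end Driven

end ConcurrentGame

end

/-! ### The linear equations and inequalities of `G(p)` -/

namespace SqrtGame

theorem le_of_mul_self_le {x y : ℝ} (hy : 0 ≤ y) (h : x * x ≤ y * y) : x ≤ y :=
  le_of_not_gt fun hlt => absurd h (not_le.2 (mul_self_lt_mul_self hy hlt))

open Node

/-- The algebraic core of the upper bound. `a = 1 - z₁` and `b = 1 - z₂` are the probabilities of
leaving the cycle in its two halves. -/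
theorem sqrt_bound_of_system {p q x₁ y₁ z₁ x₂ y₂ z₂ : ℝ} {A B : Fin 6 → ℝ} (hq : 0 ≤ q)
    (hq2 : q * q = p) (hs₁ : x₁ + y₁ + z₁ = 1) (hs₂ : x₂ + y₂ + z₂ = 1)
    (hz₁ : 0 ≤ z₁) (hz₁' : z₁ ≤ 1) (hz₂ : 0 ≤ z₂) (hz₂' : z₂ ≤ 1) (hZ : z₁ * z₂ < 1)
    (hA1 : A 1 = x₁ + z₁ * B 1) (hB1 : B 1 = x₂ + z₂ * A 1)
    (hA2 : A 2 = x₁ + 2 * y₁ + z₁ * B 2) (hB2 : B 2 = z₂ * A 2)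
    (hA3 : A 3 = z₁ * B 3) (hB3 : B 3 = x₂ + 2 * y₂ + z₂ * A 3)
    (hA4 : A 4 = (2 - p) * x₁ + (1 - p) * y₁ + z₁ * B 4) (hB4 : B 4 = y₂ + z₂ * A 4)
    (hA5 : A 5 = y₁ + z₁ * B 5) (hB5 : B 5 = (2 - p) * x₂ + (1 - p) * y₂ + z₂ * A 5)
    (h2 : 1 ≤ A 2) (h3 : 1 ≤ B 3) (h4 : 1 ≤ A 4) (h4' : 1 - p ≤ B 4)
    (h5 : 1 - p ≤ A 5) (h5' : 1 ≤ B 5) : A 1 ≤ q := by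
  obtain rfl : x₁ = 1 - z₁ - y₁ := by linarith
  obtain rfl : x₂ = 1 - z₂ - y₂ := by linarith
  obtain ⟨a, rfl⟩ : ∃ a, z₁ = 1 - a := ⟨1 - z₁, by ring⟩
  obtain ⟨b, rfl⟩ : ∃ b, z₂ = 1 - b := ⟨1 - z₂, by ring⟩
  -- The shifts are chosen so that the conditions of players 2 and 3 turn into `0 ≤ u` and `0 ≤ w`.
  obtain ⟨u, rfl⟩ : ∃ u, y₁ = u + (1 - a) * b := ⟨y₁ - (1 - a) * b, by ring⟩
  obtain ⟨w, rfl⟩ : ∃ w, y₂ = w + (1 - b) * a := ⟨y₂ - (1 - b) * a, by ring⟩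
  -- `Z = 1 - z₁ z₂` is the probability of leaving within one round; multiplying by it solves the
  -- cyclic equations without division.
  obtain ⟨Z, hZd⟩ : ∃ Z, Z = a + b - a * b := ⟨_, rfl⟩
  have hZ0 : 0 < Z := by rw [hZd]; linarith
  have e1 : Z * A 1 = a * Z - u - (1 - a) * w := by
    rw [hB1] at hA1; rw [hZd]; linear_combination hA1
  have e2 : Z * A 2 = Z + u := by rw [hB2] at hA2; rw [hZd]; linear_combination hA2
  have e3 : Z * B 3 = Z + w := by rw [hA3] at hB3; rw [hZd]; linear_combination hB3
  have e4 : Z * A 4 = Z + (-u + (1 - a) * w + (4 - p) * a - (2 + a) * Z) := by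
    rw [hB4] at hA4; rw [hZd]; linear_combination hA4
  have e5 : Z * A 5 = (1 - p) * Z + (u - (1 - a) * w - (4 - p) * a + (2 + a) * Z) := by
    rw [hB5] at hA5; rw [hZd]; linear_combination hA5
  have e4' : Z * B 4 = (1 - p) * Z + (w - (1 - b) * u - (4 - p) * b + (2 + b) * Z) := by
    rw [hA4] at hB4; rw [hZd]; linear_combination hB4
  have e5' : Z * B 5 = Z + (-w + (1 - b) * u + (4 - p) * b - (2 + b) * Z) := by
    rw [hA5] at hB5; rw [hZd]; linear_combination hB5
  have hu : 0 ≤ u := by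
    have := mul_le_mul_of_nonneg_left h2 hZ0.le
    linarith
  have hw : 0 ≤ w := by
    have := mul_le_mul_of_nonneg_left h3 hZ0.le
    linarith
  -- The brackets in `e4` and `e5` are negatives of each other and both must be nonnegative, so they
  -- vanish.
  have E1 : u - (1 - a) * w = (4 - p) * a - (2 + a) * Z := by
    have := mul_le_mul_of_nonneg_left h4 hZ0.le
    have := mul_le_mul_of_nonneg_left h5 hZ0.le
    linarith
  have E2 : w - (1 - b) * u = (4 - p) * b - (2 + b) * Z := by
    have := mul_le_mul_of_nonneg_left h4' hZ0.le
    have := mul_le_mul_of_nonneg_left h5' hZ0.le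
    linarith
  have hu' : u = 2 * a - p - Z := by
    refine mul_left_cancel₀ hZ0.ne' ?_
    rw [hZd] at E1 E2 ⊢
    linear_combination E1 + (1 - a) * E2
  have hw' : w = 2 * b - p - Z := by
    refine mul_left_cancel₀ hZ0.ne' ?_
    rw [hZd] at E1 E2 ⊢
    linear_combination E2 + (1 - b) * E1
  have e : Z * A 1 = p * (2 - a) := by rw [e1, hu', hw', hZd]; ring
  have ha : 0 ≤ a := by linarith
  have hb : 0 ≤ b := by linarith
  have ha' : a ≤ 1 := by linarith
  have hb' : b ≤ 1 := by linarith
  have hpa : p ≤ a - b + a * b := by linarith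
  have hpb : p ≤ b - a + a * b := by linarith
  -- For `a ≤ b` one has `a² - (a - b + a b) = (b - a)(1 - a) ≥ 0`, so `q² = p ≤ a²`; the other case
  -- is symmetric.
  have hq' : q ≤ a ∧ q ≤ b := by
    rcases le_total a b with hab | hab
    · have h1 : q * q ≤ a * a := by
        have := mul_nonneg (sub_nonneg.2 hab) (sub_nonneg.2 ha')
        linarith
      have := le_of_mul_self_le ha h1
      exact ⟨this, this.trans hab⟩
    · have h1 : q * q ≤ b * b := by
        have := mul_nonneg (sub_nonneg.2 hab) (sub_nonneg.2 hb')
        linarith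
      have := le_of_mul_self_le hb h1
      exact ⟨this.trans hab, this⟩
  refine le_of_mul_le_mul_left ?_ hZ0
  rw [e, ← hq2, hZd]
  have h1 := mul_le_mul_of_nonneg_left hq'.2 (sub_nonneg.2 ha')
  -- Split `q (2 - a) = q + (1 - a) q` and bound the first `q` by `a`, the second by `b`.
  have h2 : q * (2 - a) ≤ a + b - a * b := by linarith [hq'.1]
  have := mul_le_mul_of_nonneg_left h2 hq
  linarith

section Upper

variable {p : ℝ} {e : Node → ℝ} {V : Fin 6 → Node → ℝ} {R : Node → Prop}

/-- An upper bound for the payoff of player 1, in terms of the exit probabilities `e` and the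
payoffs `V` from each node. The set `R` contains the nodes that are reached. -/
theorem payoff_le_sqrt (hp0 : 0 ≤ p) (hp1 : p ≤ 1) (he0 : ∀ x, 0 ≤ e x) (he1 : ∀ x, e x ≤ 1)
    (hV : ∀ i x, V i x = e x * exitReward p x i + (1 - e x) * V i (next x))
    (hR₀ : R s₁) (hR : ∀ x, R x → e x ≠ 1 → R (next x))
    (hexit : ∀ x, R x → controller x ≠ 0 → exitReward p x (controller x) ≤ V (controller x) x)
    (hin : ∀ x, R x → controller x ≠ 0 → e x = 0)
    (hloop : (∀ x, e x = 0) → ∀ i, V i s₁ = 0) : V 1 s₁ ≤ Real.sqrt p := by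
  have hz (x : Node) (h : e x = 0) (i : Fin 6) : V i x = V i (next x) := by rw [hV, h]; ring
  have hRz (x : Node) (hx : R x) (h : e x = 0) : R (next x) := hR x hx (by rw [h]; norm_num)
  have es₁ := hin s₁ hR₀ (by decide)
  have hr₁ : R r₁ := hRz s₁ hR₀ es₁
  have er₁ := hin r₁ hr₁ (by decide)
  have ht₁ : R t₁ := hRz r₁ hr₁ er₁
  have et₁ := hin t₁ ht₁ (by decide)
  have hu₁ : R u₁ := hRz t₁ ht₁ et₁
  have hsr₁ (i : Fin 6) : V i s₁ = V i r₁ := hz s₁ es₁ i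
  have hrt₁ (i : Fin 6) : V i r₁ = V i t₁ := hz r₁ er₁ i
  have htu₁ (i : Fin 6) : V i t₁ = V i u₁ := hz t₁ et₁ i
  have h2 : 1 ≤ V 2 s₁ := hexit s₁ hR₀ (by decide)
  have h4 : 1 ≤ V 4 s₁ := by rw [hsr₁]; exact hexit r₁ hr₁ (by decide)
  have h5 : 1 - p ≤ V 5 s₁ := by rw [hsr₁, hrt₁]; exact hexit t₁ ht₁ (by decide)
  have hA (i : Fin 6) : V i s₁ = e u₁ * exitReward p u₁ i +
      (1 - e u₁) * (e v₁ * exitReward p v₁ i + (1 - e v₁) * V i s₂) := by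
    rw [hsr₁, hrt₁, htu₁, hV i u₁]; simp only [next]; rw [hV i v₁]; rfl
  have hpq : p ≤ Real.sqrt p := Real.le_sqrt_of_sq_le (by nlinarith)
  -- If the play surely ends in the first half, the second one need not be reached and its
  -- inequalities are unavailable. Then the payoffs of players 1 and 5 add up to 1, and the bound `1
  -- - p` for player 5 leaves at most `p ≤ √p` for player 1.
  by_cases hz₁ : e u₁ = 1 ∨ e v₁ = 1
  · have h0 : (1 - e u₁) * (1 - e v₁) = 0 := by rcases hz₁ with h | h <;> rw [h] <;> ring
    have A1 := hA 1
    have A5 := hA 5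
    simp [exitReward] at A1 A5
    refine le_trans ?_ hpq
    linear_combination A1 + A5 + h5 + h0 * (V 1 s₂ + V 5 s₂ - 1)
  push Not at hz₁
  have hs₂ : R s₂ := hR v₁ (hR u₁ hu₁ hz₁.1) hz₁.2
  have es₂ := hin s₂ hs₂ (by decide)
  have hr₂ : R r₂ := hRz s₂ hs₂ es₂
  have er₂ := hin r₂ hr₂ (by decide)
  have ht₂ : R t₂ := hRz r₂ hr₂ er₂
  have et₂ := hin t₂ ht₂ (by decide)
  have hsr₂ (i : Fin 6) : V i s₂ = V i r₂ := hz s₂ es₂ i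
  have hrt₂ (i : Fin 6) : V i r₂ = V i t₂ := hz r₂ er₂ i
  have htu₂ (i : Fin 6) : V i t₂ = V i u₂ := hz t₂ et₂ i
  have h3 : 1 ≤ V 3 s₂ := hexit s₂ hs₂ (by decide)
  have h4' : 1 - p ≤ V 4 s₂ := by rw [hsr₂]; exact hexit r₂ hr₂ (by decide)
  have h5' : 1 ≤ V 5 s₂ := by rw [hsr₂, hrt₂]; exact hexit t₂ ht₂ (by decide)
  have hB (i : Fin 6) : V i s₂ = e u₂ * exitReward p u₂ i +
      (1 - e u₂) * (e v₂ * exitReward p v₂ i + (1 - e v₂) * V i s₁) := by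
    rw [hsr₂, hrt₂, htu₂, hV i u₂]; simp only [next]; rw [hV i v₂]; rfl
  have k (x : Node) : 0 ≤ 1 - e x ∧ 1 - e x ≤ 1 :=
    ⟨sub_nonneg.2 (he1 x), by linarith [he0 x]⟩
  have m {a b : ℝ} (ha : 0 ≤ a ∧ a ≤ 1) (hb : 0 ≤ b ∧ b ≤ 1) : 0 ≤ a * b ∧ a * b ≤ 1 :=
    ⟨mul_nonneg ha.1 hb.1, mul_le_one₀ ha.2 hb.1 hb.2⟩
  have k₁ := m (k u₁) (k v₁)
  have k₂ := m (k u₂) (k v₂)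
  -- A product equal to 1 would mean that no exit is ever used; player 2 would then receive 0,
  -- contrary to her bound.
  have hZ : (1 - e u₁) * (1 - e v₁) * ((1 - e u₂) * (1 - e v₂)) < 1 := by
    refine lt_of_le_of_ne (m k₁ k₂).2 fun h => ?_
    have f {a b : ℝ} (ha : 0 ≤ a ∧ a ≤ 1) (hb : 0 ≤ b ∧ b ≤ 1) (h : a * b = 1) :
        a = 1 ∧ b = 1 := by
      constructor <;> nlinarith
    obtain ⟨f₁, f₂⟩ := f k₁ k₂ h
    obtain ⟨f₁, f₁'⟩ := f (k u₁) (k v₁) f₁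
    obtain ⟨f₂, f₂'⟩ := f (k u₂) (k v₂) f₂
    have := hloop (fun x => by cases x <;> first | assumption | linarith) 2
    linarith
  refine sqrt_bound_of_system (A := fun i => V i s₁) (B := fun i => V i s₂)
    (x₁ := e u₁) (y₁ := (1 - e u₁) * e v₁) (x₂ := e u₂) (y₂ := (1 - e u₂) * e v₂)
    (Real.sqrt_nonneg p) (Real.mul_self_sqrt hp0) (by ring) (by ring) k₁.1 k₁.2 k₂.1 k₂.2 hZ
    ?_ ?_ ?_ ?_ ?_ ?_ ?_ ?_ ?_ ?_ h2 h3 h4 h4' h5 h5'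
  · exact (hA 1).trans (by simp [exitReward]; ring)
  · exact (hB 1).trans (by simp [exitReward]; ring)
  · exact (hA 2).trans (by simp [exitReward]; ring)
  · exact (hB 2).trans (by simp [exitReward]; ring)
  · exact (hA 3).trans (by simp [exitReward]; ring)
  · exact (hB 3).trans (by simp [exitReward]; ring)
  · exact (hA 4).trans (by simp [exitReward]; ring)
  · exact (hB 4).trans (by simp [exitReward]; ring)
  · exact (hA 5).trans (by simp [exitReward]; ring)
  · exact (hB 5).trans (by simp [exitReward]; ring)

end Upper

/-- Exit probabilities that leave the choice to player 0. -/
def exitProb (α₁ β₁ α₂ β₂ : ℝ) : Node → ℝ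
  | u₁ => α₁ | v₁ => β₁ | u₂ => α₂ | v₂ => β₂ | _ => 0

/-- Exit probabilities and payoffs of an equilibrium in which player 1 receives `√p`. -/
structure IsOptimal (p : ℝ) (e : Node → ℝ) (V : Fin 6 → Node → ℝ) : Prop where
  nonneg : ∀ x, 0 ≤ e x
  le_one : ∀ x, e x ≤ 1
  pos : 0 < e v₁
  eq_zero : ∀ x, controller x ≠ 0 → e x = 0
  rec_eq : ∀ i x, V i x = e x * exitReward p x i + (1 - e x) * V i (next x)
  exit_le : ∀ x, controller x ≠ 0 → exitReward p x (controller x) ≤ V (controller x) x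
  player_zero : ∀ x, V 0 x = 0
  player_one : V 1 s₁ = Real.sqrt p
  value_nonneg : ∀ i x, 0 ≤ V i x

/-- Since only player 0 leaves, payoffs are constant from `s₁` to `u₁` and from `s₂` to `u₂`, so two
vectors determine all of them. By symmetry the same exit probabilities serve in both halves. -/
theorem exists_isOptimal_of_values {p α β : ℝ} (hp1 : p ≤ 1) (A B : Fin 6 → ℝ)
    (hα : 0 ≤ α) (hα' : α ≤ 1) (hβ : 0 < β) (hβ' : β ≤ 1)
    (hA : ∀ i, A i = α * exitReward p u₁ i + (1 - α) * (β * exitReward p v₁ i + (1 - β) * B i))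
    (hB : ∀ i, B i = α * exitReward p u₂ i + (1 - α) * (β * exitReward p v₂ i + (1 - β) * A i))
    (hA0 : ∀ i, 0 ≤ A i) (hB0 : ∀ i, 0 ≤ B i) (hA00 : A 0 = 0) (hB00 : B 0 = 0)
    (hA1 : A 1 = Real.sqrt p) (hA2 : 1 ≤ A 2) (hB3 : 1 ≤ B 3) (hA4 : 1 ≤ A 4) (hB4 : 1 - p ≤ B 4)
    (hA5 : 1 - p ≤ A 5) (hB5 : 1 ≤ B 5) : ∃ e V, IsOptimal p e V := by
  refine ⟨exitProb α β α β, fun i x => match x with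
    | s₁ | r₁ | t₁ | u₁ => A i
    | s₂ | r₂ | t₂ | u₂ => B i
    | v₁ => β * exitReward p v₁ i + (1 - β) * B i
    | v₂ => β * exitReward p v₂ i + (1 - β) * A i, ?_, ?_, hβ, ?_, ?_, ?_, ?_, hA1, ?_⟩
  · intro x; cases x <;> simp [exitProb, hα, hβ.le]
  · intro x; cases x <;> simp [exitProb, hα', hβ']
  · intro x; cases x <;> simp [exitProb, controller]
  · intro i x
    cases x <;> simp [exitProb, next]
    · exact hA i
    · exact hB i
  · intro x; cases x <;> simp [controller, exitReward, hA2, hB3, hA4, hB4, hA5, hB5]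
  · intro x; cases x <;> simp [exitReward, hA00, hB00]
  · have h (i : Fin 6) : 0 ≤ exitReward p v₁ i ∧ 0 ≤ exitReward p v₂ i := by
      fin_cases i <;> simp [exitReward, hp1]
    intro i x
    cases x <;> simp only [hA0, hB0]
    · exact add_nonneg (mul_nonneg hβ.le (h i).1) (mul_nonneg (sub_nonneg.2 hβ') (hB0 i))
    · exact add_nonneg (mul_nonneg hβ.le (h i).2) (mul_nonneg (sub_nonneg.2 hβ') (hA0 i))

theorem exists_isOptimal {p : ℝ} (hp0 : 0 ≤ p) (hp1 : p ≤ 1) : ∃ e V, IsOptimal p e V := by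
  rcases hp0.eq_or_lt with rfl | hp
  -- For `p = 0` the general formula would give `β = 0`, and the play would never end; leaving
  -- surely at `v₁` works instead.
  · refine exists_isOptimal_of_values (α := 0) (β := 1) zero_le_one ![0, 0, 2, 0, 1, 1]
      ![0, 0, 0, 2, 1, 1] ?_ ?_ ?_ ?_ ?_ ?_ ?_ ?_ ?_ ?_ ?_ ?_ ?_ ?_ ?_ ?_ ?_
    all_goals first
      | (intro i; fin_cases i <;> simp [exitReward])
      | simp
  · obtain ⟨q, hq, hq1, rfl⟩ : ∃ q, 0 < q ∧ q ≤ 1 ∧ q * q = p :=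
      ⟨_, Real.sqrt_pos.2 hp, Real.sqrt_le_one.2 hp1, Real.mul_self_sqrt hp0⟩
    have h1q : 1 + q ≠ 0 := by positivity
    -- The bound is tight for `a = b = q` and `u = w = 0`. So a half is left at its `v` with
    -- probability `q (1 - q)` and at its `u` with probability `q²`, hence `β = q (1 - q) / (1 -
    -- q²)`.
    refine exists_isOptimal_of_values (α := q * q) (β := q / (1 + q)) hp1
      ![0, q, 1, 1 - q, 1, 1 - q * q] ![0, q, 1 - q, 1, 1 - q * q, 1] hp0 hp1 (by positivity)
      ?_ ?_ ?_ ?_ ?_ ?_ ?_ ?_ ?_ ?_ ?_ ?_ ?_ ?_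
    · rw [div_le_one (by positivity)]; linarith
    · intro i; fin_cases i <;> simp [exitReward] <;> field_simp <;> ring
    · intro i; fin_cases i <;> simp [exitReward] <;> field_simp <;> ring
    · intro i; fin_cases i <;> simp [hq.le, hq1, hp1]
    · intro i; fin_cases i <;> simp [hq.le, hq1, hp1]
    all_goals simp [hq.le]

/-- Applied to the difference of two solutions of the payoff recursion: the exit rewards cancel, and
one round contracts by at least the factor `1 - e v₁ < 1`. Thus exit probabilities determine the
payoffs. -/
theorem eq_zero_of_cycle {e D : Node → ℝ} (h0 : ∀ x, 0 ≤ e x) (h1 : ∀ x, e x ≤ 1)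
    (hpos : 0 < e v₁) (hD : ∀ x, D x = (1 - e x) * D (next x)) (x : Node) : D x = 0 := by
  have back (x : Node) (h : D (next x) = 0) : D x = 0 := by rw [hD, h, mul_zero]
  have habs (x : Node) : |D x| ≤ |D (next x)| := by
    rw [hD x, abs_mul, abs_of_nonneg (sub_nonneg.2 (h1 x))]
    exact mul_le_of_le_one_left (abs_nonneg _) (by linarith [h0 x])
  have hv : D v₁ = 0 := by
    have h : |D s₂| ≤ |D v₁| :=
      (habs s₂).trans <| (habs r₂).trans <| (habs t₂).trans <| (habs u₂).trans <|
      (habs v₂).trans <| (habs s₁).trans <| (habs r₁).trans <| (habs t₁).trans <| habs u₁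
    have h' : |D v₁| = (1 - e v₁) * |D s₂| := by
      conv_lhs => rw [hD v₁, abs_mul, abs_of_nonneg (sub_nonneg.2 (h1 _))]
      rfl
    have h3 := mul_le_mul_of_nonneg_left h (sub_nonneg.2 (h1 v₁))
    rw [← abs_eq_zero]
    have h4 : e v₁ * |D v₁| ≤ 0 := by linarith
    nlinarith [abs_nonneg (D v₁)]
  have hu := back u₁ hv
  have ht := back t₁ hu
  have hr := back r₁ ht
  have hs := back s₁ hr
  have hv2 := back v₂ hs
  have hu2 := back u₂ hv2
  have ht2 := back t₂ hu2
  have hr2 := back r₂ ht2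
  have hs2 := back s₂ hr2
  cases x <;> assumption

end SqrtGame

/-! ### The maximal payoff of player 1 in `G(p)` -/

section

open Filter Topology
set_option linter.unusedSectionVars false

namespace ConcurrentGame

variable {ι S A : Type*} [Fintype ι] [DecidableEq ι] [Finite S] [Fintype A]
  {G : ConcurrentGame ι S A} {c : S → ι} {succ : S → A → S}

theorem IsDriven.payoff_eq_sum (hd : G.IsDriven c succ) (hG : G.IsTerminalReward) {σ : G.Profile}
    (hσ : σ.IsStationary) (i : ι) (s : S) :
    σ.payoff s i = ∑ b, ((σ (c s)).1 [] s b).toReal * σ.payoff (succ s b) i := by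
  conv_lhs => rw [payoff_eq_next hG hσ, hd.next_eq]

/-- A player without positive rewards who receives payoff `0` receives payoff `0` from every state
that is reached with positive probability. -/
theorem IsDriven.payoff_eq_zero_of_reach (hd : G.IsDriven c succ) (hG : G.IsTerminalReward)
    {σ : G.Profile} (hσ : σ.IsStationary) {i : ι} (hr : ∀ s, G.reward i s ≤ 0) {s₀ s : S}
    (h0 : 0 ≤ σ.payoff s₀ i) (hs : Reach c succ σ s₀ s) : σ.payoff s i = 0 := by
  have hle := payoff_mono hG hσ i 0 hr
  induction hs with
  | refl => exact le_antisymm (hle _) h0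
  | @step s b hs hb ih =>
    -- An average of nonpositive payoffs is 0 only if every payoff of positive weight is 0.
    rw [hd.payoff_eq_sum hG hσ, Finset.sum_eq_zero_iff_of_nonpos fun b _ =>
      mul_nonpos_of_nonneg_of_nonpos ENNReal.toReal_nonneg (hle _)] at ih
    rcases mul_eq_zero.1 (ih b (Finset.mem_univ _)) with h | h
    · exact absurd h (ENNReal.toReal_ne_zero.2 ⟨hb, PMF.apply_ne_top _ _⟩)
    · exact h

theorem toReal_pmf_le_one {B : Type*} (q : PMF B) (b : B) : (q b).toReal ≤ 1 :=
  ENNReal.toReal_le_of_le_ofReal zero_le_one (by simpa using q.coe_le_one b)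

end ConcurrentGame

namespace SqrtGame

open Node ConcurrentGame

def stateController : State → Fin 6
  | .node x => controller x
  | .exit _ => 0

def stateSucc : State → Bool → State
  | .node x, b => if b then .exit x else .node (next x)
  | .exit x, _ => .exit x

variable {p : ℝ}

theorem isDriven_game : (game p).IsDriven stateController stateSucc := by
  intro s a _
  cases s <;> rfl

theorem isTerminal_exit (x : Node) : (game p).IsTerminal (.exit x) := fun _ _ => rfl

theorem isTurnBased_game : (game p).IsTurnBased := by
  intro s
  refine ⟨stateController s, fun j hj => ?_⟩
  cases s with
  | node x => exact (congrArg Finset.card (if_neg hj)).trans rfl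
  | exit x => rfl

theorem isTerminalReward_game : (game p).IsTerminalReward := by
  intro i s h
  cases s with
  | node x => exact absurd rfl h
  | exit x => exact isTerminal_exit x

theorem mem_legal_node (x : Node) (b : Bool) :
    b ∈ (game p).legal (controller x) (.node x) := by
  cases b <;> simp [game]

theorem payoff_node {σ : (game p).Profile} (hσ : σ.IsStationary) (i : Fin 6) (x : Node) :
    σ.payoff (.node x) i = ((σ (controller x)).1 [] (.node x) true).toReal * exitReward p x i +
      (1 - ((σ (controller x)).1 [] (.node x) true).toReal) * σ.payoff (.node (next x)) i := by
  have h := sum_toReal_pmf ((σ (controller x)).1 [] (.node x))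
  rw [Fintype.sum_bool] at h
  rw [isDriven_game.payoff_eq_sum isTerminalReward_game hσ, Fintype.sum_bool]
  simp only [stateController, stateSucc, if_true, Bool.false_eq_true, if_false]
  rw [payoff_of_isTerminal isTerminalReward_game hσ i (isTerminal_exit x), ← h]
  simp only [game]
  ring

theorem payoff_le (hp0 : 0 ≤ p) (hp1 : p ≤ 1) {σ : (game p).Profile} (hσ : σ.IsStationary)
    (hN : σ.IsNashEquilibrium (.node s₁)) (h0 : 0 ≤ σ.payoff (.node s₁) 0) :
    σ.payoff (.node s₁) 1 ≤ Real.sqrt p := by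
  have hreach (x : Node) (b : Bool)
      (hx : Reach stateController stateSucc σ (.node s₁) (.node x))
      (hb : (σ (controller x)).1 [] (.node x) b ≠ 0) :
      Reach stateController stateSucc σ (.node s₁) (stateSucc (.node x) b) := Reach.step b hx hb
  have hr (s : State) : (game p).reward 0 s ≤ 0 := by
    rcases s with x | x
    · exact le_rfl
    · cases x <;> simp [game, exitReward]
  refine payoff_le_sqrt (e := fun x => ((σ (controller x)).1 [] (.node x) true).toReal)
    (V := fun i x => σ.payoff (.node x) i)
    (R := fun x => Reach stateController stateSucc σ (.node s₁) (.node x)) hp0 hp1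
    (fun _ => ENNReal.toReal_nonneg) (fun _ => toReal_pmf_le_one _ _) (fun i x => payoff_node hσ i x)
    Reach.refl ?_ ?_ ?_ ?_
  · intro x hx he
    refine hreach x false hx fun h => he ?_
    have h1 := sum_toReal_pmf ((σ (controller x)).1 [] (.node x))
    rw [Fintype.sum_bool, h] at h1
    simpa using h1
  · intro x hx _
    exact isDriven_game.reward_le_payoff isTerminalReward_game hσ hN hx (b := true)
      (mem_legal_node x true) (isTerminal_exit x)
  · intro x hx hc
    by_contra he
    have h1 := isDriven_game.payoff_eq_zero_of_reach isTerminalReward_game hσ hr h0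
      (hreach x true hx fun h => he (by rw [h]; rfl))
    have h2 : σ.payoff (.exit x) 0 = exitReward p x 0 :=
      payoff_of_isTerminal isTerminalReward_game hσ 0 (isTerminal_exit x)
    have h3 : exitReward p x 0 = 0 := by rw [← h2]; exact h1
    cases x <;> simp [exitReward, controller] at h3 hc
  · intro he i
    -- Without exits the nodes form a closed set with zero rewards; comparison with factor 0 makes
    -- all payoffs there vanish.
    have := isDriven_game.payoff_congr isTerminalReward_game hσ hσ i i 0
      (Set.range State.node) (by
        rintro _ ⟨x, rfl⟩ b hb
        cases b with
        | false => exact ⟨next x, rfl⟩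
        | true => exact absurd (he x) (ENNReal.toReal_ne_zero.2 ⟨hb, PMF.apply_ne_top _ _⟩))
        (by rintro _ ⟨x, rfl⟩; simp [game]) (fun _ _ _ => rfl) (.node s₁) ⟨s₁, rfl⟩
    simpa using this

theorem exists_equilibrium (hp0 : 0 ≤ p) (hp1 : p ≤ 1) :
    ∃ σ : (game p).Profile, σ.IsStationary ∧ σ.IsNashEquilibrium (.node s₁) ∧
      0 ≤ σ.payoff (.node s₁) 0 ∧ Real.sqrt p = σ.payoff (.node s₁) 1 := by
  obtain ⟨e, V, h⟩ := exists_isOptimal hp0 hp1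
  obtain ⟨σ, hσ, hw⟩ := exists_profile (game p) stateController (fun s b => match s with
    | .node x => if b then e x else 1 - e x
    | .exit _ => if b then 0 else 1)
    (by
      rintro (x | x) (_ | _) <;> simp [h.nonneg, h.le_one])
    (by rintro (x | x) <;> simp)
    (by
      rintro (x | x) (_ | _) <;> simp [game, stateController])
  have hwt (x : Node) : ((σ (controller x)).1 [] (.node x) true).toReal = e x := hw (.node x) true
  have hwf (x : Node) : ((σ (controller x)).1 [] (.node x) false).toReal = 1 - e x :=
    hw (.node x) false
  have hpay (i : Fin 6) (x : Node) : σ.payoff (.node x) i = V i x := by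
    rw [← sub_eq_zero]
    refine eq_zero_of_cycle (D := fun x => σ.payoff (.node x) i - V i x) h.nonneg h.le_one h.pos
      (fun x => ?_) x
    rw [payoff_node hσ, hwt, h.rec_eq i x]
    ring
  refine ⟨σ, hσ, ?_, by rw [hpay, h.player_zero], by rw [hpay, h.player_one]⟩
  -- A constant rank suffices: the values are nonnegative at the nodes, where rewards vanish, and
  -- equal the rewards at the exits.
  refine isDriven_game.isNashEquilibrium isTerminalReward_game hσ _ (fun i s => match s with
    | .node x => V i x
    | .exit x => exitReward p x i) (fun _ => 0) ?_ ?_ ?_ (fun i => (hpay i s₁).ge)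
  · rintro (x | x) b hb
    · by_cases hc : controller x = 0
      · simp only [stateController, hc, h.player_zero]
        cases b with
        | false => simp [stateSucc]
        | true => cases x <;> simp [stateSucc, exitReward]
      · have h1 := h.rec_eq (controller x) x
        rw [h.eq_zero x hc] at h1
        cases b with
        | false => simp [stateSucc, stateController, h1]
        | true => exact h.exit_le x hc
    · exact le_rfl
  · rintro i (x | x) _
    · rw [Fintype.sum_bool]
      simp only [stateController, hwt, hwf]
      exact (h.rec_eq i x).ge
    · simp only [stateSucc]
      rw [← Finset.sum_mul, sum_toReal_pmf, one_mul]
  · rintro (x | x) b _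
    · refine ⟨le_rfl, fun i hi => absurd hi (not_lt.2 (h.value_nonneg i x))⟩
    · exact ⟨le_rfl, fun i hi => absurd hi (lt_irrefl _)⟩

theorem isGreatest_payoff (hp0 : 0 ≤ p) (hp1 : p ≤ 1) :
    IsGreatest
      {v : ℝ | ∃ σ : (game p).Profile,
        σ.IsStationary ∧ σ.IsNashEquilibrium (.node .s₁) ∧
        0 ≤ σ.payoff (.node .s₁) 0 ∧ v = σ.payoff (.node .s₁) 1}
      (Real.sqrt p) := by
  refine ⟨exists_equilibrium hp0 hp1, ?_⟩
  rintro _ ⟨σ, hσ, hN, h0, rfl⟩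
  exact payoff_le hp0 hp1 hσ hN h0

end SqrtGame

end

section

open Computability

/-! ### A structured programming language for stack machines -/

/-- Structured programs that work on stacks indexed by `K` with symbols from `Γ` and a register
with values in `σ`. -/
inductive StackProg (K Γ σ : Type) where
  | push (k : K) (f : σ → Γ)
  | pop (k : K) (f : σ → Option Γ → σ)
  | load (f : σ → σ)
  | seq (A B : StackProg K Γ σ)
  | ite (c : σ → Bool) (A B : StackProg K Γ σ)
  | loop (c : σ → Bool) (A : StackProg K Γ σ)

namespace StackProg

variable {K Γ σ : Type}

/-- The control points of a program. -/
def Pos : StackProg K Γ σ → Type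
  | push _ _ | pop _ _ | load _ => Unit
  | seq A B => Pos A ⊕ Pos B
  | ite _ A B => Option (Pos A ⊕ Pos B)
  | loop _ A => Option (Pos A)

instance instFintypePos : (P : StackProg K Γ σ) → Fintype P.Pos
  | push _ _ | pop _ _ | load _ => inferInstanceAs (Fintype Unit)
  | seq A B => by
    have := instFintypePos A
    have := instFintypePos B
    exact inferInstanceAs (Fintype (Pos A ⊕ Pos B))
  | ite _ A B => by
    have := instFintypePos A
    have := instFintypePos B
    exact inferInstanceAs (Fintype (Option (Pos A ⊕ Pos B)))
  | loop _ A => by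
    have := instFintypePos A
    exact inferInstanceAs (Fintype (Option (Pos A)))

def entry : (P : StackProg K Γ σ) → P.Pos
  | push _ _ | pop _ _ | load _ => ()
  | seq A _ => Sum.inl A.entry
  | ite _ _ _ | loop _ _ => none

/-- The statements of a stack machine that runs the program and then goes to the label `next`. The
control points are embedded in the labels of the machine. -/
def code {Λ : Type} : (P : StackProg K Γ σ) → (P.Pos → Λ) → Λ → P.Pos →
    Turing.TM2.Stmt (fun _ : K => Γ) Λ σ
  | push k f, _, next, _ => .push k f (.goto fun _ => next)
  | pop k f, _, next, _ => .pop k f (.goto fun _ => next)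
  | load f, _, next, _ => .load f (.goto fun _ => next)
  | seq A B, emb, _, Sum.inl x => A.code (fun y => emb (Sum.inl y)) (emb (Sum.inr B.entry)) x
  | seq _ B, emb, next, Sum.inr x => B.code (fun y => emb (Sum.inr y)) next x
  | ite c A B, emb, _, none => .branch c (.goto fun _ => emb (some (Sum.inl A.entry)))
      (.goto fun _ => emb (some (Sum.inr B.entry)))
  | ite _ A _, emb, next, some (Sum.inl x) => A.code (fun y => emb (some (Sum.inl y))) next x
  | ite _ _ B, emb, next, some (Sum.inr x) => B.code (fun y => emb (some (Sum.inr y))) next x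
  | loop c A, emb, next, none => .branch c (.goto fun _ => emb (some A.entry))
      (.goto fun _ => next)
  | loop _ A, emb, _, some x => A.code (fun y => emb (some y)) (emb none) x

variable [DecidableEq K]

/-- `P.Exec v S v' S' t`: started with register `v` and stacks `S`, the program halts after `t`
steps with register `v'` and stacks `S'`. -/
inductive Exec : StackProg K Γ σ → σ → (K → List Γ) → σ → (K → List Γ) → ℕ → Prop
  | push (k f v S) : Exec (.push k f) v S v (Function.update S k (f v :: S k)) 1
  | pop (k f v S) : Exec (.pop k f) v S (f v (S k).head?) (Function.update S k (S k).tail) 1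
  | load (f v S) : Exec (.load f) v S (f v) S 1
  | seq {A B v₁ S₁ v₂ S₂ v₃ S₃ t₁ t₂} : Exec A v₁ S₁ v₂ S₂ t₁ → Exec B v₂ S₂ v₃ S₃ t₂ →
      Exec (.seq A B) v₁ S₁ v₃ S₃ (t₂ + t₁)
  | ite_true {c A B v S v' S' t} : c v = true → Exec A v S v' S' t →
      Exec (.ite c A B) v S v' S' (t + 1)
  | ite_false {c A B v S v' S' t} : c v = false → Exec B v S v' S' t →
      Exec (.ite c A B) v S v' S' (t + 1)
  | loop_false {c A v S} : c v = false → Exec (.loop c A) v S v S 1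
  | loop_true {c A v₁ S₁ v₂ S₂ v₃ S₃ t₁ t₂} : c v₁ = true → Exec A v₁ S₁ v₂ S₂ t₁ →
      Exec (.loop c A) v₂ S₂ v₃ S₃ t₂ → Exec (.loop c A) v₁ S₁ v₃ S₃ (t₂ + (t₁ + 1))

/-- By induction on the execution. The embedding and the exit label are universally quantified so
that the induction hypotheses apply to subprograms placed inside a larger machine. -/
theorem Exec.iterate_step {Λ : Type} {m : Λ → Turing.TM2.Stmt (fun _ : K => Γ) Λ σ}
    {P : StackProg K Γ σ} {v v' : σ} {S S' : K → List Γ} {t : ℕ} (h : P.Exec v S v' S' t) :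
    ∀ (emb : P.Pos → Λ) (next : Λ), (∀ x, m (emb x) = P.code emb next x) →
      (flip bind (Turing.TM2.step m))^[t] (some ⟨some (emb P.entry), v, S⟩) =
        some ⟨some next, v', S'⟩ := by
  have one (l : Λ) (v : σ) (S : K → List Γ) :
      (flip bind (Turing.TM2.step m)) (some ⟨some l, v, S⟩) =
        some (Turing.TM2.stepAux (m l) v S) := rfl
  induction h with
  | push k f v S =>
    intro emb next hm
    rw [Function.iterate_one, one, hm]; rfl
  | pop k f v S =>
    intro emb next hm
    rw [Function.iterate_one, one, hm]; rfl
  | load f v S =>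
    intro emb next hm
    rw [Function.iterate_one, one, hm]; rfl
  | seq _ _ ihA ihB =>
    intro emb next hm
    rw [Function.iterate_add_apply]
    exact (congrArg _ (ihA _ _ fun x => hm (Sum.inl x))).trans (ihB _ _ fun x => hm (Sum.inr x))
  | ite_true hc _ ih =>
    intro emb next hm
    rw [Function.iterate_add_apply, Function.iterate_one, one, hm]
    simp only [entry, code, Turing.TM2.stepAux, hc, cond_true]
    exact ih _ _ fun x => hm (some (Sum.inl x))
  | ite_false hc _ ih =>
    intro emb next hm
    rw [Function.iterate_add_apply, Function.iterate_one, one, hm]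
    simp only [entry, code, Turing.TM2.stepAux, hc, cond_false]
    exact ih _ _ fun x => hm (some (Sum.inr x))
  | loop_false hc =>
    intro emb next hm
    rw [Function.iterate_one, one, hm]
    simp only [entry, code, Turing.TM2.stepAux, hc, cond_false]
  | loop_true hc _ _ ihA ihB =>
    intro emb next hm
    rw [Function.iterate_add_apply, Function.iterate_add_apply, Function.iterate_one, one, hm]
    simp only [entry, code, Turing.TM2.stepAux, hc, cond_true]
    exact (congrArg _ (ihA _ _ fun x => hm (some x))).trans (ihB emb next hm)

/-- The stack machine that runs a program and halts. -/
def machine [Fintype K] [Fintype Γ] [Fintype σ] (P : StackProg K Γ σ) (k₀ k₁ : K) (v₀ : σ) :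
    Turing.FinTM2 where
  K := K
  k₀ := k₀
  k₁ := k₁
  Γ _ := Γ
  Λ := Option P.Pos
  main := some P.entry
  σ := σ
  initialState := v₀
  m
    | none => .halt
    | some x => P.code some none x

/-- The stacks when only the stack `k` is nonempty. -/
def single (k : K) (l : List Γ) : K → List Γ := fun j => if j = k then l else []

theorem initList_machine [Fintype K] [Fintype Γ] [Fintype σ] (P : StackProg K Γ σ) (k₀ k₁ : K)
    (v₀ : σ) (l : List Γ) : Turing.initList (P.machine k₀ k₁ v₀) l =
      ⟨some (some P.entry), v₀, single k₀ l⟩ := by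
  refine congrArg (Turing.TM2.Cfg.mk _ _) (funext fun j : K => ?_)
  by_cases h : j = k₀
  · subst h
    exact (dif_pos rfl).trans (if_pos rfl).symm
  · exact (dif_neg h).trans (if_neg h).symm

/-- A halting configuration carries the initial register, so programs have to restore `v₀`. -/
theorem haltList_machine [Fintype K] [Fintype Γ] [Fintype σ] (P : StackProg K Γ σ) (k₀ k₁ : K)
    (v₀ : σ) (l : List Γ) : Turing.haltList (P.machine k₀ k₁ v₀) l =
      ⟨none, v₀, single k₁ l⟩ := by
  refine congrArg (Turing.TM2.Cfg.mk _ _) (funext fun j : K => ?_)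
  by_cases h : j = k₁
  · subst h
    exact (dif_pos rfl).trans (if_pos rfl).symm
  · exact (dif_neg h).trans (if_neg h).symm

/-- A function is computable in polynomial time, if there is a program that computes it in
polynomial time. -/
theorem nonempty_tm2ComputableInPolyTime [Fintype K] [Fintype Γ] [Fintype σ] {α β : Type}
    {ea : α → List Γ} {eb : β → List Γ} {f : α → β} (P : StackProg K Γ σ) (k₀ k₁ : K) (v₀ : σ)
    (time : Polynomial ℕ)
    (h : ∀ a, ∃ t ≤ time.eval (ea a).length,
      P.Exec v₀ (single k₀ (ea a)) v₀ (single k₁ (eb (f a))) t) :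
    Nonempty (Turing.TM2ComputableInPolyTime ea eb f) := by
  choose t ht hex using h
  refine ⟨{ tm := P.machine k₀ k₁ v₀, inputAlphabet := Equiv.refl _,
            outputAlphabet := Equiv.refl _, time := time + 1, outputsFun := fun a => ?_ }⟩
  have h1 := (hex a).iterate_step (m := (P.machine k₀ k₁ v₀).m) some none fun _ => rfl
  -- The additional step executes `halt` at the label `none`.
  refine ⟨⟨t a + 1, ?_⟩, by simpa using ht a⟩
  rw [Nat.add_comm, Function.iterate_add_apply]
  have e1 : Turing.initList (P.machine k₀ k₁ v₀) (List.map (Equiv.refl Γ).invFun (ea a)) =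
      ⟨some (some P.entry), v₀, single k₀ (ea a)⟩ :=
    (congrArg (Turing.initList (P.machine k₀ k₁ v₀)) (List.map_id (ea a))).trans
      (initList_machine _ _ _ _ _)
  have e2 : Turing.haltList (P.machine k₀ k₁ v₀) (List.map (Equiv.refl Γ).invFun (eb (f a))) =
      ⟨none, v₀, single k₁ (eb (f a))⟩ :=
    (congrArg (Turing.haltList (P.machine k₀ k₁ v₀)) (List.map_id (eb (f a)))).trans
      (haltList_machine _ _ _ _ _)
  refine (congrArg _ ((congrArg (fun c => (flip bind (P.machine k₀ k₁ v₀).step)^[t a] (some c))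
    e1).trans h1)).trans ?_
  exact congrArg some e2.symm

end StackProg

end

/-! ### Time bounds and basic routines for stack programs -/

section

open Computability

namespace StackProg

variable {K Γ σ : Type} [DecidableEq K]

/-- The program halts after at most `T` steps. -/
def Runs (P : StackProg K Γ σ) (v : σ) (S : K → List Γ) (v' : σ) (S' : K → List Γ) (T : ℕ) :
    Prop := ∃ t ≤ T, P.Exec v S v' S' t

theorem Runs.mono {P : StackProg K Γ σ} {v v' : σ} {S S' : K → List Γ} {T T' : ℕ}
    (h : P.Runs v S v' S' T) (hT : T ≤ T') : P.Runs v S v' S' T' :=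
  let ⟨t, ht, hP⟩ := h
  ⟨t, ht.trans hT, hP⟩

theorem Runs.mono' {P : StackProg K Γ σ} {v v' : σ} {S S' S'' : K → List Γ} {T T' : ℕ}
    (h : P.Runs v S v' S' T) (hS : S' = S'') (hT : T ≤ T') : P.Runs v S v' S'' T' :=
  hS ▸ h.mono hT

theorem Runs.seq {A B : StackProg K Γ σ} {v₁ v₂ v₃ : σ} {S₁ S₂ S₃ : K → List Γ} {T₁ T₂ : ℕ}
    (hA : A.Runs v₁ S₁ v₂ S₂ T₁) (hB : B.Runs v₂ S₂ v₃ S₃ T₂) :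
    (StackProg.seq A B).Runs v₁ S₁ v₃ S₃ (T₁ + T₂) := by
  obtain ⟨t₁, h₁, hA⟩ := hA
  obtain ⟨t₂, h₂, hB⟩ := hB
  exact ⟨t₂ + t₁, by omega, hA.seq hB⟩

theorem runs_push (k : K) (f : σ → Γ) (v : σ) (S : K → List Γ) :
    (push k f).Runs v S v (Function.update S k (f v :: S k)) 1 := ⟨1, le_rfl, .push k f v S⟩

theorem runs_pop (k : K) (f : σ → Option Γ → σ) (v : σ) (S : K → List Γ) :
    (pop k f).Runs v S (f v (S k).head?) (Function.update S k (S k).tail) 1 :=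
  ⟨1, le_rfl, .pop k f v S⟩

theorem runs_load (f : σ → σ) (v : σ) (S : K → List Γ) :
    (load f).Runs v S (f v) S 1 := ⟨1, le_rfl, .load f v S⟩

theorem runs_loop_false {c : σ → Bool} {A : StackProg K Γ σ} {v : σ} {S : K → List Γ}
    (h : c v = false) : (loop c A).Runs v S v S 1 := ⟨1, le_rfl, .loop_false h⟩

theorem Runs.loop_true {c : σ → Bool} {A : StackProg K Γ σ} {v₁ v₂ v₃ : σ} {S₁ S₂ S₃ : K → List Γ}
    {T₁ T₂ : ℕ} (h : c v₁ = true) (hA : A.Runs v₁ S₁ v₂ S₂ T₁)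
    (hB : (loop c A).Runs v₂ S₂ v₃ S₃ T₂) : (loop c A).Runs v₁ S₁ v₃ S₃ (T₁ + 1 + T₂) := by
  obtain ⟨t₁, h₁, hA⟩ := hA
  obtain ⟨t₂, h₂, hB⟩ := hB
  exact ⟨t₂ + (t₁ + 1), by omega, hA.loop_true h hB⟩

theorem Runs.ite_true {c : σ → Bool} {A B : StackProg K Γ σ} {v v' : σ} {S S' : K → List Γ}
    {T : ℕ} (h : c v = true) (hA : A.Runs v S v' S' T) :
    (ite c A B).Runs v S v' S' (T + 1) := by
  obtain ⟨t, ht, hA⟩ := hA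
  exact ⟨t + 1, by omega, hA.ite_true h⟩

theorem Runs.ite_false {c : σ → Bool} {A B : StackProg K Γ σ} {v v' : σ} {S S' : K → List Γ}
    {T : ℕ} (h : c v = false) (hB : B.Runs v S v' S' T) :
    (ite c A B).Runs v S v' S' (T + 1) := by
  obtain ⟨t, ht, hB⟩ := hB
  exact ⟨t + 1, by omega, hB.ite_false h⟩

/-- The register holds the symbol that was read last and a flag. -/
abbrev Register := Option Γ' × Bool

/-- Read the top symbol of a stack. -/
def read (k : K) : StackProg K Γ' Register := pop k fun v a => (a, v.2)

/-- Push images of the symbol in the register on several stacks. -/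
def pushes : List (K × (Γ' → Γ')) → StackProg K Γ' Register
  | [] => load id
  | (k, f) :: outs => seq (push k fun v => f (v.1.getD .blank)) (pushes outs)

/-- The symbols that `pushes outs` pushes on the stack `j`. -/
def contrib (outs : List (K × (Γ' → Γ'))) (j : K) (a : Γ') : List Γ' :=
  ((outs.filter (·.1 = j)).map fun q => q.2 a).reverse

theorem runs_pushes (outs : List (K × (Γ' → Γ'))) (a : Γ') (b : Bool) (S : K → List Γ') :
    (pushes outs).Runs (some a, b) S (some a, b) (fun j => contrib outs j a ++ S j)
      (outs.length + 1) := by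
  induction outs generalizing S with
  | nil => exact runs_load _ _ _
  | cons q outs ih =>
    obtain ⟨k, f⟩ := q
    have h := (runs_push k (fun v : Register => f (v.1.getD .blank)) (some a, b) S).seq (ih _)
    refine h.mono' ?_ ?_
    · funext j
      by_cases hj : k = j
      · subst hj; simp [contrib]
      · simp [contrib, hj, Function.update_of_ne (Ne.symm hj)]
    · simp only [List.length_cons]; omega

/-- Pop symbols from the stack `k`, as long as they satisfy `p`, and push images of them on other
stacks. The first symbol that does not satisfy `p` is popped as well. -/
def xfer (k : K) (p : Option Γ' → Bool) (outs : List (K × (Γ' → Γ'))) :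
    StackProg K Γ' Register :=
  seq (read k) (loop (fun v => p v.1) (seq (pushes outs) (read k)))

/-- The invariant is that the register already holds the next symbol and the stack only what follows
it; hence `head?` and `tail` of the same word. -/
theorem runs_xfer_loop {k : K} {p : Option Γ' → Bool} {outs : List (K × (Γ' → Γ'))}
    (hk : ∀ q ∈ outs, q.1 ≠ k) (l rest : List Γ') (hl : ∀ a ∈ l, p (some a) = true)
    (hr : p rest.head? = false) (b : Bool) (S : K → List Γ') (hS : S k = (l ++ rest).tail) :
    (loop (fun v => p v.1) (seq (pushes outs) (read k))).Runs ((l ++ rest).head?, b) S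
      (rest.head?, b)
      (fun j => if j = k then rest.tail else l.reverse.flatMap (contrib outs j) ++ S j)
      ((outs.length + 3) * l.length + 1) := by
  induction l generalizing S with
  | nil =>
    refine (runs_loop_false (c := fun v : Register => p v.1) (v := (rest.head?, b))
      (S := S) hr).mono' ?_ (by simp)
    funext j
    by_cases hj : j = k
    · subst hj; simpa using hS
    · simp [hj]
  | cons a l ih =>
    have hc : contrib outs k a = [] := by
      simp only [contrib, List.reverse_eq_nil_iff, List.map_eq_nil_iff, List.filter_eq_nil_iff]
      exact fun q hq => by simpa using hk q hq
    have h1 := runs_pushes outs a b S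
    have h2 := runs_pop k (fun (v : Register) a => (a, v.2)) (some a, b)
      (fun j => contrib outs j a ++ S j)
    simp only [hc, hS, List.nil_append, List.cons_append, List.tail_cons] at h2
    have h3 := Runs.loop_true (c := fun v : Register => p v.1) (hl a List.mem_cons_self)
      (h1.seq h2) (ih (fun a ha => hl a (List.mem_cons_of_mem _ ha)) _ (by simp))
    refine h3.mono' ?_ ?_
    · funext j
      by_cases hj : j = k
      · simp [hj]
      · simp [hj, Function.update_of_ne]
    · simp only [List.length_cons]; linarith

theorem runs_xfer {k : K} {p : Option Γ' → Bool} {outs : List (K × (Γ' → Γ'))}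
    (hk : ∀ q ∈ outs, q.1 ≠ k) (l rest : List Γ') (hl : ∀ a ∈ l, p (some a) = true)
    (hr : p rest.head? = false) (v : Register) (S : K → List Γ') (hS : S k = l ++ rest) :
    (xfer k p outs).Runs v S (rest.head?, v.2)
      (fun j => if j = k then rest.tail else l.reverse.flatMap (contrib outs j) ++ S j)
      ((outs.length + 3) * l.length + 2) := by
  have h1 := runs_pop k (fun (v : Register) a => (a, v.2)) v S
  have h2 := runs_xfer_loop hk l rest hl hr v.2 (Function.update S k (S k).tail) (by simp [hS])
  rw [← hS] at h2
  refine (h1.seq h2).mono' ?_ (by omega)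
  funext j
  by_cases hj : j = k
  · simp [hj]
  · simp [hj, Function.update_of_ne]

/-- Empty the stack `k` and push images of its symbols on other stacks. -/
def drain (k : K) (outs : List (K × (Γ' → Γ'))) : StackProg K Γ' Register :=
  xfer k Option.isSome outs

theorem runs_drain {k : K} {outs : List (K × (Γ' → Γ'))} (hk : ∀ q ∈ outs, q.1 ≠ k) (v : Register)
    (S : K → List Γ') :
    (drain k outs).Runs v S (none, v.2)
      (fun j => if j = k then [] else (S k).reverse.flatMap (contrib outs j) ++ S j)
      ((outs.length + 3) * (S k).length + 2) :=
  runs_xfer hk (S k) [] (fun _ _ => rfl) rfl v S (by simp)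

/-- A piece of a text: a symbol, or the content of a stack. -/
inductive Piece (K : Type) where
  | sym (a : Γ')
  | stack (k : K)

def Piece.render (S : K → List Γ') : Piece K → List Γ'
  | sym a => [a]
  | stack k => S k

/-- Write a text on the stack `o`, using the empty stack `t`. -/
def emit (o t : K) : List (Piece K) → StackProg K Γ' Register
  | [] => load fun _ => (none, false)
  | .sym a :: ps => seq (push o fun _ => a) (emit o t ps)
  | .stack k :: ps => seq (seq (drain k [(o, id), (t, id)]) (drain t [(k, id)])) (emit o t ps)

/-- The text appears reversed because it is pushed symbol by symbol. A stack is copied to `o` and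
`t` at once and then restored from `t`; the two drains cost `5 L + 2` and `4 L + 2`, which gives the
constant `9 L + 4`. -/
theorem runs_emit {o t : K} (hot : o ≠ t) (L : ℕ) (ps : List (Piece K))
    (hps : ∀ k, Piece.stack k ∈ ps → k ≠ o ∧ k ≠ t) (v : Register) (S : K → List Γ')
    (ht : S t = []) (hL : ∀ k, Piece.stack k ∈ ps → (S k).length ≤ L) :
    (emit o t ps).Runs v S (none, false)
      (Function.update S o ((ps.flatMap (Piece.render S)).reverse ++ S o))
      (ps.length * (9 * L + 4) + 1) := by
  induction ps generalizing v S with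
  | nil =>
    exact (runs_load (fun _ : Register => (none, false)) v S).mono' (by simp) (by simp)
  | cons q ps ih =>
    have hps' := fun k hk => hps k (List.mem_cons_of_mem _ hk)
    have hren (l : List Γ') (k : K) (hk : Piece.stack k ∈ ps) : Function.update S o l k = S k :=
      Function.update_of_ne (hps' k hk).1 _ _
    have hflat (l : List Γ') : ps.flatMap (Piece.render (Function.update S o l)) =
        ps.flatMap (Piece.render S) := by
      refine List.flatMap_congr fun q hq => ?_
      cases q with
      | sym a => rfl
      | stack k => exact hren l k hq
    have key (l : List Γ') (v : Register) := ih hps' v (Function.update S o l)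
      (by rw [Function.update_of_ne hot.symm, ht])
      (fun k hk => by rw [hren l k hk]; exact hL k (List.mem_cons_of_mem _ hk))
    simp only [hflat, Function.update_self, Function.update_idem] at key
    cases q with
    | sym a =>
      refine ((runs_push o (fun _ => a) v S).seq (key _ _)).mono' ?_ ?_
      · simp [Piece.render]
      · simp only [List.length_cons]
        have : (ps.length + 1) * (9 * L + 4) = ps.length * (9 * L + 4) + (9 * L + 4) := by ring
        omega
    | stack k =>
      obtain ⟨hko, hkt⟩ := hps k List.mem_cons_self
      have hkL := hL k List.mem_cons_self
      have h1 := runs_drain (k := k) (outs := [(o, id), (t, id)])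
        (by simp [hko.symm, hkt.symm]) v S
      have h2 := runs_drain (k := t) (outs := [(k, id)]) (by simp [hkt]) (none, v.2)
        (fun j => if j = k then [] else
          (S k).reverse.flatMap (contrib [(o, id), (t, id)] j) ++ S j)
      have e1 : contrib [(o, id), (t, id)] t = fun a => [a] := by
        funext a; simp [contrib, hot]
      have e2 : contrib [(o, id), (t, id)] o = fun a => [a] := by
        funext a; simp [contrib, hot.symm]
      have e3 : contrib [(k, id)] k = fun a => [a] := by
        funext a; simp [contrib]
      have e4 (j : K) (hj : j ≠ k) : contrib [(k, id)] j = fun _ => [] := by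
        funext a; simp [contrib, hj.symm]
      have e5 (j : K) (hj : j ≠ o) (hj' : j ≠ t) :
          contrib [(o, id), (t, id)] j = fun _ => [] := by
        funext a; simp [contrib, hj.symm, hj'.symm]
      have e6 : (if t = k then [] else
          (S k).reverse.flatMap (contrib [(o, id), (t, id)] t) ++ S t) = (S k).reverse := by
        rw [if_neg hkt.symm, e1, ht]; simp
      rw [e6] at h2
      have h3 := h1.seq h2
      have e7 : (fun j => if j = t then [] else
          (S k).reverse.reverse.flatMap (contrib [(k, id)] j) ++ if j = k then [] else
          (S k).reverse.flatMap (contrib [(o, id), (t, id)] j) ++ S j) =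
          Function.update S o ((S k).reverse ++ S o) := by
        funext j
        by_cases hjt : j = t
        · rw [if_pos hjt, hjt, Function.update_of_ne hot.symm, ht]
        rw [if_neg hjt]
        by_cases hjk : j = k
        · rw [if_pos hjk, hjk, e3, Function.update_of_ne hko]; simp
        rw [if_neg hjk, e4 j hjk]
        by_cases hjo : j = o
        · rw [hjo, e2, Function.update_self]; simp
        · rw [e5 j hjo hjt, Function.update_of_ne hjo,
            List.flatMap_eq_nil_iff.2 fun _ _ => rfl, List.flatMap_eq_nil_iff.2 fun _ _ => rfl]
          rfl
      rw [e7] at h3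
      refine (h3.seq (key _ _)).mono' ?_ ?_
      · simp [Piece.render]
      · simp only [List.length_cons, List.length_nil, List.length_reverse]
        have : (ps.length + 1) * (9 * L + 4) = ps.length * (9 * L + 4) + (9 * L + 4) := by ring
        omega

end StackProg

end

section

open ConcurrentGame Filter Topology

namespace SqrtReduction

open SqrtGame Node

/-! ### The instance of StatNE -/

/-- The positions in a block of the game. -/
inductive Loc where
  | node (x : Node)
  | exit (x : Node)
  | chk₆ | fail₆ | chk₇ | fail₇ | coin | pad | base
  deriving DecidableEq

open Loc

def nodeNumber : Node → ℕ
  | s₁ => 0 | r₁ => 1 | t₁ => 2 | u₁ => 3 | v₁ => 4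
  | s₂ => 5 | r₂ => 6 | t₂ => 7 | u₂ => 8 | v₂ => 9

def nodeOf : ℕ → Node
  | 0 => s₁ | 1 => r₁ | 2 => t₁ | 3 => u₁ | 4 => v₁
  | 5 => s₂ | 6 => r₂ | 7 => t₂ | 8 => u₂ | _ => v₂

theorem nodeOf_nodeNumber (x : Node) : nodeOf (nodeNumber x) = x := by cases x <;> rfl

theorem nodeNumber_lt (x : Node) : nodeNumber x < 10 := by cases x <;> decide

/-- The entrances `chk₆` and `base`, which never occur in the same block, share the number 31. Its
five binary digits are all 1, so an entrance is written as five ones followed by the digits of the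
block number, even for block 0, whose number has no digits. -/
def Loc.number : Loc → ℕ
  | node x => nodeNumber x
  | exit x => 10 + nodeNumber x
  | coin => 20
  | chk₇ => 21
  | fail₆ => 22
  | fail₇ => 23
  | pad => 24
  | chk₆ => 31
  | base => 31

theorem Loc.number_lt (l : Loc) : l.number < 32 := by
  cases l <;> simp only [Loc.number] <;> (try have := nodeNumber_lt ‹_›) <;> omega

/-- The position with a given number in the block `b`. -/
def locOf (b j : ℕ) : Loc :=
  if b = 0 then if j = 31 then base else pad
  else if j < 10 then node (nodeOf j)
  else if j < 20 then exit (nodeOf (j - 10))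
  else if j = 20 then coin
  else if j = 21 then chk₇
  else if j = 22 then fail₆
  else if j = 23 then fail₇
  else if j = 31 then chk₆
  else pad

/-- The positions that occur in the block `b`. -/
def Valid (b : ℕ) (l : Loc) : Prop := (b = 0 ∧ l = base) ∨ (b ≠ 0 ∧ l ≠ base ∧ l ≠ pad)

theorem locOf_number {b : ℕ} {l : Loc} (h : Valid b l) : locOf b l.number = l := by
  rcases h with ⟨rfl, rfl⟩ | ⟨hb, h1, h2⟩
  · rfl
  · rw [locOf, if_neg hb]
    cases l with
    | node x => simp [Loc.number, nodeNumber_lt, nodeOf_nodeNumber]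
    | exit x =>
      have := nodeNumber_lt x
      generalize hj : (exit x).number = j
      replace hj : 10 + nodeNumber x = j := hj
      rw [if_neg (by omega), if_pos (by omega), ← hj, Nat.add_sub_cancel_left, nodeOf_nodeNumber]
    | pad => exact absurd rfl h2
    | base => exact absurd rfl h1
    | _ => rfl

theorem locOf_cases (b j : ℕ) : Valid b (locOf b j) ∨ locOf b j = pad := by
  by_cases hb : b = 0
  · subst hb
    by_cases hj : j = 31
    · left; left; simp [locOf, hj]
    · right; simp [locOf, hj]
  · have : locOf b j ≠ base := by
      rw [locOf, if_neg hb]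
      repeat' split
      all_goals simp
    by_cases h : locOf b j = pad
    · exact Or.inr h
    · exact Or.inl (Or.inr ⟨hb, this, h⟩)

/-- The player who moves at a position. -/
def Loc.controller : Loc → Fin 8
  | node x => (SqrtGame.controller x).castLE (by decide)
  | chk₆ => 6
  | chk₇ => 7
  | _ => 0

/-- The positions with two actions. -/
def Loc.binary : Loc → Bool
  | node _ | chk₆ | chk₇ | coin => true
  | _ => false

/-- A reference to a state. -/
inductive Ref where
  | here (l : Loc)
  | prev
  | base

def Loc.succ : Loc → Bool → Ref
  | node x, true => .here (exit x)
  | node x, false => .here (node (next x))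
  | exit x, _ => .here (exit x)
  | chk₆, true => .here fail₆
  | chk₆, false => .here chk₇
  | fail₆, _ => .here fail₆
  | chk₇, true => .here fail₇
  | chk₇, false => .here coin
  | fail₇, _ => .here fail₇
  | coin, true => .here (node s₁)
  | coin, false => .prev
  | pad, _ => .base
  | Loc.base, _ => .base

theorem Loc.succ_of_not_binary {l : Loc} (h : l.binary = false) (a b : Bool) :
    l.succ a = l.succ b := by
  cases l <;> simp [Loc.binary] at h <;> rfl

/-- The entrance of the block `b`. -/
def entrance (b : ℕ) : ℕ × Loc := (b, if b = 0 then base else chk₆)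

def Ref.target (b : ℕ) : Ref → ℕ × Loc
  | here l => (b, l)
  | prev => entrance (b - 1)
  | base => entrance 0

/-- The rewards in the block with the numbers `e` and `d`, which occur in it as `2⁻ᵉ` and
`p = d / 4ᵉ`. -/
inductive Reward where
  | zero | one | two | negOne | oneSub | twoSub | small | negSmall

def Reward.frac (e d : ℕ) : Reward → ℤ × ℕ+
  | zero => (0, 1)
  | one => (1, 1)
  | two => (2, 1)
  | negOne => (-1, 1)
  | oneSub => (4 ^ e - d, 4 ^ e)
  | twoSub => (2 * 4 ^ e - d, 4 ^ e)
  | small => (1, 2 ^ e)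
  | negSmall => (-1, 2 ^ e)

open Reward in
def exitCode : Node → Fin 8 → Reward
  | s₁ => ![negOne, zero, one, zero, zero, zero, zero, zero]
  | r₁ => ![negOne, zero, zero, zero, one, zero, zero, zero]
  | t₁ => ![negOne, zero, zero, zero, zero, oneSub, zero, zero]
  | u₁ => ![zero, one, one, zero, twoSub, zero, zero, zero]
  | v₁ => ![zero, zero, two, zero, oneSub, one, zero, zero]
  | s₂ => ![negOne, zero, zero, one, zero, zero, zero, zero]
  | r₂ => ![negOne, zero, zero, zero, oneSub, zero, zero, zero]
  | t₂ => ![negOne, zero, zero, zero, zero, one, zero, zero]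
  | u₂ => ![zero, one, zero, one, zero, twoSub, zero, zero]
  | v₂ => ![zero, zero, zero, two, one, oneSub, zero, zero]

open Reward in
def Loc.reward : Loc → Fin 8 → Reward
  | exit x => exitCode x
  | fail₆ | fail₇ => ![negOne, zero, zero, zero, zero, zero, small, negSmall]
  | Loc.base => ![zero, zero, zero, zero, zero, zero, small, negSmall]
  | _ => fun _ => zero

instance (n : ℕ) : NeZero ((n + 1) * 32) := ⟨by omega⟩

/-- The number of the state at a position. -/
def stateNumber (v : ℕ × Loc) : ℕ := v.1 * 32 + v.2.number

def state (n : ℕ) (v : ℕ × Loc) : Fin ((n + 1) * 32) := Fin.ofNat _ (stateNumber v)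

/-- The position of a state. -/
def position (s : ℕ) : ℕ × Loc := (s / 32, locOf (s / 32) (s % 32))

/-- The length of the encoded instance is used as a bound for the sizes of the numbers in it. -/
def size (x : List ℕ × ℕ) : ℕ := (Code.sqrtSumInstance x).length

/-- The number that belongs to the block `b`. -/
def entryAt (x : List ℕ × ℕ) (b : ℕ) : ℕ := x.1.getD (b - 1) 0

/-- Blocks of uniform size 32 keep the numbering simple; unused numbers are unreachable padding. The
lower threshold of player 1 is `k` times `2⁻⁽ˢ⁺ⁿ⁺¹⁾`, with `s` the input length, the factor that the
chain of fair choices puts in front of the sum of roots. In block 0 the entry given by truncated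
subtraction is harmless, as no reward there depends on it. -/
def gameInstance (x : List ℕ × ℕ) : GameInstance 8 where
  numStates := (x.1.length + 1) * 32
  numActions := 2
  maxAction s i := if (position s).2.binary ∧ i = (position s).2.controller then 1 else 0
  table s a := state _ (((position s).2.succ (a.val = 1)).target (position s).1)
  reward s i := ((position s).2.reward i).frac (size x + (position s).1) (entryAt x (position s).1)
  init := state _ (entrance x.1.length)
  lower := ![.frac (0, 1), .frac (x.2, 2 ^ (size x + x.1.length + 1)), .negInf, .negInf, .negInf,
    .negInf, .negInf, .negInf]
  upper _ := .posInf

theorem val_state {n : ℕ} {v : ℕ × Loc} (h : v.1 ≤ n) : (state n v : ℕ) = stateNumber v := by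
  have := v.2.number_lt
  refine Nat.mod_eq_of_lt ?_
  rw [stateNumber]
  omega

theorem position_state {n : ℕ} {v : ℕ × Loc} (h : v.1 ≤ n) (hv : Valid v.1 v.2) :
    position (state n v) = v := by
  have h1 := v.2.number_lt
  have h2 : stateNumber v / 32 = v.1 := by rw [stateNumber]; omega
  have h3 : stateNumber v % 32 = v.2.number := by rw [stateNumber]; omega
  rw [val_state h, position, h2, h3, locOf_number hv]

theorem valid_entrance (b : ℕ) : Valid (entrance b).1 (entrance b).2 := by
  by_cases h : b = 0
  · left; simp [entrance, h]
  · right; simp [entrance, h]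

theorem valid_succ {b : ℕ} {l : Loc} (h : Valid b l ∨ l = pad) (a : Bool) :
    Valid ((l.succ a).target b).1 ((l.succ a).target b).2 ∧ ((l.succ a).target b).1 ≤ b := by
  rcases h with (⟨rfl, rfl⟩ | ⟨hb, h1, h2⟩) | rfl
  · exact ⟨valid_entrance 0, le_rfl⟩
  · cases l <;> cases a <;> simp only [Loc.succ, Ref.target] <;>
      first
        | exact ⟨valid_entrance _, by simp [entrance]⟩
        | exact ⟨Or.inr ⟨hb, by simp, by simp⟩, le_rfl⟩
  · exact ⟨valid_entrance 0, Nat.zero_le _⟩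

/-- In the mixed-radix numbering a digit of a one-element factor is 0 and its radix 1 contributes
nothing, so at a turn-based state the number of a profile is the controller's action. -/
theorem finPiFinEquiv_eq {m : ℕ} {n : Fin m → ℕ} (f : ∀ i, Fin (n i)) (c : Fin m)
    (h : ∀ i, i ≠ c → n i = 1) : (finPiFinEquiv f : ℕ) = f c := by
  rw [finPiFinEquiv_apply, Finset.sum_eq_single c]
  · rw [Finset.prod_eq_one, mul_one]
    intro j _
    exact h _ (ne_of_lt (by exact j.2))
  · intro i _ hi
    have h1 := (f i).2
    have h2 := h i hi
    have h3 : (f i : ℕ) = 0 := by omega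
    rw [h3, zero_mul]
  · simp

/-! ### The instance is a turn-based terminal-reward game -/

section Game

variable (x : List ℕ × ℕ)

/-- The numbers of the positions of the game. -/
abbrev States := Fin ((x.1.length + 1) * 32)

noncomputable abbrev theGame : ConcurrentGame (Fin 8) (States x) (Fin 2) := (gameInstance x).game

def ctrl (s : States x) : Fin 8 := (position s).2.controller

def stateSucc (s : States x) (a : Fin 2) : States x :=
  state _ (((position s).2.succ (a = 1)).target (position s).1)

variable {x}

theorem mem_legal {i : Fin 8} {s : States x} {a : Fin 2} :
    a ∈ (theGame x).legal i s ↔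
      a = 0 ∨ ((position s).2.binary = true ∧ i = (position s).2.controller) := by
  have h : a ∈ (theGame x).legal i s ↔
      a ≤ if (position s).2.binary ∧ i = (position s).2.controller then (1 : Fin 2) else 0 := by
    exact (Finset.mem_filter.trans (and_iff_right (Finset.mem_univ _)))
  rw [h]
  split
  · next h => simp [h, Fin.le_last a |> fun h => show a ≤ 1 from h]
  · next h => simp [h]

theorem position_lt (s : States x) : (position s).1 ≤ x.1.length := by
  have := s.2
  simp only [position]
  omega

theorem position_cases (s : States x) :
    Valid (position s).1 (position s).2 ∨ (position s).2 = pad := locOf_cases _ _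

theorem position_stateSucc (s : States x) (a : Fin 2) :
    position (stateSucc x s a) = ((position s).2.succ (a = 1)).target (position s).1 := by
  have h := valid_succ (position_cases s) (decide (a = 1))
  exact position_state (h.2.trans (position_lt s)) h.1

theorem maxAction_eq (s : States x) (i : Fin 8) : (gameInstance x).maxAction s i =
    if (position s).2.binary ∧ i = (position s).2.controller then (1 : Fin 2) else 0 := rfl

theorem table_eq (s : States x) (a : Fin (∏ i, (((gameInstance x).maxAction s i : ℕ) + 1))) :
    (gameInstance x).table s a =
      state _ (((position s).2.succ (a.val = 1)).target (position s).1) := rfl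

theorem isDriven : (theGame x).IsDriven (ctrl x) (stateSucc x) := by
  intro s a ha
  have h (i : Fin 8) : a i ≤ (gameInstance x).maxAction s i := (Finset.mem_filter.1 (ha i)).2
  have h0 : (theGame x).trans s a = (gameInstance x).table s
      (finPiFinEquiv fun i => ⟨a i, Nat.lt_succ_of_le (h i)⟩) := dif_pos h
  rw [h0, table_eq, stateSucc]
  refine congrArg (fun r => state _ (Ref.target (position s).1 r)) ?_
  by_cases hb : (position s).2.binary = true
  · refine congrArg (position s).2.succ ?_
    rw [decide_eq_decide, finPiFinEquiv_eq _ (ctrl x s)]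
    · exact ⟨fun h => Fin.ext h, fun h => congrArg Fin.val h⟩
    · intro i hi
      rw [maxAction_eq, if_neg fun h => hi h.2]
      rfl
  · exact Loc.succ_of_not_binary (by simpa using hb) _ _

theorem isTurnBased : (theGame x).IsTurnBased := by
  intro s
  refine ⟨ctrl x s, fun j hj => ?_⟩
  have : (theGame x).legal j s = {0} := by
    ext a
    rw [mem_legal, Finset.mem_singleton]
    exact ⟨fun h => h.resolve_right fun h => hj h.2, Or.inl⟩
  rw [this, Finset.card_singleton]

theorem isTerminal_of_succ (s : States x)
    (h : ∀ a, stateSucc x s a = s) : (theGame x).IsTerminal s := by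
  intro a ha
  rw [isDriven s a ha, h]

theorem reward_eq (i : Fin 8) (s : States x) : (theGame x).reward i s =
    fracValue (((position s).2.reward i).frac (size x + (position s).1)
      (entryAt x (position s).1)) := rfl

theorem fracValue_zero : fracValue (0, 1) = 0 := by simp [fracValue]

/-- Validity is needed because all padding states share one position. -/
theorem stateNumber_position (s : ℕ) (h : Valid (position s).1 (position s).2) :
    stateNumber (position s) = s := by
  have h1 : s % 32 < 32 := Nat.mod_lt _ (by norm_num)
  have key : (position s).2.number = s % 32 := by
    rcases h with ⟨h0, h2⟩ | ⟨h0, h2, h3⟩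
    · simp only [position] at h0 h2 ⊢
      rw [h0] at h2 ⊢
      by_contra hne
      have : s % 32 ≠ 31 := fun h => hne (by rw [h]; rfl)
      simp [locOf, this] at h2
    · simp only [position] at h0 h2 h3 ⊢
      generalize s % 32 = j at *
      have e : locOf (s / 32) j = locOf 1 j := by simp [locOf, h0]
      rw [e] at h3 ⊢
      interval_cases j <;> first | rfl | exact absurd rfl h3
  rw [stateNumber, key]
  simp only [position]
  omega

theorem state_position (s : States x) (h : Valid (position s).1 (position s).2) :
    state _ (position s) = s :=
  Fin.ext (by rw [val_state (position_lt s), stateNumber_position _ h])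

theorem isTerminalReward : (theGame x).IsTerminalReward := by
  intro i s h
  refine isTerminal_of_succ s fun a => ?_
  rw [reward_eq] at h
  have hpad : (position s).2 ≠ pad := fun hp => h (by rw [hp]; exact fracValue_zero)
  have hv := (position_cases s).resolve_right hpad
  conv_rhs => rw [← state_position s hv]
  rw [stateSucc]
  congr 1
  revert hv h
  generalize position s = v
  obtain ⟨b, l⟩ := v
  intro h hv
  cases l <;> first | rfl | exact absurd fracValue_zero h | skip
  rcases hv with ⟨h0, _⟩ | ⟨_, h1, _⟩
  · subst h0; rfl
  · exact absurd rfl h1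

end Game

end SqrtReduction

end

section

open ConcurrentGame Filter Topology

namespace SqrtReduction

open SqrtGame Node Loc

/-! ### Sizes of numbers -/

theorem lt_two_pow_length_encodePosNum (p : PosNum) :
    (p : ℕ) < 2 ^ (Computability.encodePosNum p).length := by
  induction p with
  | one => simp [Computability.encodePosNum]
  | bit0 p ih =>
    rw [PosNum.cast_bit0, Computability.encodePosNum, List.length_cons, pow_succ]; omega
  | bit1 p ih =>
    rw [PosNum.cast_bit1, Computability.encodePosNum, List.length_cons, pow_succ]; omega

theorem lt_two_pow_length_encodeNat (d : ℕ) : d < 2 ^ (Computability.encodeNat d).length := by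
  conv_lhs => rw [← Num.to_of_nat d]
  rw [Computability.encodeNat]
  cases (d : Num) with
  | zero => simp
  | pos p => exact lt_two_pow_length_encodePosNum p

theorem length_nat (d : ℕ) : (Code.nat d).length = (Computability.encodeNat d).length + 1 := by
  simp [Code.nat]

theorem length_list_nat (l : List ℕ) {d : ℕ} (hd : d ∈ l) :
    (Computability.encodeNat d).length + 1 ≤ (Code.list Code.nat l).length := by
  induction l with
  | nil => simp at hd
  | cons a l ih =>
    rw [Code.list, List.length_cons, List.length_append, length_nat]
    rcases List.mem_cons.1 hd with rfl | h
    · omega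
    · have := ih h; omega

theorem length_encodeNat_entryAt (x : List ℕ × ℕ) (b : ℕ) :
    (Computability.encodeNat (entryAt x b)).length + 1 ≤ size x := by
  rw [size, Code.sqrtSumInstance, Code.prod, List.length_append, length_nat, entryAt]
  by_cases h : b - 1 < x.1.length
  · have := length_list_nat x.1 (List.getElem_mem h)
    rw [List.getD_eq_getElem _ _ h]; omega
  · rw [List.getD_eq_default _ _ (by omega)]
    have : (Computability.encodeNat 0).length = 0 := rfl
    omega

theorem entryAt_lt (x : List ℕ × ℕ) (b : ℕ) : entryAt x b < 2 ^ size x :=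
  (lt_two_pow_length_encodeNat _).trans_le
    (Nat.pow_le_pow_right (by norm_num) (by have := length_encodeNat_entryAt x b; omega))

/-! ### The rewards -/

/-- The rewards at the exits, with no rewards for the players 6 and 7. -/
noncomputable def exitValue (p : ℝ) (x : Node) (i : Fin 8) : ℝ :=
  if h : i.val < 6 then exitReward p x ⟨i, h⟩ else 0

noncomputable def Reward.value (e d : ℕ) : Reward → ℝ
  | zero => 0
  | one => 1
  | two => 2
  | negOne => -1
  | oneSub => 1 - d / 4 ^ e
  | twoSub => 2 - d / 4 ^ e
  | small => (1 / 2) ^ e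
  | negSmall => -(1 / 2) ^ e

theorem fracValue_frac (e d : ℕ) (r : Reward) : fracValue (r.frac e d) = r.value e d := by
  cases r <;> simp [fracValue, Reward.frac, Reward.value, sub_div]
  rw [neg_div, one_div]

theorem value_exitCode (e d : ℕ) (x : Node) (i : Fin 8) :
    (exitCode x i).value e d = exitValue (d / 4 ^ e) x i := by
  cases x <;> fin_cases i <;> rfl

section Game

variable {x : List ℕ × ℕ}

/-- The parameter of the game in the block `b`. -/
noncomputable def param (x : List ℕ × ℕ) (b : ℕ) : ℝ := entryAt x b / 4 ^ (size x + b)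

theorem param_nonneg (b : ℕ) : 0 ≤ param x b := by unfold param; positivity

/-- This is where the input length enters the exponent: an entry is smaller than two to that length,
so the parameter of the copy is at most 1. -/
theorem param_le_one (b : ℕ) : param x b ≤ 1 := by
  rw [param, div_le_one (by positivity)]
  have h1 : entryAt x b ≤ 4 ^ (size x + b) :=
    (entryAt_lt x b).le.trans ((Nat.pow_le_pow_left (by norm_num) _).trans
      (Nat.pow_le_pow_right (by norm_num) (Nat.le_add_right _ _)))
  exact_mod_cast h1

theorem sqrt_param (b : ℕ) :
    Real.sqrt (param x b) = (1 / 2) ^ (size x + b) * Real.sqrt (entryAt x b) := by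
  have : (4 : ℝ) ^ (size x + b) = (2 ^ (size x + b)) ^ 2 := by
    rw [← pow_mul, mul_comm, pow_mul]; norm_num
  rw [param, Real.sqrt_div (by positivity), this, Real.sqrt_sq (by positivity), one_div, inv_pow]
  ring

/-- The reward at a position. -/
noncomputable def rewardAt (x : List ℕ × ℕ) (i : Fin 8) (v : ℕ × Loc) : ℝ :=
  (v.2.reward i).value (size x + v.1) (entryAt x v.1)

theorem reward_eq_rewardAt (i : Fin 8) (s : States x) :
    (theGame x).reward i s = rewardAt x i (position s) := by
  rw [reward_eq, fracValue_frac]; rfl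

theorem rewardAt_exit (i : Fin 8) (b : ℕ) (y : Node) :
    rewardAt x i (b, exit y) = exitValue (param x b) y i := value_exitCode _ _ _ _

theorem rewardAt_zero_nonpos (v : ℕ × Loc) : rewardAt x 0 v ≤ 0 := by
  obtain ⟨b, l⟩ := v
  cases l with
  | exit y => rw [rewardAt_exit]; cases y <;> simp [exitValue, exitReward]
  | _ => simp [rewardAt, Loc.reward, Reward.value]

theorem rewardAt_seven (v : ℕ × Loc) : rewardAt x 7 v = -1 * rewardAt x 6 v := by
  obtain ⟨b, l⟩ := v
  cases l with
  | exit y => rw [rewardAt_exit, rewardAt_exit]; simp [exitValue]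
  | _ => simp [rewardAt, Loc.reward, Reward.value]

/-! ### The payoffs of a stationary profile -/

/-- The probability of the second action. -/
noncomputable def prob (σ : (theGame x).Profile) (v : ℕ × Loc) : ℝ :=
  ((σ (ctrl x (state _ v))).1 [] (state _ v) 1).toReal

/-- The payoff from a position. -/
noncomputable def value (σ : (theGame x).Profile) (i : Fin 8) (v : ℕ × Loc) : ℝ :=
  σ.payoff (state _ v) i

theorem stateSucc_state {v : ℕ × Loc} (hb : v.1 ≤ x.1.length) (hv : Valid v.1 v.2) (a : Fin 2) :
    stateSucc x (state _ v) a = state _ ((v.2.succ (a = 1)).target v.1) := by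
  rw [stateSucc, position_state hb hv]

theorem prob_nonneg (σ : (theGame x).Profile) (v : ℕ × Loc) : 0 ≤ prob σ v :=
  ENNReal.toReal_nonneg

theorem prob_le_one (σ : (theGame x).Profile) (v : ℕ × Loc) : prob σ v ≤ 1 :=
  toReal_pmf_le_one _ _

theorem prob_zero (σ : (theGame x).Profile) (v : ℕ × Loc) :
    ((σ (ctrl x (state _ v))).1 [] (state _ v) 0).toReal = 1 - prob σ v := by
  have h := sum_toReal_pmf ((σ (ctrl x (state _ v))).1 [] (state _ v))
  rw [Fin.sum_univ_two] at h
  rw [← h, prob]; ring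

theorem value_eq {σ : (theGame x).Profile} (hσ : σ.IsStationary) (i : Fin 8) {v : ℕ × Loc}
    (hb : v.1 ≤ x.1.length) (hv : Valid v.1 v.2) :
    value σ i v = prob σ v * value σ i ((v.2.succ true).target v.1) +
      (1 - prob σ v) * value σ i ((v.2.succ false).target v.1) := by
  rw [value, isDriven.payoff_eq_sum isTerminalReward hσ, Fin.sum_univ_two, prob_zero,
    stateSucc_state hb hv, stateSucc_state hb hv, add_comm]
  rfl

theorem isTerminal_state {v : ℕ × Loc} (hb : v.1 ≤ x.1.length) (hv : Valid v.1 v.2)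
    (h : ∀ a, (v.2.succ a).target v.1 = v) : (theGame x).IsTerminal (state _ v) :=
  isTerminal_of_succ _ fun a => by rw [stateSucc_state hb hv, h]

theorem value_of_terminal {σ : (theGame x).Profile} (hσ : σ.IsStationary) (i : Fin 8)
    {v : ℕ × Loc} (hb : v.1 ≤ x.1.length) (hv : Valid v.1 v.2)
    (h : ∀ a, (v.2.succ a).target v.1 = v) : value σ i v = rewardAt x i v := by
  rw [value, payoff_of_isTerminal isTerminalReward hσ i (isTerminal_state hb hv h),
    reward_eq_rewardAt, position_state hb hv]

theorem value_node {σ : (theGame x).Profile} (hσ : σ.IsStationary) (i : Fin 8) {b : ℕ}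
    (hb : b ≤ x.1.length) (hb0 : b ≠ 0) (y : Node) :
    value σ i (b, node y) = prob σ (b, node y) * exitValue (param x b) y i +
      (1 - prob σ (b, node y)) * value σ i (b, node (next y)) := by
  rw [value_eq hσ i hb (Or.inr ⟨hb0, by simp, by simp⟩), ← rewardAt_exit,
    ← value_of_terminal hσ i (v := (b, exit y)) hb (Or.inr ⟨hb0, by simp, by simp⟩) fun a => rfl]
  rfl

/-- The states that are reached with positive probability from the initial state. -/
def Reached (σ : (theGame x).Profile) (v : ℕ × Loc) : Prop :=
  Reach (ctrl x) (stateSucc x) σ (gameInstance x).init (state _ v)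

theorem Reached.succ_true {σ : (theGame x).Profile} {v : ℕ × Loc} (h : Reached σ v)
    (hb : v.1 ≤ x.1.length) (hv : Valid v.1 v.2) (hp : prob σ v ≠ 0) :
    Reached σ ((v.2.succ true).target v.1) := by
  have := Reach.step 1 h fun h0 => hp (by rw [prob, h0]; rfl)
  rw [stateSucc_state hb hv] at this
  exact this

theorem Reached.succ_false {σ : (theGame x).Profile} {v : ℕ × Loc} (h : Reached σ v)
    (hb : v.1 ≤ x.1.length) (hv : Valid v.1 v.2) (hp : prob σ v ≠ 1) :
    Reached σ ((v.2.succ false).target v.1) := by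
  have := Reach.step 0 h fun h0 => hp (by
    have := prob_zero σ v
    rw [h0] at this
    simp only [ENNReal.toReal_zero] at this
    linarith)
  rw [stateSucc_state hb hv] at this
  exact this

/-- Comparison with factor 0 via `IsDriven.payoff_congr`, for positions inside one block. -/
theorem value_closed {σ : (theGame x).Profile} (hσ : σ.IsStationary) (i : Fin 8) {b : ℕ}
    (hb : b ≤ x.1.length) (L : Set Loc) (hL : ∀ l ∈ L, l ≠ Loc.base ∧ l ≠ pad) (hb0 : b ≠ 0)
    (htrue : ∀ l ∈ L, prob σ (b, l) ≠ 0 → ∃ l' ∈ L, (l.succ true).target b = (b, l'))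
    (hfalse : ∀ l ∈ L, ∃ l' ∈ L, (l.succ false).target b = (b, l'))
    (hr : ∀ l ∈ L, rewardAt x i (b, l) = 0) (l : Loc) (hl : l ∈ L) : value σ i (b, l) = 0 := by
  have hv (l) (hl : l ∈ L) : Valid b l := Or.inr ⟨hb0, hL l hl⟩
  have := isDriven.payoff_congr isTerminalReward hσ hσ i i 0
    ((fun l => state x.1.length (b, l)) '' L) (by
      rintro _ ⟨l, hl, rfl⟩ a ha
      rw [stateSucc_state (v := (b, l)) hb (hv l hl)]
      by_cases h1 : a = 1
      · subst h1
        obtain ⟨l', hl', he⟩ := htrue l hl (ENNReal.toReal_ne_zero.2 ⟨ha, PMF.apply_ne_top _ _⟩)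
        exact ⟨l', hl', congrArg _ he.symm⟩
      · obtain ⟨l', hl', he⟩ := hfalse l hl
        refine ⟨l', hl', ?_⟩
        simp only [h1, decide_false]
        exact congrArg _ he.symm)
    (by
      rintro _ ⟨l, hl, rfl⟩
      rw [reward_eq_rewardAt, position_state (v := (b, l)) hb (hv l hl), hr l hl, zero_mul])
    (fun _ _ _ => rfl) (state _ (b, l)) ⟨l, hl, rfl⟩
  rw [value, this, zero_mul]

/-- The rewards of the players 6 and 7 are opposite at every state, so the comparison with factor
`-1` applies to the whole state space. -/
theorem value_seven {σ : (theGame x).Profile} (hσ : σ.IsStationary) (v : ℕ × Loc) :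
    value σ 7 v = -value σ 6 v := by
  have := isDriven.payoff_congr isTerminalReward hσ hσ 7 6 (-1) Set.univ
    (fun _ _ _ _ => Set.mem_univ _) (fun s _ => by
      rw [reward_eq_rewardAt, reward_eq_rewardAt, rewardAt_seven]) (fun _ _ _ => rfl)
    (state _ v) (Set.mem_univ _)
  rw [value, this, value]; ring

end Game

end SqrtReduction

end

/-! ### From an equilibrium to the inequality for the square roots -/

section

open ConcurrentGame Filter Topology

namespace SqrtReduction

open SqrtGame Node Loc

section Game

variable {x : List ℕ × ℕ}

/-- The sum of the square roots of the first `b` numbers. -/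
noncomputable def sqrtSum (x : List ℕ × ℕ) (b : ℕ) : ℝ :=
  ∑ j ∈ Finset.range b, Real.sqrt (entryAt x (j + 1))

theorem sqrtSum_length : sqrtSum x x.1.length = (x.1.map fun d : ℕ => Real.sqrt (d : ℝ)).sum := by
  rw [← List.ofFn_getElem (xs := x.1.map fun d : ℕ => Real.sqrt (d : ℝ)), List.sum_ofFn,
    sqrtSum, Finset.sum_range]
  refine Fintype.sum_equiv (finCongr (by simp)) _ _ fun j => ?_
  simp [entryAt]

theorem valid_of_ne {b : ℕ} {l : Loc} (hb0 : b ≠ 0) (h1 : l ≠ Loc.base := by simp)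
    (h2 : l ≠ pad := by simp) : Valid b l := Or.inr ⟨hb0, h1, h2⟩

theorem rewardAt_fail₆ (b : ℕ) :
    rewardAt x 0 (b, fail₆) = -1 ∧ rewardAt x 6 (b, fail₆) = (1 / 2) ^ (size x + b) :=
  ⟨rfl, rfl⟩

theorem rewardAt_fail₇ (b : ℕ) :
    rewardAt x 0 (b, fail₇) = -1 ∧ rewardAt x 7 (b, fail₇) = -(1 / 2) ^ (size x + b) :=
  ⟨rfl, rfl⟩

/-- In an equilibrium in which player 0 receives payoff `0`, player 1 receives at most `√p` in the
block with parameter `p`. -/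
theorem value_block_le {σ : (theGame x).Profile} (hσ : σ.IsStationary)
    (hN : σ.IsNashEquilibrium (gameInstance x).init)
    (h0 : ∀ v, Reached σ v → value σ 0 v = 0) {b : ℕ} (hb : b ≤ x.1.length) (hb0 : b ≠ 0)
    (hR : Reached σ (b, node s₁)) : value σ 1 (b, node s₁) ≤ Real.sqrt (param x b) := by
  have hv (y : Node) : Valid b (node y) := valid_of_ne hb0
  refine payoff_le_sqrt (e := fun y => prob σ (b, node y))
    (V := fun i y => value σ (i.castLE (by decide)) (b, node y))
    (R := fun y => Reached σ (b, node y)) (param_nonneg b) (param_le_one b)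
    (fun y => prob_nonneg σ _) (fun y => prob_le_one σ _) ?_ hR ?_ ?_ ?_ ?_
  · intro i y
    rw [value_node hσ _ hb hb0, exitValue, dif_pos (by exact i.2)]
    rfl
  · intro y hy hp
    exact hy.succ_false hb (hv y) hp
  · intro y hy _
    have ht : (theGame x).IsTerminal (stateSucc x (state _ (b, node y)) 1) := by
      rw [stateSucc_state (v := (b, node y)) hb (hv y)]
      exact isTerminal_state (v := (b, exit y)) hb (valid_of_ne hb0) fun _ => rfl
    have hpos : position (state x.1.length (b, node y)) = (b, node y) :=
      position_state (v := (b, node y)) hb (hv y)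
    have hc : ctrl x (state _ (b, node y)) = (controller y).castLE (by decide) := by
      rw [ctrl, hpos]; rfl
    have h := isDriven.reward_le_payoff isTerminalReward hσ hN hy (b := 1) (by
      rw [mem_legal, hpos]; exact Or.inr ⟨rfl, hc⟩) ht
    have hs : stateSucc x (state _ (b, node y)) 1 = state _ (b, exit y) :=
      stateSucc_state (v := (b, node y)) hb (hv y) 1
    rw [hc, hs, reward_eq_rewardAt,
      position_state (v := (b, exit y)) hb (valid_of_ne hb0)] at h
    refine le_trans (le_of_eq ?_) h
    refine Eq.trans ?_ (rewardAt_exit _ b y).symm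
    rw [exitValue, dif_pos (by exact (controller y).2)]
    rfl
  · intro y hy hc
    -- A used exit of another player would be a reached state in which player 0 receives `-1`.
    by_contra hp
    have h1 := h0 _ (hy.succ_true hb (hv y) hp)
    have h2 : value σ 0 (b, exit y) = rewardAt x 0 (b, exit y) :=
      value_of_terminal hσ 0 (v := (b, exit y)) hb (valid_of_ne hb0) fun _ => rfl
    have h3 : exitReward (param x b) y 0 = 0 := by
      have h4 := rewardAt_exit (x := x) 0 b y
      rw [← h2] at h4
      exact h4.symm.trans h1
    cases y <;> simp [exitReward, SqrtGame.controller] at h3 hc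
  · intro hp i
    refine value_closed hσ _ hb (Set.range node) ?_ hb0 ?_ ?_ ?_ _ ⟨s₁, rfl⟩
    · rintro _ ⟨y, rfl⟩; simp
    · rintro _ ⟨y, rfl⟩ h; exact absurd (hp y) h
    · rintro _ ⟨y, rfl⟩; exact ⟨_, ⟨next y, rfl⟩, rfl⟩
    · rintro _ ⟨y, rfl⟩; rfl

theorem value_six_node {σ : (theGame x).Profile} (hσ : σ.IsStationary) {b : ℕ}
    (hb : b ≤ x.1.length) (hb0 : b ≠ 0) (y : Node) : value σ 6 (b, node y) = 0 := by
  refine value_closed hσ _ hb (Set.range node ∪ Set.range exit) ?_ hb0 ?_ ?_ ?_ _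
    (Or.inl ⟨y, rfl⟩)
  · rintro _ (⟨y, rfl⟩ | ⟨y, rfl⟩) <;> simp
  · rintro _ (⟨y, rfl⟩ | ⟨y, rfl⟩) _ <;> exact ⟨_, Or.inr ⟨y, rfl⟩, rfl⟩
  · rintro _ (⟨y, rfl⟩ | ⟨y, rfl⟩)
    · exact ⟨_, Or.inl ⟨next y, rfl⟩, rfl⟩
    · exact ⟨_, Or.inr ⟨y, rfl⟩, rfl⟩
  · rintro _ (⟨y, rfl⟩ | ⟨y, rfl⟩)
    · rfl
    · rw [rewardAt_exit]; simp [exitValue]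

theorem half_pow_pred {b : ℕ} (hb0 : b ≠ 0) :
    (1 / 2 : ℝ) ^ (size x + (b - 1)) = 2 * (1 / 2) ^ (size x + b) := by
  obtain ⟨c, rfl⟩ := Nat.exists_eq_succ_of_ne_zero hb0
  rw [Nat.succ_sub_one, Nat.add_succ, pow_succ]; ring

theorem value_entrance_zero {σ : (theGame x).Profile} (hσ : σ.IsStationary) (i : Fin 8) :
    value σ i (entrance 0) = rewardAt x i (0, Loc.base) :=
  value_of_terminal hσ i (v := (0, Loc.base)) (Nat.zero_le _) (Or.inl ⟨rfl, rfl⟩) fun _ => rfl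

/-- The players 6 and 7 force player 0 to choose each block with the right probability. -/
theorem value_entrance {σ : (theGame x).Profile} (hσ : σ.IsStationary)
    (hN : σ.IsNashEquilibrium (gameInstance x).init)
    (h0 : ∀ v, Reached σ v → value σ 0 v = 0) (b : ℕ) (hb : b ≤ x.1.length)
    (hR : Reached σ (entrance b)) :
    value σ 6 (entrance b) = (1 / 2) ^ (size x + b) ∧
      value σ 1 (entrance b) ≤ (1 / 2) ^ (size x + b + 1) * sqrtSum x b := by
  induction b with
  | zero =>
    rw [value_entrance_zero hσ, value_entrance_zero hσ]
    exact ⟨rfl, by simp [sqrtSum, rewardAt, Loc.reward, Reward.value]⟩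
  | succ b ih =>
    have hb0 : b + 1 ≠ 0 := Nat.succ_ne_zero b
    have ent : entrance (b + 1) = (b + 1, chk₆) := by simp [entrance]
    rw [ent] at hR ⊢
    -- A failure state costs player 0 one unit, so it cannot be reached and the checks are passed
    -- surely.
    have hfail (l : Loc) (hR : Reached σ (b + 1, l)) (hl : Valid (b + 1) l) (f : Loc)
        (hf : Valid (b + 1) f) (ht : (l.succ true).target (b + 1) = (b + 1, f))
        (hff : ∀ a, (f.succ a).target (b + 1) = (b + 1, f))
        (hr : rewardAt x 0 (b + 1, f) = -1) : prob σ (b + 1, l) = 0 := by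
      by_contra hp
      have h1 := hR.succ_true hb hl hp
      dsimp only at h1
      rw [ht] at h1
      have h2 := h0 _ h1
      rw [value_of_terminal hσ 0 (v := (b + 1, f)) hb hf hff, hr] at h2
      norm_num at h2
    have e6 := hfail chk₆ hR (valid_of_ne hb0) fail₆ (valid_of_ne hb0) rfl (fun _ => rfl)
      (rewardAt_fail₆ _).1
    have hR7 : Reached σ (b + 1, chk₇) :=
      hR.succ_false hb (valid_of_ne hb0) (by rw [e6]; norm_num)
    have e7 := hfail chk₇ hR7 (valid_of_ne hb0) fail₇ (valid_of_ne hb0) rfl (fun _ => rfl)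
      (rewardAt_fail₇ _).1
    have hRc : Reached σ (b + 1, coin) :=
      hR7.succ_false hb (valid_of_ne hb0) (by rw [e7]; norm_num)
    have v6 (i : Fin 8) : value σ i (b + 1, chk₆) = value σ i (b + 1, chk₇) := by
      rw [value_eq hσ i (v := (b + 1, chk₆)) hb (valid_of_ne hb0), e6]
      simp [Loc.succ, Ref.target]
    have v7 (i : Fin 8) : value σ i (b + 1, chk₇) = value σ i (b + 1, coin) := by
      rw [value_eq hσ i (v := (b + 1, chk₇)) hb (valid_of_ne hb0), e7]
      simp [Loc.succ, Ref.target]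
    have vc (i : Fin 8) : value σ i (b + 1, coin) =
        prob σ (b + 1, coin) * value σ i (b + 1, node s₁) +
          (1 - prob σ (b + 1, coin)) * value σ i (entrance b) := by
      rw [value_eq hσ i (v := (b + 1, coin)) hb (valid_of_ne hb0)]
      rfl
    have hexit (l : Loc) (hR : Reached σ (b + 1, l)) (hl : Valid (b + 1) l) (f : Loc)
        (hf : Valid (b + 1) f) (ht : (l.succ true).target (b + 1) = (b + 1, f))
        (hff : ∀ a, (f.succ a).target (b + 1) = (b + 1, f)) (hbin : l.binary = true) :
        rewardAt x l.controller (b + 1, f) ≤ value σ l.controller (b + 1, l) := by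
      have hpos : position (state x.1.length (b + 1, l)) = (b + 1, l) :=
        position_state (v := (b + 1, l)) hb hl
      have hc : ctrl x (state _ (b + 1, l)) = l.controller := by rw [ctrl, hpos]
      have hs : stateSucc x (state _ (b + 1, l)) 1 = state _ (b + 1, f) := by
        rw [stateSucc_state (v := (b + 1, l)) hb hl, ← ht]; rfl
      have h := isDriven.reward_le_payoff isTerminalReward hσ hN hR (b := 1) (by
        rw [mem_legal, hpos]; exact Or.inr ⟨hbin, hc⟩) (by
        rw [hs]; exact isTerminal_state (v := (b + 1, f)) hb hf hff)
      rw [hc, hs, reward_eq_rewardAt, position_state (by exact hb) (by exact hf)] at h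
      exact h
    have x6 : (1 / 2 : ℝ) ^ (size x + (b + 1)) ≤ value σ 6 (b + 1, chk₆) :=
      hexit chk₆ hR (valid_of_ne hb0) fail₆ (valid_of_ne hb0) rfl (fun _ => rfl) rfl
    have x7 : -(1 / 2 : ℝ) ^ (size x + (b + 1)) ≤ value σ 7 (b + 1, chk₇) :=
      hexit chk₇ hR7 (valid_of_ne hb0) fail₇ (valid_of_ne hb0) rfl (fun _ => rfl) rfl
    rw [value_seven hσ, ← v6] at x7
    -- The threat of player 6 bounds this payoff from below; that of player 7, whose payoff is the
    -- negative, bounds it from above.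
    have hval : value σ 6 (b + 1, chk₆) = (1 / 2 : ℝ) ^ (size x + (b + 1)) := by linarith
    have hc6 := vc 6
    rw [← v7, ← v6, hval, value_six_node hσ hb hb0, mul_zero, zero_add] at hc6
    have hT : (0 : ℝ) < (1 / 2) ^ (size x + (b + 1)) := by positivity
    -- Always entering the copy would leave player 6 with 0. Hence the next entrance is reached and
    -- the induction hypothesis applies.
    have hq1 : prob σ (b + 1, coin) ≠ 1 := by
      intro h
      rw [h, sub_self, zero_mul] at hc6
      exact hT.ne' hc6
    have hRn := hRc.succ_false hb (valid_of_ne hb0) hq1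
    obtain ⟨i6, i1⟩ := ih (by omega) hRn
    have hpred := half_pow_pred (x := x) hb0
    rw [Nat.add_sub_cancel] at hpred
    rw [i6, hpred] at hc6
    -- Continuing is worth twice the required amount to player 6 and the copy is worth nothing, so
    -- both have probability one half.
    have hq : prob σ (b + 1, coin) = 1 / 2 := by
      have : (1 - 2 * prob σ (b + 1, coin)) * (1 / 2 : ℝ) ^ (size x + (b + 1)) = 0 := by
        linarith
      rcases mul_eq_zero.1 this with h | h
      · linarith
      · exact absurd h hT.ne'
    have hRb : Reached σ (b + 1, node s₁) :=
      hRc.succ_true hb (valid_of_ne hb0) (by rw [hq]; norm_num)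
    have hblock := value_block_le hσ hN h0 hb hb0 hRb
    rw [sqrt_param] at hblock
    refine ⟨hval, ?_⟩
    rw [v6, v7, vc, hq, sqrtSum, Finset.sum_range_succ, ← sqrtSum]
    have h3 : (1 / 2 : ℝ) ^ (size x + b + 1) = (1 / 2) ^ (size x + (b + 1)) := by
      rw [Nat.add_assoc]
    have h4 : (1 / 2 : ℝ) ^ (size x + (b + 1) + 1) = 1 / 2 * (1 / 2) ^ (size x + (b + 1)) := by
      rw [pow_succ]; ring
    rw [h3] at i1
    rw [h4]
    linarith

theorem threshold_value_one : ((gameInstance x).lower 1).value =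
    ((x.2 * (1 / 2 : ℝ) ^ (size x + x.1.length + 1) : ℝ) : EReal) := by
  change Threshold.value (.frac (x.2, 2 ^ (size x + x.1.length + 1))) = _
  simp only [Threshold.value, fracValue]
  congr 1
  push_cast
  rw [one_div, inv_pow, div_eq_mul_inv]

theorem threshold_value_zero : ((gameInstance x).lower 0).value = ((0 : ℝ) : EReal) := by
  change Threshold.value (.frac (0, 1)) = _
  simp [Threshold.value, fracValue]

theorem mem_sqrtSum_of_mem_statNE (h : gameInstance x ∈ StatNE 8) : x ∈ SqrtSum := by
  obtain ⟨σ, hσ, hN, ht⟩ := h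
  have h0 : (0 : ℝ) ≤ value σ 0 (entrance x.1.length) := by
    have := (ht 0).1
    rw [threshold_value_zero] at this
    exact EReal.coe_le_coe_iff.1 this
  have h1 : x.2 * (1 / 2 : ℝ) ^ (size x + x.1.length + 1) ≤ value σ 1 (entrance x.1.length) := by
    have := (ht 1).1
    rw [threshold_value_one] at this
    exact EReal.coe_le_coe_iff.1 this
  have h2 := (value_entrance hσ hN (fun v hv => isDriven.payoff_eq_zero_of_reach isTerminalReward hσ
    (fun s => by rw [reward_eq_rewardAt]; exact rewardAt_zero_nonpos _) h0 hv) x.1.length le_rfl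
    Reach.refl).2
  rw [sqrtSum_length, mul_comm ((1 / 2 : ℝ) ^ _)] at h2
  exact le_of_mul_le_mul_right (h1.trans h2) (by positivity)

end Game

end SqrtReduction

end

/-! ### From the inequality for the square roots to an equilibrium -/

section

open ConcurrentGame Filter Topology

namespace SqrtReduction

open SqrtGame Node Loc

section Game

variable {x : List ℕ × ℕ}

/-- The probability with which the second action is chosen in the equilibrium. -/
noncomputable def weight (e : ℕ → Node → ℝ) : ℕ × Loc → ℝ
  | (b, node y) => e b y
  | (_, coin) => 1 / 2
  | _ => 0

/-- The payoffs at the nodes of a block, with no payoffs for the players 6 and 7. -/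
noncomputable def nodeValue (V : ℕ → Fin 6 → Node → ℝ) (i : Fin 8) (b : ℕ) (y : Node) : ℝ :=
  if h : i.val < 6 then V b ⟨i, h⟩ y else 0

/-- The payoffs at the entrances of the blocks. -/
noncomputable def entranceValue (x : List ℕ × ℕ) (V : ℕ → Fin 6 → Node → ℝ) (i : Fin 8) :
    ℕ → ℝ
  | 0 => rewardAt x i (0, Loc.base)
  | b + 1 => 1 / 2 * nodeValue V i (b + 1) s₁ + 1 / 2 * entranceValue x V i b

/-- The payoffs of the equilibrium, or an upper bound for them. -/
noncomputable def bound (x : List ℕ × ℕ) (V : ℕ → Fin 6 → Node → ℝ) (i : Fin 8) :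
    ℕ × Loc → ℝ
  | (b, node y) => nodeValue V i b y
  | (b, chk₆) | (b, chk₇) | (b, coin) => entranceValue x V i b
  | (_, pad) => (1 / 2) ^ size x
  | v => rewardAt x i v

/-- The termination measure for `IsDriven.isNashEquilibrium`. At the checks and the coin the bound
for player 7 is negative while the reward is 0, so it must be known that every play leaves these
positions; the rank falls along the chain of blocks. -/
def rank : ℕ × Loc → ℕ
  | (b, chk₆) => 3 * b + 3
  | (b, chk₇) => 3 * b + 2
  | (b, coin) => 3 * b + 1
  | _ => 0

variable {e : ℕ → Node → ℝ} {V : ℕ → Fin 6 → Node → ℝ}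

theorem bound_entrance (i : Fin 8) (b : ℕ) :
    bound x V i (entrance b) = entranceValue x V i b := by
  cases b <;> rfl

theorem rank_entrance (b : ℕ) : rank (entrance b) ≤ 3 * b + 3 := by
  cases b <;> simp [entrance, rank]

theorem weight_nonneg (hV : ∀ b, IsOptimal (param x b) (e b) (V b)) (v : ℕ × Loc) :
    0 ≤ weight e v := by
  obtain ⟨b, l⟩ := v
  cases l <;> simp [weight, (hV b).nonneg]

theorem weight_le_one (hV : ∀ b, IsOptimal (param x b) (e b) (V b)) (v : ℕ × Loc) :
    weight e v ≤ 1 := by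
  obtain ⟨b, l⟩ := v
  cases l <;> simp [weight, (hV b).le_one]
  norm_num

theorem binary_of_weight_ne_zero {v : ℕ × Loc} (h : weight e v ≠ 0) : v.2.binary = true := by
  obtain ⟨b, l⟩ := v
  cases l <;> simp [weight] at h ⊢ <;> rfl

theorem nodeValue_eq (hV : ∀ b, IsOptimal (param x b) (e b) (V b)) (i : Fin 8) (b : ℕ)
    (y : Node) : nodeValue V i b y =
      e b y * exitValue (param x b) y i + (1 - e b y) * nodeValue V i b (next y) := by
  simp only [nodeValue, exitValue]
  split
  · exact (hV b).rec_eq _ _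
  · simp

theorem nodeValue_nonneg (hV : ∀ b, IsOptimal (param x b) (e b) (V b)) (i : Fin 8) (b : ℕ)
    (y : Node) : 0 ≤ nodeValue V i b y := by
  rw [nodeValue]
  split
  · exact (hV b).value_nonneg _ _
  · exact le_rfl

theorem entranceValue_zero (hV : ∀ b, IsOptimal (param x b) (e b) (V b)) (b : ℕ) :
    entranceValue x V 0 b = 0 := by
  induction b with
  | zero => rfl
  | succ b ih =>
    have : nodeValue V 0 (b + 1) s₁ = 0 := (hV _).player_zero _
    rw [entranceValue, ih, this]; simp

theorem entranceValue_one (hV : ∀ b, IsOptimal (param x b) (e b) (V b)) (b : ℕ) :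
    entranceValue x V 1 b = (1 / 2) ^ (size x + b + 1) * sqrtSum x b := by
  induction b with
  | zero => simp [entranceValue, rewardAt, Loc.reward, Reward.value, sqrtSum]
  | succ b ih =>
    have : nodeValue V 1 (b + 1) s₁ = Real.sqrt (param x (b + 1)) := (hV _).player_one
    rw [entranceValue, ih, this, sqrt_param, sqrtSum, sqrtSum, Finset.sum_range_succ, pow_succ,
      ← Nat.add_assoc, pow_succ, pow_succ]
    ring

theorem entranceValue_six (b : ℕ) : entranceValue x V 6 b = (1 / 2) ^ (size x + b) := by
  induction b with
  | zero => rfl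
  | succ b ih =>
    have : nodeValue V 6 (b + 1) s₁ = 0 := rfl
    rw [entranceValue, ih, this, ← Nat.add_assoc, pow_succ]; ring

theorem entranceValue_seven (b : ℕ) : entranceValue x V 7 b = -(1 / 2) ^ (size x + b) := by
  induction b with
  | zero => rfl
  | succ b ih =>
    have : nodeValue V 7 (b + 1) s₁ = 0 := rfl
    rw [entranceValue, ih, this, ← Nat.add_assoc, pow_succ]; ring

/-- Makes the constant `2⁻ˢ`, with `s` the input length, a superharmonic bound for all players at
the padding states, which lead to the base. -/
theorem rewardAt_base_le (i : Fin 8) : rewardAt x i (0, Loc.base) ≤ (1 / 2) ^ size x := by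
  have h : (0 : ℝ) ≤ (1 / 2) ^ size x := by positivity
  fin_cases i <;> simp [rewardAt, Loc.reward, Reward.value]

/-- The controller does not gain by choosing another action. -/
theorem bound_target_le (hV : ∀ b, IsOptimal (param x b) (e b) (V b)) {v : ℕ × Loc}
    (hv : Valid v.1 v.2 ∨ v.2 = pad) (a : Bool) :
    bound x V v.2.controller ((v.2.succ a).target v.1) ≤ bound x V v.2.controller v := by
  obtain ⟨b, l⟩ := v
  cases l with
  | node y =>
    have hc : nodeValue V (node y).controller b = V b (SqrtGame.controller y) :=
      funext fun z => dif_pos (by exact (SqrtGame.controller y).2)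
    have h2 : rewardAt x (node y).controller (b, exit y) =
        exitReward (param x b) y (SqrtGame.controller y) := by
      rw [rewardAt_exit, exitValue, dif_pos (by exact (SqrtGame.controller y).2)]; rfl
    have key : V b (SqrtGame.controller y) (next y) ≤ V b (SqrtGame.controller y) y ∧
        exitReward (param x b) y (SqrtGame.controller y) ≤ V b (SqrtGame.controller y) y := by
      by_cases h : SqrtGame.controller y = 0
      · rw [h, (hV b).player_zero, (hV b).player_zero]
        refine ⟨le_rfl, ?_⟩
        cases y <;> simp [exitReward]
      · have h1 := (hV b).rec_eq (SqrtGame.controller y) y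
        rw [(hV b).eq_zero y h] at h1
        exact ⟨by linarith, (hV b).exit_le y h⟩
    cases a with
    | false => exact (congrFun hc _).trans_le (key.1.trans (congrFun hc _).ge)
    | true => exact h2.trans_le (key.2.trans (congrFun hc _).ge)
  | exit y => exact le_rfl
  | fail₆ => exact le_rfl
  | fail₇ => exact le_rfl
  | chk₆ =>
    cases a with
    | false => exact le_rfl
    | true => exact (entranceValue_six b).ge
  | chk₇ =>
    cases a with
    | false => exact le_rfl
    | true => exact (entranceValue_seven b).ge
  | coin =>
    have h : bound x V 0 (b, coin) = 0 := entranceValue_zero hV b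
    change bound x V 0 _ ≤ bound x V 0 (b, coin)
    rw [h]
    cases a with
    | false => exact ((bound_entrance _ _).trans (entranceValue_zero hV _)).le
    | true => exact ((hV b).player_zero s₁).le
  | pad => exact rewardAt_base_le _
  | base =>
    rcases hv with (⟨rfl, _⟩ | ⟨_, h, _⟩) | h
    · exact le_rfl
    · exact absurd rfl h
    · cases h

/-- At nodes and coins this is the payoff recursion, with equality; elsewhere the action `false` is
certain and the bound does not increase along it. -/
theorem weight_bound_le (hV : ∀ b, IsOptimal (param x b) (e b) (V b)) {v : ℕ × Loc}
    (hv : Valid v.1 v.2 ∨ v.2 = pad) (i : Fin 8) :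
    weight e v * bound x V i ((v.2.succ true).target v.1) +
      (1 - weight e v) * bound x V i ((v.2.succ false).target v.1) ≤ bound x V i v := by
  obtain ⟨b, l⟩ := v
  have drop (r s : ℝ) (h : s ≤ bound x V i (b, l)) :
      0 * r + (1 - 0) * s ≤ bound x V i (b, l) := by linarith
  cases l with
  | node y =>
    refine le_of_eq (Eq.trans ?_ (nodeValue_eq hV i b y).symm)
    rw [← rewardAt_exit]; rfl
  | coin =>
    obtain ⟨c, rfl⟩ : ∃ c, b = c + 1 := by
      rcases hv with (⟨_, h⟩ | ⟨h, _⟩) | h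
      · cases h
      · exact Nat.exists_eq_succ_of_ne_zero h
      · cases h
    have h1 : bound x V i ((Loc.coin.succ false).target (c + 1)) = entranceValue x V i c :=
      bound_entrance i c
    dsimp only
    rw [h1]
    change 1 / 2 * nodeValue V i (c + 1) s₁ + (1 - 1 / 2) * _ ≤ 1 / 2 * _ + 1 / 2 * _
    linarith
  | pad => exact drop _ _ (rewardAt_base_le _)
  | base =>
    refine drop _ _ ?_
    rcases hv with (⟨rfl, _⟩ | ⟨_, h, _⟩) | h
    · exact le_rfl
    · exact absurd rfl h
    · cases h
  | _ => exact drop _ _ le_rfl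

theorem rank_target_le {v : ℕ × Loc} (hv : Valid v.1 v.2 ∨ v.2 = pad) (a : Bool) :
    rank ((v.2.succ a).target v.1) ≤ rank v ∧
      (v.2 = chk₆ ∨ v.2 = chk₇ ∨ v.2 = coin → rank ((v.2.succ a).target v.1) < rank v) := by
  obtain ⟨b, l⟩ := v
  have hb (h : l = coin) : 1 ≤ b := by
    subst h
    rcases hv with (⟨_, h⟩ | ⟨h, _⟩) | h
    · cases h
    · exact Nat.one_le_iff_ne_zero.2 h
    · cases h
  cases l with
  | coin =>
    have := hb rfl
    have h2 := rank_entrance (b - 1)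
    have h3 : rank (entrance (b - 1)) < 3 * b + 1 := by omega
    cases a with
    | false => exact ⟨h3.le, fun _ => h3⟩
    | true => exact ⟨Nat.zero_le _, fun _ => Nat.succ_pos _⟩
  | _ => cases a <;> simp [Loc.succ, Ref.target, rank, entrance]

theorem rewardAt_le_bound (hV : ∀ b, IsOptimal (param x b) (e b) (V b)) {v : ℕ × Loc}
    (i : Fin 8) (h : bound x V i v < rewardAt x i v) :
    v.2 = chk₆ ∨ v.2 = chk₇ ∨ v.2 = coin := by
  obtain ⟨b, l⟩ := v
  cases l with
  | node y => exact absurd h (not_lt.2 (nodeValue_nonneg hV i b y))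
  | pad => exact absurd h (not_lt.2 (by positivity : (0 : ℝ) ≤ (1 / 2) ^ size x))
  | chk₆ => simp
  | chk₇ => simp
  | coin => simp
  | _ => exact absurd h (lt_irrefl _)

theorem mem_statNE_of_mem_sqrtSum (hx : x ∈ SqrtSum) : gameInstance x ∈ StatNE 8 := by
  choose e V hV using fun b => exists_isOptimal (param_nonneg (x := x) b) (param_le_one b)
  obtain ⟨σ, hσ, hw⟩ := exists_profile (theGame x) (ctrl x)
    (fun s a => if a = 1 then weight e (position s) else 1 - weight e (position s))
    (by
      intro s a
      split
      · exact weight_nonneg hV _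
      · exact sub_nonneg.2 (weight_le_one hV _))
    (by intro s; simp)
    (by
      intro s a h
      rw [mem_legal]
      by_cases ha : a = 1
      · rw [if_pos ha] at h
        exact Or.inr ⟨binary_of_weight_ne_zero h, rfl⟩
      · left; omega)
  have hprob {v : ℕ × Loc} (hb : v.1 ≤ x.1.length) (hv : Valid v.1 v.2) :
      prob σ v = weight e v := by
    have h := hw (state _ v) 1
    rw [if_pos rfl, position_state hb hv] at h
    exact h
  -- Both sides solve the recursion of the cycle, whose solution is unique because `v₁` is an exit
  -- with positive probability.
  have hnode (i : Fin 8) {b : ℕ} (hb : b ≤ x.1.length) (hb0 : b ≠ 0) (y : Node) :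
      value σ i (b, node y) = nodeValue V i b y := by
    rw [← sub_eq_zero]
    refine eq_zero_of_cycle (D := fun y => value σ i (b, node y) - nodeValue V i b y)
      (hV b).nonneg (hV b).le_one (hV b).pos (fun y => ?_) y
    rw [value_node hσ i hb hb0, hprob (v := (b, node y)) hb (valid_of_ne hb0),
      nodeValue_eq hV i b y]
    simp only [weight]
    ring
  have hent (i : Fin 8) (b : ℕ) (hb : b ≤ x.1.length) :
      value σ i (entrance b) = entranceValue x V i b := by
    induction b with
    | zero => exact value_entrance_zero hσ i
    | succ b ih =>
      have hb0 : b + 1 ≠ 0 := Nat.succ_ne_zero b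
      have v6 : value σ i (b + 1, chk₆) = value σ i (b + 1, chk₇) := by
        rw [value_eq hσ i (v := (b + 1, chk₆)) hb (valid_of_ne hb0),
          hprob (v := (b + 1, chk₆)) hb (valid_of_ne hb0)]
        simp [weight, Loc.succ, Ref.target]
      have v7 : value σ i (b + 1, chk₇) = value σ i (b + 1, coin) := by
        rw [value_eq hσ i (v := (b + 1, chk₇)) hb (valid_of_ne hb0),
          hprob (v := (b + 1, chk₇)) hb (valid_of_ne hb0)]
        simp [weight, Loc.succ, Ref.target]
      have vc : value σ i (b + 1, coin) =
          1 / 2 * value σ i (b + 1, node s₁) + (1 - 1 / 2) * value σ i (entrance b) := by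
        rw [value_eq hσ i (v := (b + 1, coin)) hb (valid_of_ne hb0),
          hprob (v := (b + 1, coin)) hb (valid_of_ne hb0)]
        rfl
      change value σ i (b + 1, chk₆) = _
      rw [v6, v7, vc, hnode i hb hb0, ih (by omega), entranceValue]
      norm_num
  -- At the initial state the superharmonic bounds are the actual payoffs, so no deviation gains.
  have hpay (i : Fin 8) :
      σ.payoff (gameInstance x).init i = entranceValue x V i x.1.length :=
    hent i _ le_rfl
  refine ⟨σ, hσ, ?_, fun i => ⟨?_, ?_⟩⟩
  · refine isDriven.isNashEquilibrium isTerminalReward hσ _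
      (fun i s => bound x V i (position s)) (fun s => rank (position s)) ?_ ?_ ?_ ?_
    · intro s a _
      rw [position_stateSucc]
      exact bound_target_le hV (position_cases s) _
    · intro i s _
      have h0 := hw s 0
      have h1 := hw s 1
      rw [if_pos rfl] at h1
      rw [if_neg (by decide)] at h0
      rw [Fin.sum_univ_two, h0, h1, position_stateSucc, position_stateSucc, add_comm]
      exact weight_bound_le hV (position_cases s) i
    · intro s a _
      rw [position_stateSucc]
      refine ⟨(rank_target_le (position_cases s) _).1, fun i h => ?_⟩
      rw [reward_eq_rewardAt] at h
      exact (rank_target_le (position_cases s) _).2 (rewardAt_le_bound hV i h)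
    · intro i
      rw [hpay]
      have : position (gameInstance x).init = entrance x.1.length :=
        position_state (v := entrance x.1.length) le_rfl (valid_entrance _)
      rw [this, bound_entrance]
  · refine le_of_le_of_eq ?_ (congrArg ((↑) : ℝ → EReal) (hpay i)).symm
    by_cases h0 : i = 0
    · rw [h0, threshold_value_zero, entranceValue_zero hV]
    by_cases h1 : i = 1
    · rw [h1, threshold_value_one, entranceValue_one hV, sqrtSum_length, mul_comm]
      exact EReal.coe_le_coe_iff.2 (mul_le_mul_of_nonneg_left hx (by positivity))
    · have : (gameInstance x).lower i = .negInf := by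
        fin_cases i <;> first | exact absurd rfl h0 | exact absurd rfl h1 | rfl
      rw [this]
      exact bot_le
  · exact le_top

theorem mem_sqrtSum_iff : x ∈ SqrtSum ↔ gameInstance x ∈ StatNE 8 :=
  ⟨mem_statNE_of_mem_sqrtSum, mem_sqrtSum_of_mem_statNE⟩

end Game

end SqrtReduction

end

section

open Computability

namespace SqrtReduction

/-! ### Binary digits -/

/-- The hypothesis excludes a superfluous zero as most significant digit. -/
theorem encodeNat_bit (b : Bool) (n : ℕ) (h : n ≠ 0 ∨ b = true) :
    encodeNat (Nat.bit b n) = b :: encodeNat n := by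
  have h1 (m : ℕ) : encodeNat m = encodeNum (Num.ofNat' m) := by rw [Num.ofNat'_eq]; rfl
  have h0 : Num.ofNat' n = 0 → n = 0 := fun h => by
    rw [Num.ofNat'_eq] at h
    exact_mod_cast h
  rw [h1, h1, Num.ofNat'_bit]
  revert h0
  cases Num.ofNat' n with
  | zero =>
    intro h0
    obtain rfl := h.resolve_left fun hn => hn (h0 rfl)
    rfl
  | pos p => cases b <;> exact fun _ => rfl

/-- Binary addition of one. -/
def incBits : List Bool → List Bool
  | [] => [true]
  | false :: l => true :: l
  | true :: l => false :: incBits l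

theorem encodeNat_succ (n : ℕ) : encodeNat (n + 1) = incBits (encodeNat n) := by
  have h1 (m : ℕ) : encodeNat m = encodeNum (Num.ofNat' m) := by rw [Num.ofNat'_eq]; rfl
  have h2 (p : PosNum) : encodePosNum p.succ = incBits (encodePosNum p) := by
    induction p with
    | one => rfl
    | bit0 p ih => rfl
    | bit1 p ih => exact congrArg (false :: ·) ih
  rw [h1, h1, Num.ofNat'_succ, Num.add_one]
  cases Num.ofNat' n with
  | zero => rfl
  | pos p => exact h2 p

theorem length_incBits_le (l : List Bool) : (incBits l).length ≤ l.length + 1 := by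
  induction l with
  | nil => rfl
  | cons b l ih => cases b <;> simp [incBits]; omega

theorem length_encodeNat_le (n : ℕ) : (encodeNat n).length ≤ n := by
  induction n with
  | zero => rfl
  | succ n ih =>
    rw [encodeNat_succ]
    exact (length_incBits_le _).trans (Nat.succ_le_succ ih)

/-- The form in which a stack program performs the carry: it turns leading ones into zeros, removes
the zero that stops the run (if there is one) and puts a one in its place. -/
theorem exists_incBits_eq (l : List Bool) : ∃ k rest, l = List.replicate k true ++ rest ∧
    rest.head? ≠ some true ∧ incBits l = List.replicate k false ++ true :: rest.tail := by
  induction l with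
  | nil => exact ⟨0, [], rfl, by simp, rfl⟩
  | cons b l ih =>
    cases b with
    | false => exact ⟨0, false :: l, rfl, by simp, rfl⟩
    | true =>
      obtain ⟨k, rest, h1, h2, h3⟩ := ih
      exact ⟨k + 1, rest, by rw [List.replicate_succ, h1]; rfl, h2, by
        rw [List.replicate_succ, incBits, h3]; rfl⟩

theorem encodeNat_foldr (l : List Bool) (n : ℕ) (h : n ≠ 0 ∨ ∀ b ∈ l, b = true) :
    encodeNat (l.foldr Nat.bit n) = l ++ encodeNat n := by
  induction l with
  | nil => rfl
  | cons b l ih =>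
    rw [List.foldr_cons, encodeNat_bit, ih, List.cons_append]
    · exact h.imp_right fun h b hb => h b (List.mem_cons_of_mem _ hb)
    · rcases h with h | h
      · left
        clear ih
        induction l with
        | nil => exact h
        | cons c l ih => cases c <;> simp [Nat.bit, ih]
      · exact Or.inr (h b List.mem_cons_self)

theorem foldr_encodeNat (n : ℕ) : (encodeNat n).foldr Nat.bit 0 = n := by
  induction n using Nat.binaryRec' with
  | zero => rfl
  | bit b n h ih =>
    rw [encodeNat_bit, List.foldr_cons, ih]
    by_cases hn : n = 0
    · exact Or.inr (h hn)
    · exact Or.inl hn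

theorem foldr_bit_eq (l : List Bool) (n : ℕ) :
    l.foldr Nat.bit n = 2 ^ l.length * n + l.foldr Nat.bit 0 := by
  induction l with
  | nil => simp
  | cons b l ih =>
    rw [List.foldr_cons, ih, List.foldr_cons, List.length_cons, pow_succ]
    cases b <;> simp [Nat.bit] <;> ring

theorem foldr_bit_replicate_false (k n : ℕ) :
    (List.replicate k false).foldr Nat.bit n = 2 ^ k * n := by
  induction k with
  | zero => simp
  | succ k ih =>
    rw [List.replicate_succ, List.foldr_cons, ih, pow_succ]
    simp [Nat.bit]; ring

theorem foldr_bit_ne_zero (l : List Bool) : l.foldr Nat.bit 0 ≠ 0 ↔ l.any id = true := by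
  induction l with
  | nil => simp
  | cons b l ih => cases b <;> simp [Nat.bit, ← ih]

theorem any_encodeNat (d : ℕ) : (encodeNat d).any id = decide (d ≠ 0) := by
  rw [Bool.eq_iff_iff, ← foldr_bit_ne_zero, foldr_encodeNat, decide_eq_true_iff]

theorem encodeNat_two_pow (k : ℕ) : encodeNat (2 ^ k) = List.replicate k false ++ [true] := by
  rw [← mul_one (2 ^ k), ← foldr_bit_replicate_false, encodeNat_foldr _ _ (Or.inl one_ne_zero)]
  rfl

/-- The five lowest binary digits. -/
def fiveBits (j : ℕ) : List Bool :=
  [j, j / 2, j / 4, j / 8, j / 16].map fun i => decide (i % 2 = 1)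

/-- A state number splits into five low digits and the digits of the block. For block 0 the low
digits must not end in a superfluous zero, and 31 is the only position of that block to which
references point. -/
theorem encodeNat_add (b j : ℕ) (hj : j < 32) (h : b ≠ 0 ∨ j = 31) :
    encodeNat (b * 32 + j) = fiveBits j ++ encodeNat b := by
  rw [← encodeNat_foldr]
  · have key (i n : ℕ) : Nat.bit (decide (i % 2 = 1)) n = 2 * n + i % 2 := by
      rcases Nat.mod_two_eq_zero_or_one i with h | h <;> simp [h, Nat.bit]
    congr 1
    simp only [fiveBits, List.map_cons, List.map_nil, List.foldr_cons, List.foldr_nil, key]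
    omega
  · refine h.imp_right fun h => ?_
    subst h
    decide

/-- Two's complement negation. The flag tells that a digit `1` has occurred before. -/
def negBits : Bool → List Bool → List Bool
  | _, [] => []
  | s, b :: l => (s ^^ b) :: negBits (s || b) l

theorem length_negBits (s : Bool) (l : List Bool) : (negBits s l).length = l.length := by
  induction l generalizing s with
  | nil => rfl
  | cons b l ih => simp [negBits, ih]

theorem foldr_negBits_true (l : List Bool) :
    (negBits true l).foldr Nat.bit 0 + l.foldr Nat.bit 0 + 1 = 2 ^ l.length := by
  induction l with
  | nil => rfl
  | cons b l ih => cases b <;> simp [negBits, Nat.bit, pow_succ] <;> omega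

/-- Trailing zeros and the first one are copied; the digits after it are complemented, and a word
and its complement add up to all ones. -/
theorem foldr_negBits_false (l : List Bool) (h : l.any id = true) :
    (negBits false l).foldr Nat.bit 0 + l.foldr Nat.bit 0 = 2 ^ l.length := by
  induction l with
  | nil => simp at h
  | cons b l ih =>
    cases b with
    | false =>
      have := ih (by simpa using h)
      simp [negBits, Nat.bit, pow_succ]; omega
    | true =>
      have := foldr_negBits_true l
      simp [negBits, Nat.bit, pow_succ]; omega

/-- The digits of `2ᴸ - d`, up to the last one. -/
def negDigits (L d : ℕ) : List Bool :=
  negBits false (encodeNat d) ++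
    List.replicate (L - (encodeNat d).length) (decide (d ≠ 0))

theorem length_negDigits {L d : ℕ} (h : (encodeNat d).length < L) :
    (negDigits L d).length = L := by
  rw [negDigits, List.length_append, length_negBits, List.length_replicate]; omega

theorem foldr_replicate_true (k : ℕ) : (List.replicate k true).foldr Nat.bit 0 + 1 = 2 ^ k := by
  induction k with
  | zero => rfl
  | succ k ih =>
    rw [List.replicate_succ, List.foldr_cons, pow_succ, ← ih]
    simp [Nat.bit]; ring

theorem foldr_negDigits {L d : ℕ} (h : (encodeNat d).length < L) (hd : d ≠ 0) :
    (negDigits L d).foldr Nat.bit 0 + d = 2 ^ L := by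
  have h1 := foldr_negBits_false (encodeNat d) (by rw [any_encodeNat]; simpa using hd)
  rw [foldr_encodeNat] at h1
  have h2 := foldr_replicate_true (L - (encodeNat d).length)
  rw [negDigits, List.foldr_append, foldr_bit_eq, length_negBits]
  simp only [ne_eq, hd, not_false_eq_true, decide_true]
  rw [add_assoc, h1, ← Nat.mul_succ, Nat.succ_eq_add_one, h2, ← pow_add]
  congr 1
  omega

/-- The digits that follow `negDigits L d` in `2ᴸ - d`. -/
def tailBits₁ (d : ℕ) : List Bool := if d = 0 then [true] else []

/-- The digits that follow `negDigits L d` in `2 * 2ᴸ - d`. -/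
def tailBits₂ (d : ℕ) : List Bool := if d = 0 then [false, true] else [true]

theorem encodeNat_two_pow_sub {L d : ℕ} (h : (encodeNat d).length < L) :
    encodeNat (2 ^ L - d) = negDigits L d ++ tailBits₁ d := by
  by_cases hd : d = 0
  · subst hd
    rw [Nat.sub_zero, encodeNat_two_pow]; rfl
  -- As `d` has fewer than `L` digits, the padding by ones is nonempty, so the word ends in a one
  -- and is the canonical encoding.
  · have h1 : ∃ l, negDigits L d = l ++ [true] := by
      obtain ⟨k, hk⟩ := Nat.exists_eq_add_of_lt h
      have : L - (encodeNat d).length = k + 1 := by omega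
      exact ⟨negBits false (encodeNat d) ++ List.replicate k true, by
        rw [negDigits, this, List.replicate_succ', List.append_assoc]; simp [hd]⟩
    have h2 := foldr_negDigits h hd
    obtain ⟨l, hl⟩ := h1
    rw [show 2 ^ L - d = (negDigits L d).foldr Nat.bit 0 by omega, hl, List.foldr_append,
      tailBits₁, if_neg hd, List.append_nil]
    exact encodeNat_foldr l 1 (Or.inl one_ne_zero)

theorem encodeNat_two_mul_two_pow_sub {L d : ℕ} (h : (encodeNat d).length < L) :
    encodeNat (2 * 2 ^ L - d) = negDigits L d ++ tailBits₂ d := by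
  by_cases hd : d = 0
  · subst hd
    rw [Nat.sub_zero, ← pow_succ', encodeNat_two_pow, List.replicate_succ', List.append_assoc]
    rfl
  · have h2 := foldr_negDigits h hd
    have h3 := foldr_bit_eq (negDigits L d) 1
    rw [length_negDigits h] at h3
    rw [show 2 * 2 ^ L - d = (negDigits L d).foldr Nat.bit 1 by omega,
      encodeNat_foldr _ _ (Or.inl one_ne_zero), tailBits₂, if_neg hd]
    rfl

end SqrtReduction

end

section

open Computability StackProg

namespace SqrtReduction

open Loc

/-! ### The text of the instance -/

/-- The stacks of the program. -/
inductive Tape where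
  | input | output | text | zeros | zeros₂ | index | prevIndex | diff | rev | tail₁ | tail₂
  | scratch
  deriving DecidableEq

open Tape

instance : Fintype Tape :=
  ⟨{input, output, text, zeros, zeros₂, index, prevIndex, diff, rev, tail₁, tail₂, scratch},
    fun k => by cases k <;> decide⟩

def bits (l : List Bool) : List Γ' := l.map Γ'.bit

def lit (l : List Γ') : List (Piece Tape) := l.map .sym

/-- The content of a text. -/
def render (S : Tape → List Γ') (ps : List (Piece Tape)) : List Γ' := ps.flatMap (Piece.render S)

variable {S : Tape → List Γ'}

theorem render_append (ps qs : List (Piece Tape)) :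
    render S (ps ++ qs) = render S ps ++ render S qs := List.flatMap_append

theorem render_cons_sym (a : Γ') (ps : List (Piece Tape)) :
    render S (.sym a :: ps) = a :: render S ps := rfl

theorem render_cons_stack (k : Tape) (ps : List (Piece Tape)) :
    render S (.stack k :: ps) = S k ++ render S ps := rfl

theorem render_nil : render S [] = [] := rfl

theorem render_lit (l : List Γ') : render S (lit l) = l := by
  induction l with
  | nil => rfl
  | cons a l ih => exact congrArg (a :: ·) ih

def listText {α : Type} (f : α → List (Piece Tape)) (l : List α) : List (Piece Tape) :=
  (l.flatMap fun a => .sym .comma :: f a) ++ [.sym .ket]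

theorem list_eq_flatMap {α : Type} (e : α → List Γ') (l : List α) :
    Code.list e l = (l.flatMap fun a => Γ'.comma :: e a) ++ [Γ'.ket] := by
  induction l with
  | nil => rfl
  | cons a l ih => simp [Code.list, ih]

theorem render_listText {α β : Type} {f : α → List (Piece Tape)} {e : β → List Γ'} {g : α → β}
    {l : List α} (h : ∀ a ∈ l, render S (f a) = e (g a)) :
    render S (listText f l) = Code.list e (l.map g) := by
  induction l with
  | nil => rfl
  | cons a l ih =>
    have h1 : listText f (a :: l) = .sym .comma :: (f a ++ listText f l) := by simp [listText]
    rw [h1, render_cons_sym, render_append, ih fun a ha => h a (List.mem_cons_of_mem _ ha),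
      h a List.mem_cons_self]
    rfl

def refText : Ref → List (Piece Tape)
  | .here l => lit (bits (fiveBits l.number)) ++ [.stack index, .sym .blank]
  | .prev => lit (bits (fiveBits 31)) ++ [.stack prevIndex, .sym .blank]
  | .base => lit (bits (fiveBits 31)) ++ [.sym .blank]

/-- The denominators `4ᵉ` and `2ᵉ` are runs of zeros followed by a one, so unary copies of `2 e` and
`e` serve as their digits. The remaining rewards do not depend on `e` and `d`. -/
def rewardText : Reward → List (Piece Tape)
  | .oneSub => [.sym (.bit false), .stack diff, .stack tail₁, .sym .blank, .stack zeros₂,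
      .sym (.bit true), .sym .blank]
  | .twoSub => [.sym (.bit false), .stack diff, .stack tail₂, .sym .blank, .stack zeros₂,
      .sym (.bit true), .sym .blank]
  | .small => [.sym (.bit false), .sym (.bit true), .sym .blank, .stack zeros, .sym (.bit true),
      .sym .blank]
  | .negSmall => [.sym (.bit true), .sym (.bit true), .sym .blank, .stack zeros,
      .sym (.bit true), .sym .blank]
  | r => lit (Code.frac (r.frac 0 0))

/-- The numbers of the last available actions at a position. -/
def lastActions (l : Loc) : List ℕ :=
  (List.finRange 8).map fun i => if l.binary ∧ i = l.controller then 1 else 0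

/-- The actions of the controller of a position. -/
def actions (l : Loc) : List Bool := if l.binary then [false, true] else [false]

def stateText (l : Loc) : List (Piece Tape) :=
  lit (Code.list Code.nat (lastActions l)) ++
    (listText (fun a => refText (l.succ a)) (actions l) ++
      listText (fun i => rewardText (l.reward i)) (List.finRange 8))

def blockText (b : ℕ) : List (Piece Tape) :=
  (List.range 32).flatMap fun j => .sym .comma :: stateText (locOf b j)

/-- The data that describe the state at a position of the block with the numbers `e` and `d`. -/
def stateData (e d : ℕ) (v : ℕ × Loc) : List ℕ × List ℕ × List (ℤ × ℕ+) :=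
  (lastActions v.2, (actions v.2).map fun a => stateNumber ((v.2.succ a).target v.1),
    (List.finRange 8).map fun i => (v.2.reward i).frac e d)

def blockCode (e d b : ℕ) : List Γ' :=
  (List.range 32).flatMap fun j => .comma :: Code.state (stateData e d (b, locOf b j))

/-- The stacks hold the numbers that occur in the block. -/
structure Prepared (S : Tape → List Γ') (e d b : ℕ) : Prop where
  zeros : S zeros = List.replicate e (.bit false)
  zeros₂ : b ≠ 0 → S zeros₂ = List.replicate (2 * e) (.bit false)
  index : b ≠ 0 → S index = bits (encodeNat b)
  prevIndex : b ≠ 0 → S prevIndex = bits (encodeNat (b - 1))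
  diff : b ≠ 0 → S diff = bits (negDigits (2 * e) d)
  tail₁ : b ≠ 0 → S tail₁ = bits (tailBits₁ d)
  tail₂ : b ≠ 0 → S tail₂ = bits (tailBits₂ d)
  length_lt : (encodeNat d).length < 2 * e

theorem nat_eq (n : ℕ) : Code.nat n = bits (encodeNat n) ++ [.blank] := rfl

theorem bits_append (l m : List Bool) : bits (l ++ m) = bits l ++ bits m := List.map_append

theorem nat_stateNumber {b : ℕ} {l : Loc} (h : b ≠ 0 ∨ l.number = 31) :
    Code.nat (stateNumber (b, l)) =
      bits (fiveBits l.number) ++ (bits (encodeNat b) ++ [.blank]) := by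
  rw [stateNumber, nat_eq, encodeNat_add _ _ l.number_lt h, bits_append, List.append_assoc]

theorem number_entrance (b : ℕ) : (entrance b).2.number = 31 := by
  cases b <;> rfl

theorem nat_two_pow (k : ℕ) :
    Code.nat (2 ^ k) = List.replicate k (.bit false) ++ [.bit true, .blank] := by
  rw [nat_eq, encodeNat_two_pow, bits_append, List.append_assoc, bits, List.map_replicate]
  rfl

theorem natCast_two_pow (k : ℕ) : ((2 ^ k : ℕ+) : ℕ) = 2 ^ k := by simp

theorem four_pow (k : ℕ) : 4 ^ k = 2 ^ (2 * k) := by rw [pow_mul]; norm_num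

theorem le_two_pow {L d : ℕ} (h : (encodeNat d).length < L) : d ≤ 2 ^ L :=
  (lt_two_pow_length_encodeNat d).le.trans (Nat.pow_le_pow_right two_pos h.le)

theorem int_natCast (n : ℕ) : Code.int n = .bit false :: Code.nat n := by
  rw [Code.int, Int.natAbs_natCast]
  simp

variable {e d b : ℕ}

theorem Prepared.render_rewardText (h : Prepared S e d b) (r : Reward)
    (hr : b ≠ 0 ∨ (r ≠ .oneSub ∧ r ≠ .twoSub)) :
    render S (rewardText r) = Code.frac (r.frac e d) := by
  have hle := le_two_pow h.length_lt
  have h4 : ((4 ^ e : ℕ+) : ℕ) = 2 ^ (2 * e) := by rw [← four_pow]; simp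
  have hi1 : ((4 : ℤ) ^ e - d) = ((2 ^ (2 * e) - d : ℕ) : ℤ) := by
    rw [Nat.cast_sub hle, ← four_pow]; simp
  have hi2 : (2 * (4 : ℤ) ^ e - d) = ((2 * 2 ^ (2 * e) - d : ℕ) : ℤ) := by
    rw [Nat.cast_sub (by omega), ← four_pow]; simp
  cases r with
  | zero => exact render_lit _
  | one => exact render_lit _
  | two => exact render_lit _
  | negOne => exact render_lit _
  | oneSub =>
    have hb := hr.resolve_right fun h => h.1 rfl
    simp only [rewardText, Reward.frac, Code.frac, Code.prod, hi1, int_natCast, h4, nat_two_pow,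
      render_cons_sym, render_cons_stack, render_nil, h.zeros₂ hb, h.diff hb, h.tail₁ hb]
    rw [nat_eq, encodeNat_two_pow_sub h.length_lt, bits_append]
    simp
  | twoSub =>
    have hb := hr.resolve_right fun h => h.2 rfl
    simp only [rewardText, Reward.frac, Code.frac, Code.prod, hi2, int_natCast, h4, nat_two_pow,
      render_cons_sym, render_cons_stack, render_nil, h.zeros₂ hb, h.diff hb, h.tail₂ hb]
    rw [nat_eq, encodeNat_two_mul_two_pow_sub h.length_lt, bits_append]
    simp
  | small =>
    simp only [rewardText, Reward.frac, Code.frac, Code.prod, natCast_two_pow, nat_two_pow,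
      render_cons_sym, render_cons_stack, render_nil, h.zeros]
    rfl
  | negSmall =>
    simp only [rewardText, Reward.frac, Code.frac, Code.prod, natCast_two_pow, nat_two_pow,
      render_cons_sym, render_cons_stack, render_nil, h.zeros]
    rfl


theorem Prepared.render_stateText (h : Prepared S e d b) {l : Loc}
    (hl : b ≠ 0 ∨ l = Loc.base ∨ l = pad) :
    render S (stateText l) = Code.state (stateData e d (b, l)) := by
  have hbase : render S (refText .base) = Code.nat (stateNumber (Ref.target b .base)) := by
    rw [refText, Ref.target, ← Prod.mk.eta (p := entrance 0),
      nat_stateNumber (Or.inr (number_entrance 0)), render_append, render_lit]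
    rfl
  have href (r : Ref) (hb : b ≠ 0) :
      render S (refText r) = Code.nat (stateNumber (r.target b)) := by
    cases r with
    | base => exact hbase
    | here l =>
      rw [refText, Ref.target, nat_stateNumber (Or.inl hb), render_append, render_lit,
        ← h.index hb]
      rfl
    | prev =>
      rw [refText, Ref.target, ← Prod.mk.eta (p := entrance (b - 1)),
        nat_stateNumber (Or.inr (number_entrance _)), render_append, render_lit, number_entrance]
      change _ = _ ++ (bits (encodeNat (b - 1)) ++ _)
      rw [← h.prevIndex hb]
      rfl
  have hact (a : Bool) :
      render S (refText (l.succ a)) = Code.nat (stateNumber ((l.succ a).target b)) := by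
    rcases hl with hb | rfl | rfl
    · exact href _ hb
    · exact hbase
    · exact hbase
  have hrew (i : Fin 8) :
      render S (rewardText (l.reward i)) = Code.frac ((l.reward i).frac e d) := by
    refine h.render_rewardText _ (hl.imp_right ?_)
    rintro (rfl | rfl)
    · fin_cases i <;> exact ⟨Reward.noConfusion, Reward.noConfusion⟩
    · exact ⟨Reward.noConfusion, Reward.noConfusion⟩
  rw [stateText, render_append, render_append, render_lit,
    render_listText (fun a _ => hact a), render_listText (fun i _ => hrew i)]
  rfl

theorem Prepared.render_blockText (h : Prepared S e d b) :
    render S (blockText b) = blockCode e d b := by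
  rw [render, blockText, List.flatMap_assoc, blockCode]
  refine List.flatMap_congr fun j _ => ?_
  refine congrArg (Γ'.comma :: ·) (h.render_stateText ?_)
  by_cases hb : b = 0
  · subst hb
    right
    by_cases hj : j = 31 <;> simp [locOf, hj]
  · exact Or.inl hb

/-- The text to be written is the same in all later blocks; this makes a fixed, finite program
possible. -/
theorem blockText_of_ne (hb : b ≠ 0) : blockText b = blockText 1 := by
  refine List.flatMap_congr fun j _ => ?_
  simp [locOf, hb]

theorem range_mul_flatMap {α : Type} (n k : ℕ) (f : ℕ → List α) :
    (List.range (n * k)).flatMap f =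
      (List.range n).flatMap fun b => (List.range k).flatMap fun j => f (b * k + j) := by
  induction n with
  | zero => simp
  | succ n ih =>
    rw [Nat.succ_mul, List.range_add, List.flatMap_append, ih, List.range_succ,
      List.flatMap_append, List.flatMap_map]
    simp

theorem ofFn_val {α : Type} {m n : ℕ} (h : m = n) (f : ℕ → α) :
    List.ofFn (fun a : Fin m => f a) = (List.range n).map f := by
  subst h
  rw [List.ofFn_eq_map, ← List.map_coe_finRange_eq_range, List.map_map]
  rfl

/-- The text that follows the states. -/
def finalText : List (Piece Tape) :=
  .sym .ket :: (refText .prev ++ (lit ([.comma, .comma] ++ Code.frac (0, 1) ++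
    [.comma, .comma, .bit false]) ++ (.stack input :: .stack zeros ::
      lit ([.bit false, .bit true, .blank] ++
        Code.list Code.threshold (List.replicate 6 .negInf) ++
        Code.list Code.threshold (List.replicate 8 .posInf)))))

theorem gameInstance_eq (x : List ℕ × ℕ) : Code.gameInstance (gameInstance x) =
    Code.nat 2 ++ ((List.range (x.1.length + 1)).flatMap fun b =>
      blockCode (size x + b) (entryAt x b) b) ++ [.ket] ++
      (Code.nat (stateNumber (entrance x.1.length)) ++
        (Code.list Code.threshold (List.ofFn (gameInstance x).lower) ++
          Code.list Code.threshold (List.ofFn (gameInstance x).upper))) := by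
  have hstates : (List.ofFn fun s : Fin (gameInstance x).numStates =>
      (List.ofFn fun i => (((gameInstance x).maxAction s i : Fin _) : ℕ),
       List.ofFn fun a => (((gameInstance x).table s a : Fin _) : ℕ),
       List.ofFn fun i => (gameInstance x).reward s i)) =
      (List.range ((x.1.length + 1) * 32)).map fun s =>
        stateData (size x + (position s).1) (entryAt x (position s).1) (position s) := by
    rw [← ofFn_val rfl]
    refine congrArg List.ofFn (funext fun s : States x => ?_)
    refine Prod.ext ?_ (Prod.ext ?_ ?_)
    · dsimp only
      rw [List.ofFn_eq_map]
      change _ = lastActions _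
      refine List.map_congr_left fun i _ => ?_
      rw [maxAction_eq]
      split <;> rfl
    · have hb : (position s).1 ≤ x.1.length := position_lt s
      -- Only the controller contributes to the number of legal profiles, so the table has two
      -- entries or one.
      have h1 : ∏ i, (((gameInstance x).maxAction s i : ℕ) + 1) =
          if (position s).2.binary then 2 else 1 := by
        rw [Finset.prod_eq_single (position s).2.controller]
        · rw [maxAction_eq]
          by_cases h : (position s).2.binary = true <;> simp [h]
        · intro i _ hi
          rw [maxAction_eq, if_neg fun h => hi h.2]
          rfl
        · simp
      have h2 := ofFn_val h1 fun a : ℕ =>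
        stateNumber (((position s).2.succ (a = 1)).target (position s).1)
      refine Eq.trans ?_ (h2.trans ?_)
      · refine congrArg List.ofFn (funext fun a => ?_)
        rw [table_eq, val_state]
        exact ((valid_succ (position_cases s) _).2.trans hb)
      · rw [stateData, actions]
        by_cases h : (position s).2.binary = true <;> simp [h, List.range_succ]
    · dsimp only
      rw [List.ofFn_eq_map]
      rfl
  rw [Code.gameInstance, Code.prod, Code.prod, Code.prod, Code.prod, hstates, list_eq_flatMap,
    List.flatMap_map, range_mul_flatMap]
  have hblock : ((List.range (x.1.length + 1)).flatMap fun b => (List.range 32).flatMap fun j =>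
      Γ'.comma :: Code.state (stateData (size x + (position (b * 32 + j)).1)
        (entryAt x (position (b * 32 + j)).1) (position (b * 32 + j)))) =
      (List.range (x.1.length + 1)).flatMap fun b =>
        blockCode (size x + b) (entryAt x b) b := by
    refine List.flatMap_congr fun b _ => List.flatMap_congr fun j hj => ?_
    have hj := List.mem_range.1 hj
    have : position (b * 32 + j) = (b, locOf b j) := by
      rw [position, show (b * 32 + j) / 32 = b by omega, show (b * 32 + j) % 32 = j by omega]
    rw [this]
  rw [hblock]
  have hinit : (((gameInstance x).init : Fin _) : ℕ) = stateNumber (entrance x.1.length) :=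
    val_state (v := entrance x.1.length) le_rfl
  rw [hinit]
  simp [gameInstance]

/-- After `n` entries the stack `prevIndex` holds `n`, the number of the initial block, and the
input still holds `k`, the numerator of the threshold. The literal zero after `zeros` supplies the
`+ 1` in its exponent. -/
theorem render_finalText {x : List ℕ × ℕ} (hin : S input = Code.nat x.2)
    (hz : S zeros = List.replicate (size x + x.1.length) (.bit false))
    (hp : S prevIndex = bits (encodeNat x.1.length)) :
    render S finalText = [.ket] ++
      (Code.nat (stateNumber (entrance x.1.length)) ++
        (Code.list Code.threshold (List.ofFn (gameInstance x).lower) ++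
          Code.list Code.threshold (List.ofFn (gameInstance x).upper))) := by
  have h1 : (List.ofFn (gameInstance x).lower) = .frac (0, 1) ::
      .frac (x.2, 2 ^ (size x + x.1.length + 1)) :: List.replicate 6 .negInf := rfl
  have h2 : (List.ofFn (gameInstance x).upper) = List.replicate 8 .posInf := rfl
  rw [h1, h2, ← Prod.mk.eta (p := entrance x.1.length),
    nat_stateNumber (Or.inr (number_entrance _)), number_entrance]
  have h3 : (entrance x.1.length).1 = x.1.length := rfl
  simp only [finalText, render_cons_sym, render_append, render_lit, render_cons_stack, hin, hz,
    refText, hp, h3, Code.list, Code.threshold, Code.frac, Code.prod, int_natCast,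
    natCast_two_pow, nat_two_pow, List.replicate_succ' (n := size x + x.1.length), render_nil]
  simp

end SqrtReduction

end

section

open Computability StackProg

namespace StackProg

/-- A step pushes at most one symbol, so running times bound output lengths. -/
theorem Exec.length_le {K Γ σ : Type} [DecidableEq K] {P : StackProg K Γ σ} {v v' : σ}
    {S S' : K → List Γ} {t : ℕ} (h : P.Exec v S v' S' t) (k : K) :
    (S' k).length ≤ (S k).length + t := by
  induction h with
  | push j f v S => by_cases hj : k = j <;> simp [hj]
  | pop j f v S =>
    by_cases hj : k = j
    · subst hj; simp; omega
    · simp [hj]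
  | load => omega
  | seq => omega
  | ite_true => omega
  | ite_false => omega
  | loop_false => omega
  | loop_true => omega

theorem Runs.length_le {K Γ σ : Type} [DecidableEq K] {P : StackProg K Γ σ} {v v' : σ}
    {S S' : K → List Γ} {T : ℕ} (h : P.Runs v S v' S' T) (k : K) :
    (S' k).length ≤ (S k).length + T := by
  obtain ⟨t, ht, h⟩ := h
  exact (h.length_le k).trans (by omega)

theorem contrib_singleton_self {K : Type} [DecidableEq K] (k : K) (f : Γ' → Γ') :
    contrib [(k, f)] k = fun a => [f a] := by
  funext a; simp [contrib]

theorem contrib_singleton_of_ne {K : Type} [DecidableEq K] {j k : K} (h : j ≠ k) (f : Γ' → Γ') :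
    contrib [(k, f)] j = fun _ => [] := by
  funext a; simp [contrib, h.symm]

theorem contrib_eq {K : Type} [DecidableEq K] (outs : List (K × (Γ' → Γ'))) (j : K) :
    contrib outs j = fun a => ((outs.filter (·.1 = j)).map fun q => q.2 a).reverse := rfl

end StackProg

namespace SqrtReduction

open Tape

/-! ### The program -/

/-- The contents of the stacks. -/
structure Stacks where
  input : List Γ' := []
  output : List Γ' := []
  text : List Γ' := []
  zeros : List Γ' := []
  zeros₂ : List Γ' := []
  index : List Γ' := []
  prevIndex : List Γ' := []
  diff : List Γ' := []
  rev : List Γ' := []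
  tail₁ : List Γ' := []
  tail₂ : List Γ' := []
  scratch : List Γ' := []

def Stacks.get (s : Stacks) : Tape → List Γ'
  | .input => s.input
  | .output => s.output
  | .text => s.text
  | .zeros => s.zeros
  | .zeros₂ => s.zeros₂
  | .index => s.index
  | .prevIndex => s.prevIndex
  | .diff => s.diff
  | .rev => s.rev
  | .tail₁ => s.tail₁
  | .tail₂ => s.tail₂
  | .scratch => s.scratch

def Stacks.set (s : Stacks) (k : Tape) (l : List Γ') : Stacks :=
  match k with
  | .input => { s with input := l }
  | .output => { s with output := l }
  | .text => { s with text := l }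
  | .zeros => { s with zeros := l }
  | .zeros₂ => { s with zeros₂ := l }
  | .index => { s with index := l }
  | .prevIndex => { s with prevIndex := l }
  | .diff => { s with diff := l }
  | .rev => { s with rev := l }
  | .tail₁ => { s with tail₁ := l }
  | .tail₂ => { s with tail₂ := l }
  | .scratch => { s with scratch := l }

theorem Stacks.update_get (s : Stacks) (k : Tape) (l : List Γ') :
    Function.update s.get k l = (s.set k l).get := by
  funext j
  cases k <;> cases j <;> rfl

abbrev Program := StackProg Tape Γ' Register

theorem runs_push_stacks (k : Tape) (f : Register → Γ') (v : Register) (s : Stacks) :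
    StackProg.Runs (push k f) v s.get v (s.set k (f v :: s.get k)).get 1 :=
  s.update_get k _ ▸ runs_push k f v s.get

theorem runs_pop_stacks (k : Tape) (f : Register → Option Γ' → Register) (v : Register)
    (s : Stacks) : StackProg.Runs (pop k f) v s.get (f v (s.get k).head?)
      (s.set k (s.get k).tail).get 1 :=
  s.update_get k _ ▸ runs_pop k f v s.get

/-- Empty a stack. -/
def clear (k : Tape) : Program := drain k []

theorem runs_clear (k : Tape) (v : Register) (s : Stacks) :
    (clear k).Runs v s.get (none, v.2) (s.set k []).get (3 * (s.get k).length + 2) := by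
  refine (runs_drain (k := k) (outs := []) (by simp) v s.get).mono' ?_ (by simp)
  rw [← s.update_get]
  funext j
  by_cases hj : j = k
  · subst hj; simp
  · simp [hj, contrib]

/-- Add one to the binary number on a stack. -/
def increment (k : Tape) : Program :=
  seq (xfer k (fun a => decide (a = some (.bit true))) [(scratch, fun _ => .bit false)])
    (seq (push k fun _ => .bit true) (drain scratch [(k, id)]))

theorem runs_increment {k : Tape} (hk : k ≠ scratch) (v : Register) (s : Stacks) {l : List Bool}
    (hl : s.get k = bits l) (hs : s.scratch = []) :
    (increment k).Runs v s.get (none, v.2) (s.set k (bits (incBits l))).get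
      (8 * l.length + 10) := by
  obtain ⟨j, r, h1, h2, h3⟩ := exists_incBits_eq l
  have e1 := runs_xfer (k := k) (p := fun a => decide (a = some (.bit true)))
    (outs := [(scratch, fun _ => .bit false)]) (by simpa using hk.symm)
    (bits (List.replicate j true)) (bits r) (by simp [bits]) (by
      cases r with
      | nil => simp [bits]
      | cons b r => simpa [bits] using h2) v s.get (by rw [hl, h1, bits_append])
  have e2 := e1.seq ((runs_push k (fun _ => Γ'.bit true) _ _).seq
    (runs_drain (k := scratch) (outs := [(k, id)]) (by simpa using hk) _ _))
  refine e2.mono' ?_ ?_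
  · rw [← s.update_get]
    funext i
    have hs' : s.get scratch = [] := hs
    have hd : (bits (List.replicate j true)).reverse.flatMap (fun _ => [Γ'.bit false]) =
        List.replicate j (Γ'.bit false) := by
      simp [bits, ← List.map_eq_flatMap]
    by_cases hi : i = scratch
    · subst hi; simp [hk.symm, hs']
    by_cases hik : i = k
    · subst hik
      simp only [if_neg hi, contrib_singleton_self, Function.update_of_ne (Ne.symm hi),
        Function.update_self, if_neg (Ne.symm hi), hd, hs', h3]
      simp [bits]
    · have hnil (m : List Γ') : m.flatMap (fun _ => ([] : List Γ')) = [] :=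
        List.flatMap_eq_nil_iff.2 fun _ _ => rfl
      simp [hi, hik, contrib_singleton_of_ne hi, contrib_singleton_of_ne hik, hnil]
  · have hlen : l.length = j + r.length := by rw [h1]; simp
    have hs' : s.get scratch = [] := hs
    simp [hs', hk.symm, contrib, bits]
    omega

def isBit : Option Γ' → Bool
  | some (.bit _) => true
  | _ => false

def negSymbol (s : Bool) : Option Γ' → Γ'
  | some (.bit b) => .bit (s ^^ b)
  | _ => .blank

/-- Negate a digit of the input. -/
def negateDigit : Program :=
  seq (push rev fun v => negSymbol v.2 v.1) <|
  seq (load fun v => (v.1, v.2 || decide (v.1 = some (.bit true)))) <|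
  seq (pop zeros₂ fun v _ => v) <|
  seq (push scratch fun _ => .bit false) (read input)

/-- The flag records whether a one has been read. Each digit moves a zero from `zeros₂` to
`scratch`, so that afterwards `zeros₂` counts the digits missing up to length `L` and `scratch`
allows it to be restored. -/
theorem runs_negateDigits (l : List Bool) (r : List Γ') (N : ℕ) (f : Bool) (s : Stacks)
    (hz : s.zeros₂ = List.replicate (l.length + N) (.bit false))
    (hi : s.input = (bits l ++ .blank :: r).tail) :
    StackProg.Runs (loop (fun v => isBit v.1) negateDigit) ((bits l ++ .blank :: r).head?, f)
      s.get (some .blank, f || l.any id)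
      { s with
        input := r
        rev := (bits (negBits f l)).reverse ++ s.rev
        zeros₂ := List.replicate N (.bit false)
        scratch := List.replicate l.length (.bit false) ++ s.scratch : Stacks }.get
      (6 * l.length + 1) := by
  induction l generalizing f s with
  | nil =>
    have h := runs_loop_false (c := fun v : Register => isBit v.1) (A := negateDigit)
      (v := (some .blank, f)) (S := s.get) rfl
    obtain ⟨⟩ := s
    simp only [List.length_nil, Nat.zero_add, bits, List.map_nil, List.nil_append,
      List.tail_cons] at hz hi
    subst hz hi
    simpa [bits, negBits] using h
  | cons b l ih =>
    have h1 := ((runs_push_stacks rev (fun v => negSymbol v.2 v.1) (some (.bit b), f) s).seq <|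
      (runs_load (fun v : Register => (v.1, v.2 || decide (v.1 = some (.bit true)))) _ _).seq <|
      (runs_pop_stacks zeros₂ (fun v _ => v) _ _).seq <|
      (runs_push_stacks scratch (fun _ => .bit false) _ _).seq <|
      (runs_pop_stacks input (fun v a => (a, v.2)) _ _))
    have hi' : s.input = bits l ++ .blank :: r := hi
    have h2 := Runs.loop_true (c := fun v : Register => isBit v.1) rfl h1
      (v₃ := (some .blank, f || (b :: l).any id))
      (S₃ := Stacks.get { s with
        input := r
        rev := (bits (negBits f (b :: l))).reverse ++ s.rev
        zeros₂ := List.replicate N (.bit false)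
        scratch := List.replicate (b :: l).length (.bit false) ++ s.scratch : Stacks })
      (T₂ := 6 * l.length + 1) (by
        have h3 := ih (f || b) { s with
          input := s.input.tail
          rev := .bit (f ^^ b) :: s.rev
          zeros₂ := s.zeros₂.tail
          scratch := .bit false :: s.scratch } (by
            rw [hz, List.length_cons, Nat.add_right_comm, List.replicate_succ]; rfl)
          (by rw [hi'])
        have e1 : (f || b || l.any id) = (f || (b :: l).any id) := by
          simp [Bool.or_assoc]
        have e2 : (f || decide (some (Γ'.bit b) = some (Γ'.bit true))) = (f || b) := by
          cases b <;> simp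
        have e3 : (bits (negBits f (b :: l))).reverse ++ s.rev =
            (bits (negBits (f || b) l)).reverse ++ .bit (f ^^ b) :: s.rev := by
          simp [negBits, bits]
        have e4 : List.replicate (b :: l).length (Γ'.bit false) ++ s.scratch =
            List.replicate l.length (Γ'.bit false) ++ .bit false :: s.scratch := by
          rw [List.length_cons, List.replicate_succ', List.append_assoc]; rfl
        rw [e1, ← hi'] at h3
        rw [e3, e4]
        dsimp only
        rw [e2]
        exact h3)
    refine h2.mono ?_
    simp only [List.length_cons]
    omega

end SqrtReduction

end

/-! ### Processing one number of the input -/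

section

open Computability StackProg

namespace SqrtReduction

open Tape

/-- Read a number and write the digits of its negative. -/
def negate : Program :=
  seq (read input) <|
  seq (loop (fun v => isBit v.1) negateDigit) <|
  seq (ite (fun v => v.2)
    (seq (drain zeros₂ [(rev, fun _ => .bit true), (scratch, id)])
      (push tail₂ fun _ => .bit true))
    (seq (drain zeros₂ [(rev, fun _ => .bit false), (scratch, id)])
      (seq (push tail₁ fun _ => .bit true)
        (seq (push tail₂ fun _ => .bit true) (push tail₂ fun _ => .bit false))))) <|
  seq (drain rev [(diff, id)]) (drain scratch [(zeros₂, id)])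

theorem flatMap_singleton_const {l : List Γ'} (a : Γ') :
    (l.flatMap fun _ => [a]) = List.replicate l.length a := by
  rw [← List.map_eq_flatMap, List.map_const']

theorem flatMap_nil_const {l : List Γ'} : (l.flatMap fun _ => ([] : List Γ')) = [] :=
  List.flatMap_eq_nil_iff.2 fun _ _ => rfl

theorem runs_drain_zeros₂ (c : Bool) (n : ℕ) (v : Register) (s : Stacks)
    (hz : s.zeros₂ = List.replicate n (.bit false)) :
    (drain zeros₂ [(rev, fun _ => .bit c), (scratch, id)]).Runs v s.get (none, v.2)
      { s with
        zeros₂ := []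
        rev := List.replicate n (.bit c) ++ s.rev
        scratch := List.replicate n (.bit false) ++ s.scratch : Stacks }.get (5 * n + 2) := by
  refine (runs_drain (k := zeros₂) (outs := [(rev, fun _ => .bit c), (scratch, id)])
    (by simp) v s.get).mono' ?_ ?_
  · funext j
    cases j <;> simp [Stacks.get, contrib_eq, hz, flatMap_nil_const, flatMap_singleton_const]
  · simp [Stacks.get, hz]

theorem runs_drain_rev (v : Register) (s : Stacks) :
    (drain rev [(diff, id)]).Runs v s.get (none, v.2)
      { s with rev := [], diff := s.rev.reverse ++ s.diff : Stacks }.get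
      (4 * s.rev.length + 2) := by
  refine (runs_drain (k := rev) (outs := [(diff, id)]) (by simp) v s.get).mono' ?_ ?_
  · funext j
    cases j <;> simp [Stacks.get, contrib_eq, flatMap_nil_const]
  · simp [Stacks.get]

theorem runs_drain_scratch (v : Register) (s : Stacks) :
    (drain scratch [(zeros₂, id)]).Runs v s.get (none, v.2)
      { s with scratch := [], zeros₂ := s.scratch.reverse ++ s.zeros₂ : Stacks }.get
      (4 * s.scratch.length + 2) := by
  refine (runs_drain (k := scratch) (outs := [(zeros₂, id)]) (by simp) v s.get).mono' ?_ ?_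
  · funext j
    cases j <;> simp [Stacks.get, contrib_eq, flatMap_nil_const]
  · simp [Stacks.get]

theorem runs_negate {d L : ℕ} (hd : (encodeNat d).length < L) (r : List Γ') (a : Option Γ')
    (s : Stacks) (hz : s.zeros₂ = List.replicate L (.bit false))
    (hi : s.input = Code.nat d ++ r) (hrev : s.rev = []) (hdiff : s.diff = [])
    (ht₁ : s.tail₁ = []) (ht₂ : s.tail₂ = []) (hs : s.scratch = []) :
    negate.Runs (a, false) s.get (none, decide (d ≠ 0))
      { s with
        input := r
        diff := bits (negDigits L d)
        tail₁ := bits (tailBits₁ d)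
        tail₂ := bits (tailBits₂ d) : Stacks }.get (20 * L + 20) := by
  obtain ⟨N, hN⟩ : ∃ N, L = (encodeNat d).length + N := ⟨L - (encodeNat d).length, by omega⟩
  have hi' : s.input = bits (encodeNat d) ++ .blank :: r := by
    rw [hi, nat_eq, List.append_assoc]; rfl
  have h1 := runs_pop_stacks input (fun v a => (a, v.2)) (a, false) s
  have h2 := runs_negateDigits (encodeNat d) r N false (s.set input (s.get input).tail)
    (hz.trans (by rw [hN])) (congrArg List.tail hi')
  rw [any_encodeNat, Bool.false_or, ← hi'] at h2
  have h3 : StackProg.Runs (ite (fun v => v.2)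
    (seq (drain zeros₂ [(rev, fun _ => .bit true), (scratch, id)])
      (push tail₂ fun _ => .bit true))
    (seq (drain zeros₂ [(rev, fun _ => .bit false), (scratch, id)])
      (seq (push tail₁ fun _ => .bit true)
        (seq (push tail₂ fun _ => .bit true) (push tail₂ fun _ => .bit false)))))
      (some .blank, decide (d ≠ 0))
      { s with
        input := r
        rev := (bits (negBits false (encodeNat d))).reverse ++ s.rev
        zeros₂ := List.replicate N (.bit false)
        scratch := List.replicate (encodeNat d).length (.bit false) ++ s.scratch : Stacks }.get
      (none, decide (d ≠ 0))
      { s with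
        input := r
        zeros₂ := []
        rev := (bits (negDigits L d)).reverse
        tail₁ := bits (tailBits₁ d)
        tail₂ := bits (tailBits₂ d)
        scratch := List.replicate L (.bit false) : Stacks }.get (5 * N + 6) := by
    -- The `N` missing positions are filled by sign extension: ones if `d` is nonzero, zeros
    -- otherwise.
    have e1 : (bits (negDigits L d)).reverse = List.replicate N (.bit (decide (d ≠ 0))) ++
        ((bits (negBits false (encodeNat d))).reverse ++ s.rev) := by
      rw [negDigits, hrev, bits_append, List.reverse_append, List.append_nil,
        show L - (encodeNat d).length = N by omega]
      simp [bits]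
    have e2 : List.replicate L (Γ'.bit false) = List.replicate N (.bit false) ++
        (List.replicate (encodeNat d).length (.bit false) ++ s.scratch) := by
      rw [hs, List.append_nil, List.replicate_append_replicate, hN, Nat.add_comm]
    rw [e1, e2]
    by_cases h : d = 0
    · have hf : decide (d ≠ 0) = false := by simpa using h
      rw [hf]
      refine (Runs.ite_false rfl ((runs_drain_zeros₂ false N _ _ rfl).seq
        ((runs_push_stacks tail₁ (fun _ => .bit true) _ _).seq
        ((runs_push_stacks tail₂ (fun _ => .bit true) _ _).seq
        (runs_push_stacks tail₂ (fun _ => .bit false) _ _))))).mono' ?_ (by omega)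
      funext j
      cases j <;> simp [Stacks.get, Stacks.set, tailBits₁, tailBits₂, h, ht₁, ht₂, bits]
    · have hf : decide (d ≠ 0) = true := by simpa using h
      rw [hf]
      refine (Runs.ite_true rfl ((runs_drain_zeros₂ true N _ _ rfl).seq
        (runs_push_stacks tail₂ (fun _ => .bit true) _ _))).mono' ?_ (by omega)
      funext j
      cases j <;> simp [Stacks.get, Stacks.set, tailBits₁, tailBits₂, h, ht₁, ht₂, bits]
  refine (h1.seq (h2.seq (h3.seq ((runs_drain_rev _ _).seq
    (runs_drain_scratch _ _))))).mono' ?_ ?_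
  · funext j
    cases j <;> simp [Stacks.get, hdiff, hrev, hs, hz]
  · simp [bits, length_negDigits hd]
    omega

/-- The contents of the stacks when the states of `n + 1` blocks have been written. The numbers
have size at most `m`. -/
def Stacks.between (m n : ℕ) (input text : List Γ') : Stacks where
  input := input
  text := text
  zeros := List.replicate (m + n) (.bit false)
  zeros₂ := List.replicate (2 * (m + n)) (.bit false)
  index := bits (encodeNat (n + 1))
  prevIndex := bits (encodeNat n)

/-- Process one entry of the list in the input. -/
def processEntry : Program :=
  seq (push zeros fun _ => .bit false) <|
  seq (push zeros₂ fun _ => .bit false) <|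
  seq (push zeros₂ fun _ => .bit false) <|
  seq negate <|
  seq (emit text scratch (blockText 1)) <|
  seq (clear diff) <| seq (clear tail₁) <| seq (clear tail₂) <|
  seq (increment index) <| seq (increment prevIndex) (read input)

theorem length_tailBits₁_le (d : ℕ) : (tailBits₁ d).length ≤ 2 := by
  rw [tailBits₁]; split <;> simp

theorem length_tailBits₂_le (d : ℕ) : (tailBits₂ d).length ≤ 2 := by
  rw [tailBits₂]; split <;> simp

theorem not_mem_lit (k : Tape) (l : List Γ') : Piece.stack k ∉ lit l := by simp [lit]

/-- The stacks that occur in the description of a state. -/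
def IsNumeral (k : Tape) : Prop :=
  k = zeros ∨ k = zeros₂ ∨ k = index ∨ k = prevIndex ∨ k = diff ∨ k = tail₁ ∨ k = tail₂

theorem isNumeral_of_mem_refText {k : Tape} {r : Ref} (h : Piece.stack k ∈ refText r) :
    IsNumeral k := by
  cases r <;> simp [refText, not_mem_lit] at h <;> simp [IsNumeral, h]

theorem isNumeral_of_mem_rewardText {k : Tape} {r : Reward} (h : Piece.stack k ∈ rewardText r) :
    IsNumeral k := by
  cases r <;> simp [rewardText, not_mem_lit] at h <;> unfold IsNumeral <;> tauto

theorem isNumeral_of_mem_listText {α : Type} {f : α → List (Piece Tape)} {l : List α} {k : Tape}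
    (hf : ∀ a, Piece.stack k ∈ f a → IsNumeral k) (h : Piece.stack k ∈ listText f l) :
    IsNumeral k := by
  simp [listText] at h
  obtain ⟨a, _, h⟩ := h
  exact hf a h

theorem isNumeral_of_mem_blockText {k : Tape} {b : ℕ} (h : Piece.stack k ∈ blockText b) :
    IsNumeral k := by
  obtain ⟨j, _, h⟩ := List.mem_flatMap.1 h
  have h := (List.mem_cons.1 h).resolve_left (by simp)
  rw [stateText, List.mem_append, List.mem_append] at h
  rcases h with h | h | h
  · exact absurd h (not_mem_lit _ _)
  · exact isNumeral_of_mem_listText (fun _ => isNumeral_of_mem_refText) h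
  · exact isNumeral_of_mem_listText (fun _ => isNumeral_of_mem_rewardText) h

theorem IsNumeral.ne {k : Tape} (h : IsNumeral k) : k ≠ text ∧ k ≠ scratch := by
  rcases h with rfl | rfl | rfl | rfl | rfl | rfl | rfl <;> decide

theorem runs_processEntry {m n d : ℕ} (hd : (encodeNat d).length + 1 ≤ m) (r : List Γ')
    (txt : List Γ') :
    processEntry.Runs (some .comma, false) (Stacks.between m n (Code.nat d ++ r) txt).get
      (r.head?, false)
      (Stacks.between m (n + 1) r.tail
        ((blockCode (m + (n + 1)) d (n + 1)).reverse ++ txt)).get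
      ((blockText 1).length * (18 * (m + n + 1) + 4) + 100 * (m + n + 1) + 100) := by
  have hd' : (encodeNat d).length < 2 * (m + (n + 1)) := by omega
  have h1 := (runs_push_stacks zeros (fun _ => .bit false) (some .comma, false)
    (Stacks.between m n (Code.nat d ++ r) txt))
  have h2 := runs_push_stacks zeros₂ (fun _ => .bit false) (some .comma, false)
    ((Stacks.between m n (Code.nat d ++ r) txt).set zeros
      (List.replicate (m + (n + 1)) (.bit false)))
  have h3 := runs_push_stacks zeros₂ (fun _ => .bit false) (some .comma, false)
    (((Stacks.between m n (Code.nat d ++ r) txt).set zeros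
      (List.replicate (m + (n + 1)) (.bit false))).set zeros₂
        (List.replicate (2 * (m + n) + 1) (.bit false)))
  have h4 := runs_negate hd' r (some .comma) { Stacks.between m n (Code.nat d ++ r) txt with
    zeros := List.replicate (m + (n + 1)) (.bit false)
    zeros₂ := List.replicate (2 * (m + (n + 1))) (.bit false) : Stacks } rfl rfl rfl rfl rfl rfl rfl
  set s : Stacks := { Stacks.between m n r txt with
    zeros := List.replicate (m + (n + 1)) (.bit false)
    zeros₂ := List.replicate (2 * (m + (n + 1))) (.bit false)
    diff := bits (negDigits (2 * (m + (n + 1))) d)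
    tail₁ := bits (tailBits₁ d)
    tail₂ := bits (tailBits₂ d) } with hs
  have hprep : Prepared s.get (m + (n + 1)) d (n + 1) :=
    ⟨rfl, fun _ => rfl, fun _ => rfl, fun _ => rfl, fun _ => rfl, fun _ => rfl, fun _ => rfl, hd'⟩
  -- A crude common bound for the stacks copied into the text; the number of binary digits of `n` is
  -- at most `n`.
  have hlen (k : Tape) (hk : IsNumeral k) : (s.get k).length ≤ 2 * (m + (n + 1)) := by
    have := length_encodeNat_le n
    have := length_encodeNat_le (n + 1)
    have := length_tailBits₁_le d
    have := length_tailBits₂_le d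
    have := length_negDigits hd'
    rcases hk with rfl | rfl | rfl | rfl | rfl | rfl | rfl <;>
      simp [hs, Stacks.between, Stacks.get, bits] <;> omega
  have h5 := runs_emit (o := text) (t := scratch) (by decide) (2 * (m + (n + 1))) (blockText 1)
    (fun k hk => (isNumeral_of_mem_blockText hk).ne) (none, decide (d ≠ 0)) s.get rfl
    (fun k hk => hlen k (isNumeral_of_mem_blockText hk))
  have hren : (blockText 1).flatMap (Piece.render s.get) =
      blockCode (m + (n + 1)) d (n + 1) := by
    rw [← blockText_of_ne n.succ_ne_zero]
    exact hprep.render_blockText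
  rw [hren, s.update_get] at h5
  set s' : Stacks := { s with text := (blockCode (m + (n + 1)) d (n + 1)).reverse ++ txt } with hs'
  have h6 := runs_clear diff (none, false) s'
  have h7 := runs_clear tail₁ (none, false) { s' with diff := [] }
  have h8 := runs_clear tail₂ (none, false) { s' with diff := [], tail₁ := [] }
  have h9 := runs_increment (k := index) (by decide) (none, false)
    { s' with diff := [], tail₁ := [], tail₂ := [] } (l := encodeNat (n + 1)) rfl rfl
  have h10 := runs_increment (k := prevIndex) (by decide) (none, false)
    { s' with diff := [], tail₁ := [], tail₂ := [], index := bits (incBits (encodeNat (n + 1))) }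
    (l := encodeNat n) rfl rfl
  have h11 := runs_pop_stacks input (fun v a => (a, v.2)) (none, false)
    { s' with
      diff := [], tail₁ := [], tail₂ := [], index := bits (incBits (encodeNat (n + 1)))
      prevIndex := bits (incBits (encodeNat n)) }
  have h := h1.seq (h2.seq (h3.seq (h4.seq (h5.seq (h6.seq (h7.seq (h8.seq (h9.seq
    (h10.seq h11)))))))))
  refine h.mono' ?_ ?_
  · rw [← encodeNat_succ, ← encodeNat_succ]; rfl
  · have := length_encodeNat_le n
    have := length_encodeNat_le (n + 1)
    have := length_tailBits₁_le d
    have := length_tailBits₂_le d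
    have e1 : (s'.get diff).length = 2 * (m + (n + 1)) := by
      simp [hs', hs, Stacks.get, bits, length_negDigits hd']
    have e2 : (s'.get tail₁).length = (tailBits₁ d).length := by
      simp [hs', hs, Stacks.get, bits]
    have e3 : (s'.get tail₂).length = (tailBits₂ d).length := by
      simp [hs', hs, Stacks.get, bits]
    have e4 : 9 * (2 * (m + (n + 1))) + 4 = 18 * (m + n + 1) + 4 := by ring
    have e5 : ({ s' with diff := [] } : Stacks).get tail₁ = s'.get tail₁ := rfl
    have e6 : ({ s' with diff := [], tail₁ := [] } : Stacks).get tail₂ = s'.get tail₂ := rfl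
    rw [e4, e5, e6, e1, e2, e3]
    omega

end SqrtReduction

end

/-! ### The whole program and its polynomial running time -/

section

open Computability StackProg

namespace SqrtReduction

open Tape

/-- Write two unary copies of the length of the input. -/
def measureInput : Program :=
  seq (drain input [(scratch, id), (zeros, fun _ => .bit false), (zeros₂, fun _ => .bit false),
    (zeros₂, fun _ => .bit false)]) (drain scratch [(input, id)])

theorem replicate_two_mul (n : ℕ) (l : List Γ') (hl : l.length = n) :
    (l.flatMap fun _ => [Γ'.bit false, Γ'.bit false]) =
      List.replicate (2 * n) (.bit false) := by
  induction l generalizing n with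
  | nil => subst hl; rfl
  | cons a l ih =>
    subst hl
    rw [List.flatMap_cons, ih _ rfl]
    rfl

theorem runs_measureInput (v : Register) (l : List Γ') :
    measureInput.Runs v { input := l : Stacks }.get (none, v.2)
      { input := l
        zeros := List.replicate l.length (.bit false)
        zeros₂ := List.replicate (2 * l.length) (.bit false) : Stacks }.get
      (11 * l.length + 4) := by
  have h1 := runs_drain (k := input) (outs := [(scratch, id), (zeros, fun _ => .bit false),
    (zeros₂, fun _ => .bit false), (zeros₂, fun _ => .bit false)]) (by simp) v
    { input := l : Stacks }.get
  have h2 := runs_drain (k := scratch) (outs := [(input, id)]) (by simp) (none, v.2)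
    { zeros := List.replicate l.length (.bit false)
      zeros₂ := List.replicate (2 * l.length) (.bit false), scratch := l.reverse : Stacks }.get
  have e : (fun j => if j = input then [] else
      (({ input := l : Stacks }.get input).reverse.flatMap (contrib [(scratch, id),
        (zeros, fun _ => .bit false), (zeros₂, fun _ => .bit false),
        (zeros₂, fun _ => .bit false)] j)) ++ { input := l : Stacks }.get j) =
      { zeros := List.replicate l.length (.bit false)
        zeros₂ := List.replicate (2 * l.length) (.bit false), scratch := l.reverse : Stacks }.get := by
    funext j
    cases j <;> simp [Stacks.get, contrib_eq, flatMap_nil_const, flatMap_singleton_const,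
      replicate_two_mul]
  rw [e] at h1
  refine (h1.seq h2).mono' ?_ ?_
  · funext j
    cases j <;> simp [Stacks.get, contrib_eq, flatMap_nil_const]
  · simp [Stacks.get]
    omega

/-- Write the states of the first block. -/
def writeFirstBlock : Program :=
  seq measureInput <| seq (emit text scratch (lit (Code.nat 2) ++ blockText 0)) <|
    seq (increment index) (read input)

/-- Write the text that follows the states. -/
def writeFinalText : Program :=
  seq (emit text scratch finalText) <| seq (clear input) <| seq (clear zeros) <|
    seq (clear zeros₂) <| seq (clear index) (clear prevIndex)

/-- The program that computes the reduction. -/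
def reduction : Program :=
  seq (seq writeFirstBlock <|
    seq (loop (fun v => decide (v.1 = some .comma)) processEntry) writeFinalText)
    (drain text [(output, id)])

/-- The constant `c` bounds the numeral sizes in all rounds at once, so each round has the same
cost. -/
theorem runs_processEntries (m c : ℕ) (l : List ℕ) (r : List Γ') (n : ℕ) (txt : List Γ')
    (hl : ∀ d ∈ l, (encodeNat d).length + 1 ≤ m) (hc : m + n + l.length ≤ c) :
    StackProg.Runs (loop (fun v => decide (v.1 = some .comma)) processEntry)
      ((Code.list Code.nat l ++ r).head?, false)
      (Stacks.between m n (Code.list Code.nat l ++ r).tail txt).get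
      (some .ket, false)
      (Stacks.between m (n + l.length) r (((List.range l.length).flatMap fun j =>
        blockCode (m + (n + 1 + j)) (l.getD j 0) (n + 1 + j)).reverse ++ txt)).get
      (l.length * ((blockText 1).length * (18 * c + 4) + 100 * c + 101) + 1) := by
  induction l generalizing n txt with
  | nil => exact (runs_loop_false rfl).mono' (by simp [Code.list]) (by simp)
  | cons d l ih =>
    have h1 := runs_processEntry (n := n) (hl d List.mem_cons_self) (Code.list Code.nat l ++ r) txt
    have h2 := ih (n + 1) ((blockCode (m + (n + 1)) d (n + 1)).reverse ++ txt)
      (fun d hd => hl d (List.mem_cons_of_mem _ hd)) (by rw [List.length_cons] at hc; omega)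
    have e : Code.list Code.nat (d :: l) ++ r =
        .comma :: (Code.nat d ++ (Code.list Code.nat l ++ r)) := by simp [Code.list]
    rw [e]
    have h3 := Runs.loop_true (c := fun v : Register => decide (v.1 = some .comma))
      (v₁ := (some .comma, false)) rfl h1 h2
    refine h3.mono' ?_ ?_
    · have e2 : ((List.range (d :: l).length).flatMap fun j =>
          blockCode (m + (n + 1 + j)) ((d :: l).getD j 0) (n + 1 + j)) =
          blockCode (m + (n + 1)) d (n + 1) ++ (List.range l.length).flatMap fun j =>
            blockCode (m + (n + 1 + 1 + j)) (l.getD j 0) (n + 1 + 1 + j) := by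
        rw [List.length_cons, List.range_succ_eq_map, List.flatMap_cons, List.flatMap_map]
        refine congrArg (blockCode (m + (n + 1)) d (n + 1) ++ ·) (List.flatMap_congr fun j _ => ?_)
        rw [List.getD_cons_succ, Nat.succ_eq_add_one,
          show n + 1 + (j + 1) = n + 1 + 1 + j by omega]
      rw [e2, List.reverse_append, List.append_assoc, List.length_cons,
        show n + (l.length + 1) = n + 1 + l.length by omega]
    · rw [List.length_cons] at hc ⊢
      have h4 : (blockText 1).length * (18 * (m + n + 1) + 4) ≤
          (blockText 1).length * (18 * c + 4) := Nat.mul_le_mul_left _ (by omega)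
      rw [Nat.add_mul l.length 1, Nat.one_mul]
      omega

/-- A bound for the running time of the part of the program that precedes the output. -/
def timeBound (m : ℕ) : ℕ :=
  (lit (Code.nat 2) ++ blockText 0).length * (9 * (2 * m) + 4) +
    m * ((blockText 1).length * (18 * (2 * m) + 4) + 100 * (2 * m) + 101) +
    finalText.length * (9 * (2 * m) + 4) + 100 * m + 100

theorem length_le_size (x : List ℕ × ℕ) : x.1.length ≤ size x := by
  have h (l : List ℕ) : l.length ≤ (Code.list Code.nat l).length := by
    induction l with
    | nil => simp
    | cons a l ih => simp [Code.list]; omega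
  rw [size, Code.sqrtSumInstance, Code.prod, List.length_append]
  exact (h _).trans (Nat.le_add_right _ _)

theorem runs_writeFirstBlock (x : List ℕ × ℕ) :
    writeFirstBlock.Runs (none, false) { input := Code.sqrtSumInstance x : Stacks }.get
      ((Code.sqrtSumInstance x).head?, false)
      (Stacks.between (size x) 0 (Code.sqrtSumInstance x).tail
        (Code.nat 2 ++ blockCode (size x + 0) (entryAt x 0) 0).reverse).get
      (11 * size x + 4 + ((lit (Code.nat 2) ++ blockText 0).length * (9 * (2 * size x) + 4) + 1 +
        (8 * 0 + 10 + 1))) := by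
  have h1 := runs_measureInput (none, false) (Code.sqrtSumInstance x)
  let s : Stacks := { input := Code.sqrtSumInstance x
                      zeros := List.replicate (size x) (.bit false)
                      zeros₂ := List.replicate (2 * size x) (.bit false) }
  have hd0 := length_encodeNat_entryAt x 0
  have hprep : Prepared s.get (size x + 0) (entryAt x 0) 0 :=
    ⟨rfl, fun h => absurd rfl h, fun h => absurd rfl h, fun h => absurd rfl h,
      fun h => absurd rfl h, fun h => absurd rfl h, fun h => absurd rfl h, by omega⟩
  have hlen (k : Tape) (hk : IsNumeral k) : (s.get k).length ≤ 2 * size x := by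
    rcases hk with rfl | rfl | rfl | rfl | rfl | rfl | rfl <;>
      simp [s, Stacks.get]
    omega
  have hmem (k : Tape) (hk : Piece.stack k ∈ lit (Code.nat 2) ++ blockText 0) : IsNumeral k :=
    isNumeral_of_mem_blockText ((List.mem_append.1 hk).resolve_left (not_mem_lit _ _))
  have h2 := runs_emit (o := text) (t := scratch) (by decide) (2 * size x)
    (lit (Code.nat 2) ++ blockText 0) (fun k hk => (hmem k hk).ne) (none, false) s.get rfl
    (fun k hk => hlen k (hmem k hk))
  have hren : (lit (Code.nat 2) ++ blockText 0).flatMap (Piece.render s.get) =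
      Code.nat 2 ++ blockCode (size x + 0) (entryAt x 0) 0 := by
    rw [List.flatMap_append]
    exact congrArg₂ _ (render_lit _) hprep.render_blockText
  have htext : s.get text = [] := rfl
  rw [hren, s.update_get, htext, List.append_nil] at h2
  generalize (Code.nat 2 ++ blockCode (size x + 0) (entryAt x 0) 0).reverse = txt at h2 ⊢
  -- An empty stack denotes 0: after this increment `index` holds 1 and the untouched `prevIndex`
  -- holds 0, as the first entry requires.
  have h3 := runs_increment (k := index) (by decide) (none, false) (s.set text txt) (l := [])
    rfl rfl
  have h4 := runs_pop_stacks input (fun v a => (a, v.2)) (none, false)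
    (Stacks.between (size x) 0 (Code.sqrtSumInstance x) txt)
  exact h1.seq (h2.seq (h3.seq h4))

theorem runs_writeFinalText {m n : ℕ} {txt inp out : List Γ'} (hn : n ≤ m) (hi : inp.length ≤ m)
    (hout : (finalText.flatMap (Piece.render (Stacks.between m n inp txt).get)).reverse ++ txt =
      out) (a : Option Γ') :
    writeFinalText.Runs (a, false) (Stacks.between m n inp txt).get (none, false)
      { text := out : Stacks }.get
      (finalText.length * (9 * (2 * m) + 4) + 40 * m + 40) := by
  have hlog := length_encodeNat_le n
  have hlog' := length_encodeNat_le (n + 1)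
  have hmem (j : Tape) (hj : Piece.stack j ∈ finalText) :
      j = input ∨ j = zeros ∨ j = prevIndex := by
    simp [finalText, refText, not_mem_lit] at hj
    tauto
  have h1 := runs_emit (o := text) (t := scratch) (by decide) (2 * m) finalText
    (fun j hj => by rcases hmem j hj with rfl | rfl | rfl <;> decide) (a, false)
    (Stacks.between m n inp txt).get rfl (fun j hj => by
      rcases hmem j hj with rfl | rfl | rfl <;>
        simp [Stacks.between, Stacks.get, bits] <;> omega)
  have htext : (Stacks.between m n inp txt).get text = txt := rfl
  rw [htext, hout, Stacks.update_get] at h1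
  have h2 := runs_clear input (none, false) (Stacks.between m n inp out)
  have h3 := runs_clear zeros (none, false) (Stacks.between m n [] out)
  have h4 := runs_clear zeros₂ (none, false) { Stacks.between m n [] out with zeros := [] }
  have h5 := runs_clear index (none, false)
    { Stacks.between m n [] out with zeros := [], zeros₂ := [] }
  have h6 := runs_clear prevIndex (none, false)
    { Stacks.between m n [] out with zeros := [], zeros₂ := [], index := [] }
  refine (h1.seq (h2.seq (h3.seq (h4.seq (h5.seq h6))))).mono' rfl ?_
  simp only [Stacks.get, Stacks.between, List.length_replicate, bits, List.length_map]
  omega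

theorem runs_reduction (x : List ℕ × ℕ) :
    reduction.Runs (none, false) (single input (Code.sqrtSumInstance x)) (none, false)
      (single output (Code.gameInstance (gameInstance x))) (5 * timeBound (size x) + 2) := by
  have hn := length_le_size x
  have hin : Code.sqrtSumInstance x = Code.list Code.nat x.1 ++ Code.nat x.2 := rfl
  have hk : (Code.nat x.2).length ≤ size x := by rw [size, hin, List.length_append]; omega
  have h1 := runs_writeFirstBlock x
  have h2 := runs_processEntries (size x) (2 * size x) x.1 (Code.nat x.2) 0
    (Code.nat 2 ++ blockCode (size x + 0) (entryAt x 0) 0).reverse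
    (fun d hd => by
      have := length_list_nat x.1 hd
      rw [size, hin, List.length_append]; omega) (by omega)
  rw [← hin, Nat.zero_add, ← List.reverse_append] at h2
  have h3 := runs_writeFinalText hn hk rfl (some .ket)
    (txt := ((Code.nat 2 ++ blockCode (size x + 0) (entryAt x 0) 0) ++
      (List.range x.1.length).flatMap fun j =>
        blockCode (size x + (0 + 1 + j)) (x.1.getD j 0) (0 + 1 + j)).reverse)
  have hren := render_finalText (S := (Stacks.between (size x) x.1.length (Code.nat x.2)
    ((Code.nat 2 ++ blockCode (size x + 0) (entryAt x 0) 0) ++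
      (List.range x.1.length).flatMap fun j =>
        blockCode (size x + (0 + 1 + j)) (x.1.getD j 0) (0 + 1 + j)).reverse).get) (x := x)
    rfl rfl rfl
  -- Entry `j` of the list, counted from 0, belongs to block `j + 1`.
  have hblocks : (List.range x.1.length).flatMap (fun j =>
      blockCode (size x + (0 + 1 + j)) (x.1.getD j 0) (0 + 1 + j)) =
      (List.range x.1.length).flatMap fun j =>
        blockCode (size x + j.succ) (entryAt x j.succ) j.succ := by
    refine List.flatMap_congr fun j _ => ?_
    rw [Nat.zero_add, Nat.add_comm 1 j]
    rfl
  rw [render] at hren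
  rw [hren, ← List.reverse_append, hblocks] at h3
  rw [hblocks] at h2
  have hout : ((Code.nat 2 ++ blockCode (size x + 0) (entryAt x 0) 0) ++
      (List.range x.1.length).flatMap fun j =>
        blockCode (size x + j.succ) (entryAt x j.succ) j.succ) ++ ([.ket] ++
      (Code.nat (stateNumber (entrance x.1.length)) ++
        (Code.list Code.threshold (List.ofFn (gameInstance x).lower) ++
          Code.list Code.threshold (List.ofFn (gameInstance x).upper)))) =
      Code.gameInstance (gameInstance x) := by
    rw [gameInstance_eq, List.range_succ_eq_map, List.flatMap_cons, List.flatMap_map]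
    simp only [List.append_assoc]
  rw [hout] at h3
  generalize Code.gameInstance (gameInstance x) = out at h3 ⊢
  have hA := (h1.seq (h2.seq h3)).mono (T' := timeBound (size x)) (by
    have := Nat.mul_le_mul_right
      ((blockText 1).length * (18 * (2 * size x) + 4) + 100 * (2 * size x) + 101) hn
    rw [timeBound]
    omega)
  -- The output is no longer than the time spent on writing it. The final drain, which also reverses
  -- the text into the right order, thus costs at most four more time bounds plus two.
  have hlen : out.length ≤ timeBound (size x) := by
    have := hA.length_le text
    simpa [Stacks.get] using this
  have h4 := runs_drain (k := text) (outs := [(output, id)]) (by simp) (none, false)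
    { text := out.reverse : Stacks }.get
  have hstart : { input := Code.sqrtSumInstance x : Stacks }.get =
      single input (Code.sqrtSumInstance x) := by
    funext j
    cases j <;> rfl
  rw [← hstart]
  refine (hA.seq h4).mono' ?_ ?_
  · funext j
    cases j <;> simp [Stacks.get, single, contrib_eq, flatMap_nil_const]
  · have e : (({ text := out.reverse : Stacks }.get text)).length = out.length := by
      simp [Stacks.get]
    rw [e]
    simp only [List.length_cons, List.length_nil]
    omega

theorem exists_eval_timeBound : ∃ p : Polynomial ℕ, ∀ m, p.eval m = 5 * timeBound m + 2 := by
  refine ⟨5 * (((lit (Code.nat 2) ++ blockText 0).length : Polynomial ℕ) *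
    (9 * (2 * Polynomial.X) + 4) +
    Polynomial.X * (((blockText 1).length : Polynomial ℕ) * (18 * (2 * Polynomial.X) + 4) +
      100 * (2 * Polynomial.X) + 101) +
    (finalText.length : Polynomial ℕ) * (9 * (2 * Polynomial.X) + 4) + 100 * Polynomial.X +
      100) + 2, fun m => ?_⟩
  simp only [Polynomial.eval_add, Polynomial.eval_mul, Polynomial.eval_natCast,
    Polynomial.eval_ofNat, Polynomial.eval_X, timeBound]
  rfl

theorem nonempty_tm2ComputableInPolyTime : Nonempty (Turing.TM2ComputableInPolyTime
    Code.sqrtSumInstance Code.gameInstance gameInstance) := by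
  obtain ⟨p, hp⟩ := exists_eval_timeBound
  refine StackProg.nonempty_tm2ComputableInPolyTime reduction input output (none, false) p
    fun x => ?_
  obtain ⟨t, ht, h⟩ := runs_reduction x
  exact ⟨t, by rw [hp]; exact ht, h⟩

end SqrtReduction

end

theorem mainTheorem7 :
    PolyTimeReducible Code.sqrtSumInstance Code.gameInstance SqrtSum (StatNE 8)
      {I | I.game.IsTurnBased ∧ I.game.IsTerminalReward} ∧
    ∀ p : ℝ, 0 ≤ p → p ≤ 1 →
      (SqrtGame.game p).IsTurnBased ∧ (SqrtGame.game p).IsTerminalReward ∧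
      IsGreatest
        {v : ℝ | ∃ σ : (SqrtGame.game p).Profile,
          σ.IsStationary ∧ σ.IsNashEquilibrium (.node .s₁) ∧
          0 ≤ σ.payoff (.node .s₁) 0 ∧ v = σ.payoff (.node .s₁) 1}
        (Real.sqrt p) :=
  ⟨⟨SqrtReduction.gameInstance, SqrtReduction.nonempty_tm2ComputableInPolyTime, fun _ =>
    ⟨⟨SqrtReduction.isTurnBased, SqrtReduction.isTerminalReward⟩, SqrtReduction.mem_sqrtSum_iff⟩⟩,
    fun _ h0 h1 => ⟨SqrtGame.isTurnBased_game, SqrtGame.isTerminalReward_game,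
      SqrtGame.isGreatest_payoff h0 h1⟩⟩
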